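/- Let $2<p<\infty$, $\max\{2,\tfrac{p}{p-2}\}\le\alpha<\beta$, $\gamma=\beta-\alpha$ and $k>0$. For $x\in(-1,1)$ put $u(x)=1-|x|^{\alpha}$ and $f_s=-\bigl(|u'|^{p-2}u'\bigr)'$; then $f_s(x)=(p-1)\alpha^{p-1}(\alpha-1)|x|^{(\alpha-1)(p-2)+\alpha-2}$ on $(-1,1)$. There is $C_0>0$, depending only on $p,\alpha,\beta,k$, such that the following holds for every $C\in(0,C_0]$. Let $b:[0,\infty)\to[0,\infty)$ be continuous with $b(0)=0$, $b\in C^1(0,\infty)$ and $b'(s)>k$ for all $s>0$. Let $0<T<\infty$ and let $\psi_1,\psi_2\in L^\infty((-1,1)\times(0,T))$ satisfy (i) $0\le\psi_1\le\psi_2\le\tfrac12|x|^{\beta}\bigl(1-|x|^{\gamma}+Ct\bigr)$ a.e. in $(-1,1)\times(0,T)$; (ii) for every $\tau\in(0,T)$, it is not the case that $\psi_1=\psi_2$ a.e. on $(-1,1)\times(0,\tau)$. Put $h_i(x,t)=f_s(x)+|x|^{\beta}\psi_i(x,t)$ for $i=1,2$, and let $w_i\in C([-1,1]\times[0,T])$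 be a nonnegative weak solution of $$\partial_t b(w_i)-\partial_x\bigl(|\partial_xw_i|^{p-2}\partial_xw_i\bigr)=h_i\ \text{ in }(-1,1)\times(0,T),\qquad w_i(\pm1,t)=0,\qquad w_i(x,0)=u(x).$$ Here a weak solution is a function $w\ge 0$ with $w\in L^p(0,T;W_0^{1,p}(-1,1))$, $b(w)\in L^1((-1,1)\times(0,T))$ and $$\int_0^T\!\!\int_{-1}^1\bigl(-b(w)\,\partial_t\varphi+|\partial_xw|^{p-2}\partial_xw\,\partial_x\varphi\bigr)\,dx\,dt=\int_0^T\!\!\int_{-1}^1h_i\,\varphi\,dx\,dt+\int_{-1}^1b(u(x))\,\varphi(x,0)\,dx$$ for all $\varphi\in C_c^\infty((-1,1)\times(-\infty,T))$. Then there is $t_0\in(0,T)$ such that $w_1\le w_2$ on $(-1,1)\times(0,t_0)$ and $w_1\not\equiv w_2$ on $(-1,1)\times(0,t_0)$, but $w_1(0,t)=w_2(0,t)$ for all $t\in(0,t_0)$; that is, the Strong Comparison Principle fails. Moreover, if $\psi_1=\psi_2=0$ a.e. on $(-1,0)\times(0,t_0)$, then $w_1=w_2=u$ on $(-1,0]\times(0,t_0)$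 and $w_1\not\equiv w_2$ on $(0,1)\times(0,t_0)$. -/

import Mathlib

open Set Filter Topology MeasureTheory
open scoped ContDiff

noncomputable section

namespace DoublyNonlinear

/-- The one-dimensional `p`-Laplacian flux `|s|^(p-2) s`. -/
def flux (p s : ℝ) : ℝ := |s| ^ (p - 2) * s

/-- The space-time cylinder `(-1,1) × (0,T)`; points are pairs `(x, t)`. -/
def cylinder (T : ℝ) : Set (ℝ × ℝ) := Ioo (-1) 1 ×ˢ Ioo 0 T

/-- `v ∈ W₀^{1,p}(-1,1)` with weak derivative `g`: the pair `(v, g)` is an `L^p` limit of pairs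
`(φₙ, φₙ')` with `φₙ ∈ C_c^∞(-1,1)`. -/
def MemW0 (p : ℝ) (v g : ℝ → ℝ) : Prop :=
  MemLp v (ENNReal.ofReal p) (volume.restrict (Ioo (-1) 1)) ∧
  MemLp g (ENNReal.ofReal p) (volume.restrict (Ioo (-1) 1)) ∧
  ∃ φ : ℕ → ℝ → ℝ,
    (∀ n, ContDiff ℝ ∞ (φ n) ∧ HasCompactSupport (φ n) ∧ tsupport (φ n) ⊆ Ioo (-1) 1) ∧
    Tendsto (fun n => eLpNorm (fun x => φ n x - v x) (ENNReal.ofReal p)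
      (volume.restrict (Ioo (-1) 1))) atTop (𝓝 0) ∧
    Tendsto (fun n => eLpNorm (fun x => deriv (φ n) x - g x) (ENNReal.ofReal p)
      (volume.restrict (Ioo (-1) 1))) atTop (𝓝 0)

/-- `w ∈ L^p(0,T; W₀^{1,p}(-1,1))` with spatial weak derivative `g`. -/
def MemEnergySpace (p T : ℝ) (w g : ℝ × ℝ → ℝ) : Prop :=
  MemLp w (ENNReal.ofReal p) (volume.restrict (cylinder T)) ∧
  MemLp g (ENNReal.ofReal p) (volume.restrict (cylinder T)) ∧
  ∀ᵐ t ∂(volume.restrict (Ioo 0 T)), MemW0 p (fun x => w (x, t)) (fun x => g (x, t))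

/-- Test functions: smooth, with compact support in `(-1,1) × (-∞,T)`. They vanish near
`x = ±1` and near `t = T`, but need not vanish at `t = 0`. -/
def IsTestFunction (T : ℝ) (φ : ℝ × ℝ → ℝ) : Prop :=
  ContDiff ℝ ∞ φ ∧ HasCompactSupport φ ∧ tsupport φ ⊆ Ioo (-1) 1 ×ˢ Iio T

/-- `w` is a nonnegative weak solution of `∂ₜ b(w) - (|wₓ|^(p-2) wₓ)ₓ = h` in `(-1,1) × (0,T)`,
`w(±1,t) = 0`, `w(x,0) = u₀(x)`. The lateral condition is `w(·,t) ∈ W₀^{1,p}`; the initial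
condition is the last term of the integral identity. -/
def IsWeakSolution (p : ℝ) (b : ℝ → ℝ) (T : ℝ) (h : ℝ × ℝ → ℝ) (u₀ : ℝ → ℝ)
    (w : ℝ × ℝ → ℝ) : Prop :=
  (∀ᵐ z ∂(volume.restrict (cylinder T)), 0 ≤ w z) ∧
  IntegrableOn (fun z => b (w z)) (cylinder T) ∧
  ∃ g : ℝ × ℝ → ℝ, MemEnergySpace p T w g ∧
    ∀ φ : ℝ × ℝ → ℝ, IsTestFunction T φ →
      ∫ z in cylinder T, (-(b (w z) * deriv (fun s => φ (z.1, s)) z.2)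
          + flux p (g z) * deriv (fun y => φ (y, z.2)) z.1)
        = (∫ z in cylinder T, h z * φ z) + ∫ x in Ioo (-1) 1, b (u₀ x) * φ (x, 0)

/-- The stationary profile `u(x) = 1 - |x|^α`. -/
def profile (α x : ℝ) : ℝ := 1 - |x| ^ α

/-- The stationary source `f_s = -(|u'|^(p-2) u')'` of the profile. -/
def stationarySource (p α x : ℝ) : ℝ :=
  -deriv (fun y => flux p (deriv (profile α) y)) x

/-- The source `h(x,t) = f_s(x) + |x|^β ψ(x,t)`. -/
def source (p α β : ℝ) (ψ : ℝ × ℝ → ℝ) (z : ℝ × ℝ) : ℝ :=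
  stationarySource p α z.1 + |z.1| ^ β * ψ z

end DoublyNonlinear

end

/-! The mechanism is the degeneracy of the diffusion at `x = 0`, where `u' = 0`. The profile `u` is
a stationary solution with source `f_s`, and both sources exceed `f_s` only by `|x|^β ψᵢ`, which
vanishes to high order at the origin. Put `v(x,t) = u(x) + c t |x|^β` with `c = 2/k`. Since `b' >
k`, the increments of `b(v)` grow at rate at least `k c |x|^β = 2|x|^β`. With `m = (α-1)(p-2) + α -
2`, the space derivative of the flux of `v` exceeds `-f_s` by at most a multiple of `c t
|x|^(m+β-α)`. The condition `α ≥ p/(p-2)` says exactly `m ≥ α`, so for short times this excess is at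
most `|x|^β`. Hence `v` is a supersolution with source `f_s + |x|^β`, which dominates both sources
once `ψᵢ ≤ 1`, and `u` is a subsolution. Comparison gives `u ≤ wᵢ ≤ v`, and `u = v = 1` at `x = 0`.
Neither solution can move there.

Comparison also gives `w₁ ≤ w₂`. If the solutions coincided for a short time, so would their
gradients and fluxes; integrating the equation over `(-1,1)` then shows that the ordered sources
have the same integral, hence agree a.e., against (ii). If the perturbations vanish for `x < 0`, the
value `wᵢ(0,t) = 1` serves as lateral data, and comparison with `u` on `(-1,0)` gives `wᵢ = u`
there.

The main tool is `comparison`. No time derivative of `b(w)` is available, so the time variable is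
doubled, while the space variable is shared. The function `H(w₁(x,t) - w₂(x,s))`, with `H` a
smoothed Heaviside function, is tested in the equation of `w₁` at time `t` and in that of `w₂` at
time `s`. Convexity of the entropies bounds increments in time, monotonicity of the flux gives the
diffusion term a sign, and Steklov averages pass to the limit (`doubling_smoothed`). Sharpening `H`
(`doubling`) and concentrating the weight on `s = t` (`integral_diagonal_mul_deriv_nonneg`) show
that `∫ (b(w₁) - b(w₂))⁺ dx` is nonincreasing.

`IsWeakSolution.exists_integratedSolution` supplies the form of the equation used there: two du
Bois-Reymond arguments, in time and then in space, make the time-integrated flux an explicit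
primitive. -/

namespace DoublyNonlinear

/-! ### Translations and Steklov averages in `L^p`. -/

section Translation

variable {E : Type*} [NormedAddCommGroup E] [MeasurableSpace E] [BorelSpace E]
  {μ : Measure E} [μ.IsAddRightInvariant]

lemma memLp_translate {p : ENNReal} {f : E → ℝ} (hf : MemLp f p μ) (v : E) :
    MemLp (fun z => f (z + v)) p μ :=
  hf.comp_measurePreserving (measurePreserving_add_right μ v)

/-- Hölder's inequality bounds the `L¹` norm of each slice by a constant independent of the shift,
because translation preserves the norm. This justifies Fubini for Steklov averages. -/
lemma integrable_prod_translate_mul [SFinite μ] [NormedSpace ℝ E] {p q : ENNReal} [ENNReal.HolderTriple q p 1]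
    {f G : E → ℝ} (hfm : Measurable f) (hGm : Measurable G)
    (hf : MemLp f q μ) (hG : MemLp G p μ) (e : E) (τ : ℝ) :
    Integrable (fun x : E × ℝ => f (x.1 + (-x.2) • e) * G x.1)
      (μ.prod (volume.restrict (Ioc 0 τ))) := by
  have hm : Measurable fun x : E × ℝ => f (x.1 + (-x.2) • e) * G x.1 := by
    refine (hfm.comp ?_).mul (hGm.comp measurable_fst)
    exact (by fun_prop : Continuous fun x : E × ℝ => x.1 + (-x.2) • e).measurable
  refine (integrable_prod_iff' hm.aestronglyMeasurable).2 ⟨.of_forall fun r => ?_, ?_⟩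
  · exact (memLp_translate hf ((-r) • e)).integrable_mul hG
  · have hi : ∀ r : ℝ, Integrable (fun z => f (z + (-r) • e) * G z) μ := fun r =>
      (memLp_translate hf ((-r) • e)).integrable_mul hG
    refine Measure.integrableOn_of_bounded (s_finite := by simp)
      (M := (eLpNorm f q μ * eLpNorm G p μ).toReal)
      (hm.norm.comp measurable_swap).stronglyMeasurable.integral_prod_right'.aestronglyMeasurable (.of_forall fun r => ?_)
    rw [Real.norm_of_nonneg (integral_nonneg fun _ => norm_nonneg _),
      integral_norm_eq_lintegral_enorm (hi r).aestronglyMeasurable]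
    refine ENNReal.toReal_mono (ENNReal.mul_ne_top hf.eLpNorm_ne_top hG.eLpNorm_ne_top) ?_
    have := eLpNorm_smul_le_mul_eLpNorm (p := q) (q := p) (r := 1) hG.aestronglyMeasurable
      (memLp_translate hf ((-r) • e)).aestronglyMeasurable
    rw [eLpNorm_one_eq_lintegral_enorm] at this
    have e2 : eLpNorm (fun z => f (z + (-r) • e)) q μ = eLpNorm f q μ :=
      eLpNorm_comp_measurePreserving hf.aestronglyMeasurable (measurePreserving_add_right μ _)
    rw [e2] at this
    exact this

variable [IsLocallyFiniteMeasure μ] [μ.InnerRegularCompactLTTop]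

/-- Translation is continuous in `L^p`. -/
lemma tendsto_eLpNorm_translate_sub {p : ENNReal} (hp1 : 1 ≤ p) (hp : p ≠ ⊤) {f : E → ℝ}
    (hf : MemLp f p μ) :
    Tendsto (fun v => eLpNorm (fun z => f (z + v) - f z) p μ) (𝓝 0) (𝓝 0) := by
  have : Fact (1 ≤ p) := ⟨hp1⟩
  -- Translations depend continuously on the shift in the compact-open topology, which is what
  -- continuity of composition in `Lp` asks for.
  let T : C(E, C(E, E)) := ContinuousMap.curry ⟨fun x : E × E => x.2 + x.1, by fun_prop⟩
  have hT : ∀ v, MeasurePreserving (T v) μ μ := fun v => measurePreserving_add_right μ v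
  have hc : Continuous fun v => Lp.compMeasurePreserving (T v) (hT v) (hf.toLp f) :=
    continuous_const.compMeasurePreservingLp T.continuous hT hp
  have h0 := (hc.tendsto 0).edist (tendsto_const_nhds
    (x := Lp.compMeasurePreserving (T 0) (hT 0) (hf.toLp f)))
  rw [edist_self] at h0
  refine h0.congr fun v => ?_
  rw [Lp.edist_def]
  refine eLpNorm_congr_ae ?_
  have e1 := Lp.coeFn_compMeasurePreserving (hf.toLp f) (hT v)
  have e2 := Lp.coeFn_compMeasurePreserving (hf.toLp f) (hT 0)
  have e3 := (hT v).quasiMeasurePreserving.ae_eq hf.coeFn_toLp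
  have e4 := (hT 0).quasiMeasurePreserving.ae_eq hf.coeFn_toLp
  filter_upwards [e1, e2, e3, e4] with z h1 h2 h3 h4
  simp only [Pi.sub_apply, h1, h2]
  simp only [Function.comp_apply] at h3 h4 ⊢
  rw [h3, h4]
  simp [T]

lemma continuousAt_integral_translate_mul {p q : ENNReal} [ENNReal.HolderTriple q p 1]
    (hq1 : 1 ≤ q) (hq : q ≠ ⊤) {f G : E → ℝ} (hf : MemLp f q μ) (hG : MemLp G p μ) :
    Tendsto (fun v => ∫ z, f (z + v) * G z ∂μ) (𝓝 0) (𝓝 (∫ z, f z * G z ∂μ)) := by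
  refine tendsto_integral_of_L1 (fun z => f z * G z) (hf.integrable_mul hG).aestronglyMeasurable
    (.of_forall fun v => (memLp_translate hf v).integrable_mul hG) ?_
  have h1 := tendsto_eLpNorm_translate_sub hq1 hq hf
  have h2 : Tendsto (fun v => eLpNorm (fun z => f (z + v) - f z) q μ * eLpNorm G p μ) (𝓝 0)
      (𝓝 0) := by
    have := ENNReal.Tendsto.mul_const h1 (Or.inr hG.eLpNorm_ne_top)
    simpa using this
  refine tendsto_of_tendsto_of_tendsto_of_le_of_le tendsto_const_nhds h2 (fun _ => zero_le) ?_
  intro v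
  have := eLpNorm_smul_le_mul_eLpNorm (p := q) (q := p) (r := 1) hG.aestronglyMeasurable
    ((memLp_translate hf v).sub hf).aestronglyMeasurable
  rw [eLpNorm_one_eq_lintegral_enorm] at this
  refine le_trans (le_of_eq ?_) this
  refine lintegral_congr fun z => ?_
  rw [← sub_mul]
  rfl

/-- Steklov averages along a direction `e` converge weakly. -/
lemma tendsto_steklov [SFinite μ] [NormedSpace ℝ E] {p q : ENNReal} [ENNReal.HolderTriple q p 1]
    (hq1 : 1 ≤ q) (hq : q ≠ ⊤)
    {f G : E → ℝ} (hfm : Measurable f) (hGm : Measurable G)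
    (hf : MemLp f q μ) (hG : MemLp G p μ) (e : E) :
    Tendsto (fun τ : ℝ => τ⁻¹ * ∫ z, (∫ r in Ioc 0 τ, f (z + (-r) • e) * G z) ∂μ) (𝓝[>] 0)
      (𝓝 (∫ z, f z * G z ∂μ)) := by
  -- By Fubini the quantity is the mean of `J` over `(0,τ)`, and `J` is continuous at `0` by
  -- continuity of translations.
  set J : ℝ → ℝ := fun r => ∫ z, f (z + (-r) • e) * G z ∂μ with hJ
  have hswap : ∀ τ, ∫ z, (∫ r in Ioc 0 τ, f (z + (-r) • e) * G z) ∂μ = ∫ r in Ioc 0 τ, J r := by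
    intro τ
    exact integral_integral_swap (integrable_prod_translate_mul hfm hGm hf hG e τ)
  have hJi : ∀ τ, IntegrableOn J (Ioc 0 τ) := fun τ =>
    (integrable_prod_translate_mul hfm hGm hf hG e τ).integral_prod_right
  have hlim : Tendsto J (𝓝 0) (𝓝 (∫ z, f z * G z ∂μ)) := by
    have h := continuousAt_integral_translate_mul hq1 hq hf hG
    have h2 : Tendsto (fun r : ℝ => (-r) • e) (𝓝 0) (𝓝 0) := by
      have : Continuous fun r : ℝ => (-r) • e := by fun_prop
      simpa using this.tendsto 0
    exact h.comp h2
  rw [Metric.tendsto_nhds] at hlim ⊢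
  intro ε hε
  obtain ⟨δ, hδ, h⟩ := Metric.eventually_nhds_iff.1 (hlim (ε / 2) (half_pos hε))
  filter_upwards [Ioo_mem_nhdsGT hδ] with τ hτ
  rw [hswap τ]
  have e1 : τ⁻¹ * ∫ r in Ioc 0 τ, J r - (∫ r in Ioc 0 τ, (∫ z, f z * G z ∂μ)) / 1
      = τ⁻¹ * ∫ r in Ioc 0 τ, J r - (∫ r in Ioc 0 τ, (∫ z, f z * G z ∂μ)) := by simp
  have hc : (∫ r in Ioc 0 τ, (∫ z, f z * G z ∂μ)) = τ * ∫ z, f z * G z ∂μ := by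
    simp [hτ.1.le]
  have hsub : (∫ r in Ioc 0 τ, J r) - τ * ∫ z, f z * G z ∂μ
      = ∫ r in Ioc 0 τ, (J r - ∫ z, f z * G z ∂μ) := by
    rw [integral_sub (hJi τ) (integrable_const _), hc]
  have hb : ‖∫ r in Ioc 0 τ, (J r - ∫ z, f z * G z ∂μ)‖ ≤ (ε / 2) * volume.real (Ioc 0 τ) := by
    refine norm_setIntegral_le_of_norm_le_const (by simp) fun r hr => ?_
    have := h (y := r) (by
      rw [Real.dist_eq, sub_zero, abs_of_pos hr.1]; exact hr.2.trans_lt hτ.2)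
    rw [Real.dist_eq] at this
    exact this.le
  rw [← hsub] at hb
  simp only [Real.volume_real_Ioc, sub_zero, max_eq_left hτ.1.le] at hb
  rw [Real.dist_eq]
  have : τ⁻¹ * (∫ r in Ioc 0 τ, J r) - ∫ z, f z * G z ∂μ
      = τ⁻¹ * ((∫ r in Ioc 0 τ, J r) - τ * ∫ z, f z * G z ∂μ) := by
    field_simp [hτ.1.ne']
  rw [this, abs_mul, abs_of_pos (inv_pos.2 hτ.1)]
  rw [Real.norm_eq_abs] at hb
  calc τ⁻¹ * _ ≤ τ⁻¹ * (ε / 2 * τ) := by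
        gcongr; exact (inv_pos.2 hτ.1).le
    _ = ε / 2 := by field_simp [hτ.1.ne']
    _ < ε := half_lt_self hε

end Translation

/-! ### Smoothed Heaviside functions and their entropies. -/

/-- A continuous probability density on `(0, R)`. -/
structure IsBump (R : ℝ) (ρ : ℝ → ℝ) : Prop where
  pos : 0 < R
  cont : Continuous ρ
  nonneg : ∀ r, 0 ≤ ρ r
  eq_zero : ∀ r, r ∉ Ioo 0 R → ρ r = 0
  integral : ∫ r in (0 : ℝ)..R, ρ r = 1

/-- The bump sits strictly to the right of `0`. Hence its primitive vanishes on `(-∞,0]`, and `H(w₁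
- w₂)` vanishes wherever `w₁ ≤ w₂`, in particular on the lateral boundary. -/
lemma exists_contDiff_isBump {R : ℝ} (hR : 0 < R) : ∃ ρ, IsBump R ρ ∧ ContDiff ℝ ∞ ρ := by
  let f : ContDiffBump (R / 2) := ⟨R / 8, R / 4, by positivity, by linarith⟩
  have hz : ∀ r, r ∉ Ioo 0 R → f.normed volume r = 0 := by
    intro r hr
    by_contra h
    have h2 : r ∈ Function.support (f.normed volume) := h
    rw [f.support_normed_eq, Real.ball_eq_Ioo] at h2
    have h3 : f.rOut = R / 4 := rfl
    rw [h3] at h2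
    exact hr ⟨by linarith [h2.1], by linarith [h2.2]⟩
  refine ⟨f.normed volume, ⟨hR, f.continuous_normed, f.nonneg_normed, hz, ?_⟩, f.contDiff_normed⟩
  rw [intervalIntegral.integral_of_le hR.le, setIntegral_eq_integral_of_forall_compl_eq_zero]
  · exact f.integral_normed
  · intro x hx
    exact hz x fun h => hx ⟨h.1, h.2.le⟩

/-- The primitive of a bump: a smoothed Heaviside function. -/
noncomputable def smoothStep (ρ : ℝ → ℝ) (r : ℝ) : ℝ := ∫ l in (0 : ℝ)..r, ρ l

/-- `∫ H(r - z) db(r)` over `(z, w)`, with `H` the smoothed Heaviside function. -/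
noncomputable def upperEntropy (R : ℝ) (ρ b : ℝ → ℝ) (w z : ℝ) : ℝ :=
  ∫ l in (0 : ℝ)..R, ρ l * max (b w - b (z + l)) 0

/-- `∫ H(w - r) db(r)` over `(z, w)`, with `H` the smoothed Heaviside function. -/
noncomputable def lowerEntropy (R : ℝ) (ρ b : ℝ → ℝ) (w z : ℝ) : ℝ :=
  ∫ l in (0 : ℝ)..R, ρ l * max (b (w - l) - b z) 0

section Bump

variable {R : ℝ} {ρ : ℝ → ℝ}

lemma IsBump.hasDerivAt_smoothStep (h : IsBump R ρ) (r : ℝ) :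
    HasDerivAt (smoothStep ρ) (ρ r) r :=
  intervalIntegral.integral_hasDerivAt_right (h.cont.intervalIntegrable _ _)
    (h.cont.stronglyMeasurableAtFilter _ _) h.cont.continuousAt

lemma IsBump.continuous_smoothStep (h : IsBump R ρ) : Continuous (smoothStep ρ) :=
  continuous_iff_continuousAt.2 fun r => (h.hasDerivAt_smoothStep r).continuousAt

lemma IsBump.monotone_smoothStep (h : IsBump R ρ) : Monotone (smoothStep ρ) :=
  monotone_of_hasDerivAt_nonneg h.hasDerivAt_smoothStep h.nonneg

lemma IsBump.smoothStep_of_nonpos (h : IsBump R ρ) {r : ℝ} (hr : r ≤ 0) :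
    smoothStep ρ r = 0 := by
  rw [smoothStep, intervalIntegral.integral_congr (g := fun _ => 0), intervalIntegral.integral_zero]
  intro x hx
  rw [uIcc_of_ge hr] at hx
  exact h.eq_zero x fun hx' => absurd hx'.1 (not_lt.2 hx.2)

lemma IsBump.smoothStep_of_le (h : IsBump R ρ) {r : ℝ} (hr : R ≤ r) : smoothStep ρ r = 1 := by
  rw [smoothStep, ← intervalIntegral.integral_add_adjacent_intervals
    (h.cont.intervalIntegrable 0 R) (h.cont.intervalIntegrable R r), h.integral,
    intervalIntegral.integral_congr (g := fun _ => 0) (a := R), intervalIntegral.integral_zero,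
    add_zero]
  intro x hx
  rw [uIcc_of_le hr] at hx
  exact h.eq_zero x fun hx' => absurd hx'.2 (not_lt.2 hx.1)

lemma IsBump.smoothStep_nonneg (h : IsBump R ρ) (r : ℝ) : 0 ≤ smoothStep ρ r := by
  rcases le_total r 0 with hr | hr
  · rw [h.smoothStep_of_nonpos hr]
  · rw [← h.smoothStep_of_nonpos le_rfl]; exact h.monotone_smoothStep hr

lemma IsBump.smoothStep_le_one (h : IsBump R ρ) (r : ℝ) : smoothStep ρ r ≤ 1 := by
  rw [← h.smoothStep_of_le (le_max_right r R)]
  exact h.monotone_smoothStep (le_max_left _ _)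

lemma IsBump.exists_bound (h : IsBump R ρ) : ∃ M, ∀ r, |ρ r| ≤ M := by
  obtain ⟨M, hM⟩ := isCompact_Icc.exists_bound_of_continuousOn (s := Icc 0 R) h.cont.continuousOn
  refine ⟨max M 0, fun r => ?_⟩
  by_cases hr : r ∈ Ioo 0 R
  · exact (hM r ⟨hr.1.le, hr.2.le⟩).trans (le_max_left _ _)
  · rw [h.eq_zero r hr, abs_zero]; exact le_max_right _ _

/-- A superposition of sharp Heaviside functions with weight `ρ`; the entropy inequalities below
then reduce to pointwise ones in `l`. -/
lemma IsBump.smoothStep_eq_integral_indicator (h : IsBump R ρ) (r : ℝ) :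
    smoothStep ρ r = ∫ l in (0 : ℝ)..R, (Iio r).indicator ρ l := by
  rcases le_total r 0 with hr | hr
  · rw [h.smoothStep_of_nonpos hr, intervalIntegral.integral_of_le h.pos.le,
      setIntegral_congr_fun (g := fun _ => 0) measurableSet_Ioc]
    · simp
    · intro x hx
      have hx' : x ∉ Iio r := not_lt.2 (hr.trans hx.1.le)
      exact indicator_of_notMem hx' ρ
  · rw [smoothStep, intervalIntegral.integral_of_le hr, intervalIntegral.integral_of_le h.pos.le,
      integral_Ioc_eq_integral_Ioo, setIntegral_indicator measurableSet_Iio]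
    refine setIntegral_eq_of_subset_of_forall_sdiff_eq_zero measurableSet_Ioo
      (fun x hx => ⟨hx.1.1, hx.2⟩) fun x hx => h.eq_zero x fun hx' => hx.2 ⟨⟨hx'.1, hx'.2.le⟩, hx.1.2⟩

/-- A subgradient inequality: for each `l` the map `s ↦ max (s - b (z + l)) 0` is convex, with slope
at `s = b w` equal to the indicator of `l < w - z`. Averaging over `l` produces the slope
`smoothStep ρ (w - z)`. -/
lemma upperEntropy_sub_le (h : IsBump R ρ) {b : ℝ → ℝ} (hb : Continuous b) (hm : StrictMono b)
    (w w' z : ℝ) :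
    upperEntropy R ρ b w z - upperEntropy R ρ b w' z ≤ smoothStep ρ (w - z) * (b w - b w') := by
  have hc := h.cont
  rw [h.smoothStep_eq_integral_indicator, ← intervalIntegral.integral_mul_const, upperEntropy,
    upperEntropy, ← intervalIntegral.integral_sub
      (Continuous.intervalIntegrable (by fun_prop) _ _)
      (Continuous.intervalIntegrable (by fun_prop) _ _)]
  refine intervalIntegral.integral_mono_on h.pos.le
    (Continuous.intervalIntegrable (by fun_prop) _ _) ?_ fun l _ => ?_
  · refine IntervalIntegrable.mul_const ?_ _
    rw [intervalIntegrable_iff]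
    exact ((hc.intervalIntegrable 0 R).def').indicator measurableSet_Iio
  · by_cases hl : l < w - z
    · rw [indicator_of_mem (by exact hl), ← mul_sub]
      refine mul_le_mul_of_nonneg_left ?_ (h.nonneg l)
      have := hm.monotone (show z + l ≤ w by linarith)
      rw [max_eq_left (by linarith)]
      have := le_max_left (b w' - b (z + l)) 0
      linarith
    · rw [indicator_of_notMem (by exact hl), ← mul_sub, zero_mul]
      refine mul_nonpos_of_nonneg_of_nonpos (h.nonneg l) ?_
      have := hm.monotone (show w ≤ z + l by linarith)
      rw [max_eq_right (by linarith)]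
      have := le_max_right (b w' - b (z + l)) 0
      linarith

/-- The mirror inequality, convex in `b z` with slope `-smoothStep ρ (w - z)`. The shift is now put
on `w`, so that the two inequalities carry the same factor and can be added. -/
lemma lowerEntropy_sub_le (h : IsBump R ρ) {b : ℝ → ℝ} (hb : Continuous b) (hm : StrictMono b)
    (w z z' : ℝ) :
    lowerEntropy R ρ b w z - lowerEntropy R ρ b w z' ≤ smoothStep ρ (w - z) * (b z' - b z) := by
  have hc := h.cont
  rw [h.smoothStep_eq_integral_indicator, ← intervalIntegral.integral_mul_const, lowerEntropy,
    lowerEntropy, ← intervalIntegral.integral_sub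
      (Continuous.intervalIntegrable (by fun_prop) _ _)
      (Continuous.intervalIntegrable (by fun_prop) _ _)]
  refine intervalIntegral.integral_mono_on h.pos.le
    (Continuous.intervalIntegrable (by fun_prop) _ _) ?_ fun l _ => ?_
  · refine IntervalIntegrable.mul_const ?_ _
    rw [intervalIntegrable_iff]
    exact ((hc.intervalIntegrable 0 R).def').indicator measurableSet_Iio
  · by_cases hl : l < w - z
    · rw [indicator_of_mem (by exact hl), ← mul_sub]
      refine mul_le_mul_of_nonneg_left ?_ (h.nonneg l)
      have := hm.monotone (show z ≤ w - l by linarith)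
      rw [max_eq_left (by linarith)]
      have := le_max_left (b (w - l) - b z') 0
      linarith
    · rw [indicator_of_notMem (by exact hl), ← mul_sub, zero_mul]
      refine mul_nonpos_of_nonneg_of_nonpos (h.nonneg l) ?_
      have := hm.monotone (show w - l ≤ z by linarith)
      rw [max_eq_right (by linarith)]
      have := le_max_right (b (w - l) - b z') 0
      linarith

lemma continuous_upperEntropy (h : IsBump R ρ) {b : ℝ → ℝ} (hb : Continuous b) :
    Continuous fun x : ℝ × ℝ => upperEntropy R ρ b x.1 x.2 := by
  have hc := h.cont
  unfold upperEntropy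
  refine intervalIntegral.continuous_parametric_intervalIntegral_of_continuous' ?_ _ _
  fun_prop

lemma continuous_lowerEntropy (h : IsBump R ρ) {b : ℝ → ℝ} (hb : Continuous b) :
    Continuous fun x : ℝ × ℝ => lowerEntropy R ρ b x.1 x.2 := by
  have hc := h.cont
  unfold lowerEntropy
  refine intervalIntegral.continuous_parametric_intervalIntegral_of_continuous' ?_ _ _
  fun_prop

lemma IsBump.abs_integral_mul_sub_le (h : IsBump R ρ) {f : ℝ → ℝ} (hf : Continuous f) {m κ : ℝ}
    (hκ : ∀ l ∈ Icc 0 R, |f l - m| ≤ κ) : |(∫ l in (0 : ℝ)..R, ρ l * f l) - m| ≤ κ := by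
  have hc := h.cont
  have e : ∀ m : ℝ, ∫ l in (0 : ℝ)..R, ρ l * m = m := fun m => by
    rw [intervalIntegral.integral_mul_const, h.integral, one_mul]
  have h1 : ∫ l in (0 : ℝ)..R, ρ l * f l ≤ ∫ l in (0 : ℝ)..R, ρ l * (m + κ) := by
    refine intervalIntegral.integral_mono_on h.pos.le
      (Continuous.intervalIntegrable (by fun_prop) _ _)
      (Continuous.intervalIntegrable (by fun_prop) _ _) fun l hl => ?_
    exact mul_le_mul_of_nonneg_left (by linarith [(abs_le.1 (hκ l hl)).2]) (h.nonneg l)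
  have h2 : ∫ l in (0 : ℝ)..R, ρ l * (m - κ) ≤ ∫ l in (0 : ℝ)..R, ρ l * f l := by
    refine intervalIntegral.integral_mono_on h.pos.le
      (Continuous.intervalIntegrable (by fun_prop) _ _)
      (Continuous.intervalIntegrable (by fun_prop) _ _) fun l hl => ?_
    exact mul_le_mul_of_nonneg_left (by linarith [(abs_le.1 (hκ l hl)).1]) (h.nonneg l)
  rw [e] at h1 h2
  exact abs_le.2 ⟨by linarith, by linarith⟩

/-- As `R → 0` the upper and lower entropies collapse to the same function `max (b w - b z) 0`. The
error is the modulus of continuity of `b`, since taking positive parts is a contraction. -/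
lemma abs_upperEntropy_sub_le (h : IsBump R ρ) {b : ℝ → ℝ} (hb : Continuous b) {w z κ : ℝ}
    (hκ : ∀ l ∈ Icc 0 R, |b (z + l) - b z| ≤ κ) :
    |upperEntropy R ρ b w z - max (b w - b z) 0| ≤ κ := by
  refine h.abs_integral_mul_sub_le (by fun_prop) fun l hl => ?_
  refine (abs_max_sub_max_le_abs _ _ _).trans (le_trans (le_of_eq ?_) (hκ l hl))
  rw [abs_sub_comm]; congr 1; ring

lemma abs_lowerEntropy_sub_le (h : IsBump R ρ) {b : ℝ → ℝ} (hb : Continuous b) {w z κ : ℝ}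
    (hκ : ∀ l ∈ Icc 0 R, |b (w - l) - b w| ≤ κ) :
    |lowerEntropy R ρ b w z - max (b w - b z) 0| ≤ κ := by
  refine h.abs_integral_mul_sub_le (by fun_prop) fun l hl => ?_
  refine (abs_max_sub_max_le_abs _ _ _).trans (le_trans (le_of_eq ?_) (hκ l hl))
  congr 1; ring

end Bump

/-! ### Calculus for absolutely continuous functions. -/

lemma _root_.LipschitzWith.comp_absolutelyContinuousOnInterval {f H : ℝ → ℝ} {K : NNReal}
    {a c : ℝ} (hH : LipschitzWith K H) (hf : AbsolutelyContinuousOnInterval f a c) :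
    AbsolutelyContinuousOnInterval (fun x => H (f x)) a c := by
  unfold AbsolutelyContinuousOnInterval at hf ⊢
  have h := hf.const_mul (K : ℝ)
  rw [mul_zero] at h
  refine squeeze_zero (fun I => Finset.sum_nonneg fun _ _ => dist_nonneg) (fun I => ?_) h
  rw [Finset.mul_sum]
  exact Finset.sum_le_sum fun i _ => hH.dist_le_mul _ _

/-- Chain rule for primitives of integrable functions. -/
lemma comp_primitive_eq {f H ρ q : ℝ → ℝ} {K : NNReal} {a c : ℝ} (hac : a ≤ c)
    (hq : IntervalIntegrable q volume a c)
    (hf : ∀ x ∈ Icc a c, f x = f a + ∫ y in a..x, q y)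
    (hH : ∀ r, HasDerivAt H (ρ r) r) (hK : LipschitzWith K H) :
    ∀ x ∈ Icc a c, H (f x) = H (f a) + ∫ y in a..x, ρ (f y) * q y := by
  intro x hx
  have hsub : uIcc a x ⊆ uIcc a c := by
    rw [uIcc_of_le hx.1, uIcc_of_le hac]; exact Icc_subset_Icc_right hx.2
  set F : ℝ → ℝ := fun x => f a + ∫ y in a..x, q y with hF
  have hFac : AbsolutelyContinuousOnInterval F a x := by
    refine AbsolutelyContinuousOnInterval.add ?_
      (IntervalIntegrable.absolutelyContinuousOnInterval_intervalIntegral (hq.mono_set hsub)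
        left_mem_uIcc)
    exact (LipschitzWith.const' (K := 0) (f a)).lipschitzOnWith.absolutelyContinuousOnInterval
  -- The composite is absolutely continuous, hence the integral of its a.e. derivative; at a.e.
  -- point the classical chain rule computes that derivative.
  have h1 := (hK.comp_absolutelyContinuousOnInterval hFac).integral_deriv_eq_sub
  have h2 : ∫ y in a..x, deriv (fun x => H (F x)) y = ∫ y in a..x, ρ (f y) * q y := by
    refine intervalIntegral.integral_congr_ae ?_
    filter_upwards [(hq.mono_set hsub).ae_hasDerivAt_integral] with y hy hy'
    have hyI := uIoc_subset_uIcc hy'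
    have h3 := (hy hyI a left_mem_uIcc).const_add (f a)
    have h4 := ((hH (F y)).comp y h3).deriv
    rw [uIcc_of_le hx.1] at hyI
    rw [hf y ⟨hyI.1, hyI.2.trans hx.2⟩]
    exact h4
  rw [h2] at h1
  have e1 : F x = f x := (hf x hx).symm
  have e2 : F a = f a := by simp [hF]
  simp only [e1, e2] at h1
  linarith

/-- Integration by parts against a primitive vanishing at both ends. -/
lemma integral_mul_of_primitive {F D φ q : ℝ → ℝ} {a c κ : ℝ} (hac : a ≤ c)
    (hD : IntervalIntegrable D volume a c) (hq : IntervalIntegrable q volume a c)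
    (hF : ∀ᵐ x ∂(volume.restrict (Ioo a c)), F x = κ + ∫ y in a..x, D y)
    (hφ : ∀ x ∈ Icc a c, φ x = ∫ y in a..x, q y) (hφc : φ c = 0) :
    ∫ x in a..c, F x * q x = -∫ x in a..c, D x * φ x := by
  have hA : AbsolutelyContinuousOnInterval (fun x => κ + ∫ y in a..x, D y) a c :=
    AbsolutelyContinuousOnInterval.add
      (LipschitzWith.const' (K := 0) κ).lipschitzOnWith.absolutelyContinuousOnInterval
      (hD.absolutelyContinuousOnInterval_intervalIntegral left_mem_uIcc)
  have hB : AbsolutelyContinuousOnInterval (fun x => ∫ y in a..x, q y) a c :=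
    hq.absolutelyContinuousOnInterval_intervalIntegral left_mem_uIcc
  have h := hA.integral_mul_deriv_eq_deriv_mul hB
  -- Both boundary terms vanish, as `φ` is a primitive starting at `a` and `φ c = 0`. So the
  -- constant `κ` plays no role.
  have hc0 : ∫ y in a..c, q y = 0 := by rw [← hφ c (right_mem_Icc.2 hac), hφc]
  simp only [hc0, intervalIntegral.integral_same, mul_zero, sub_zero, zero_sub] at h
  have e1 : ∫ x in a..c, F x * q x
      = ∫ x in a..c, (κ + ∫ y in a..x, D y) * deriv (fun x => ∫ y in a..x, q y) x := by
    rw [Measure.restrict_congr_set Ioo_ae_eq_Ioc, ae_restrict_iff' measurableSet_Ioc] at hF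
    refine intervalIntegral.integral_congr_ae ?_
    filter_upwards [hq.ae_hasDerivAt_integral, hF] with y hy hFy hy'
    have h3 := (hy (uIoc_subset_uIcc hy') a left_mem_uIcc).deriv
    rw [uIoc_of_le hac] at hy'
    rw [h3, hFy hy']
  have e2 : ∫ x in a..c, deriv (fun x => κ + ∫ y in a..x, D y) x * ∫ y in a..x, q y
      = ∫ x in a..c, D x * φ x := by
    refine intervalIntegral.integral_congr_ae ?_
    filter_upwards [hD.ae_hasDerivAt_integral] with y hy hy'
    have hyI := uIoc_subset_uIcc hy'
    have h3 := ((hy hyI a left_mem_uIcc).const_add κ).deriv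
    rw [uIcc_of_le hac] at hyI
    rw [h3, hφ y hyI]
  rw [e1, h, e2]

/-! ### Monotonicity and integrability of the flux. -/

section Flux

variable {p : ℝ}

lemma continuous_flux (hp : 2 < p) : Continuous (flux p) := by
  unfold flux
  exact (continuous_abs.rpow_const fun _ => Or.inr (by linarith)).mul continuous_id

lemma abs_flux (hp : 2 < p) (s : ℝ) : |flux p s| = |s| ^ (p - 1) := by
  unfold flux
  rw [abs_mul, abs_of_nonneg (Real.rpow_nonneg (abs_nonneg s) _)]
  rcases eq_or_ne s 0 with rfl | hs
  · simp [Real.zero_rpow (show p - 1 ≠ 0 by linarith)]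
  · rw [← Real.rpow_add_one (abs_ne_zero.2 hs)]; congr 1; ring

lemma flux_neg (s : ℝ) : flux p (-s) = -flux p s := by simp [flux]

lemma flux_of_nonneg (hp : 2 < p) {s : ℝ} (hs : 0 ≤ s) : flux p s = s ^ (p - 1) := by
  rw [← abs_of_nonneg (show 0 ≤ flux p s from mul_nonneg (Real.rpow_nonneg (abs_nonneg s) _) hs),
    abs_flux hp, abs_of_nonneg hs]

lemma monotone_flux (hp : 2 < p) : Monotone (flux p) := by
  have hpos : MonotoneOn (flux p) (Ici 0) := fun x hx y hy hxy => by
    rw [flux_of_nonneg hp hx, flux_of_nonneg hp hy]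
    exact Real.rpow_le_rpow hx hxy (by linarith)
  have hodd : ∀ s, flux p (-s) = -flux p s := flux_neg
  intro x y hxy
  rcases le_total 0 x with hx | hx
  · exact hpos hx (hx.trans hxy) hxy
  · rcases le_total 0 y with hy | hy
    · have h1 : 0 ≤ flux p y := mul_nonneg (Real.rpow_nonneg (abs_nonneg y) _) hy
      have h2 : flux p x ≤ 0 := mul_nonpos_of_nonneg_of_nonpos (Real.rpow_nonneg (abs_nonneg x) _) hx
      exact h2.trans h1
    · have := hpos (neg_nonneg.2 hy : -y ∈ Ici 0) (neg_nonneg.2 hx : -x ∈ Ici 0) (neg_le_neg hxy)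
      rw [hodd, hodd] at this
      exact neg_le_neg_iff.1 this

lemma flux_sub_mul_sub_nonneg (hp : 2 < p) (s r : ℝ) : 0 ≤ (flux p s - flux p r) * (s - r) := by
  rcases le_total s r with h | h
  · exact mul_nonneg_of_nonpos_of_nonpos (sub_nonpos.2 (monotone_flux hp h)) (sub_nonpos.2 h)
  · exact mul_nonneg (sub_nonneg.2 (monotone_flux hp h)) (sub_nonneg.2 h)

/-- The exponents are conjugate: `|flux p s| ^ (p / (p - 1)) = |s| ^ p`. -/
lemma memLp_flux {α : Type*} [MeasurableSpace α] {μ : Measure α} (hp : 2 < p) {g : α → ℝ}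
    (hg : MemLp g (ENNReal.ofReal p) μ) :
    MemLp (fun z => flux p (g z)) (ENNReal.ofReal (p / (p - 1))) μ := by
  have hm := (continuous_flux hp).comp_aestronglyMeasurable hg.aestronglyMeasurable
  have h0 : 0 < p / (p - 1) := div_pos (by linarith) (by linarith)
  rw [← integrable_norm_rpow_iff hm (by simpa using h0) (by simp)]
  have h1 := hg.integrable_norm_rpow (by simp; linarith) (by simp)
  refine h1.congr (.of_forall fun z => ?_)
  rw [ENNReal.toReal_ofReal h0.le, ENNReal.toReal_ofReal (by linarith)]
  simp only [Real.norm_eq_abs]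
  rw [abs_flux hp, ← Real.rpow_mul (abs_nonneg _)]
  congr 1
  field_simp [show p - 1 ≠ 0 by linarith]

lemma holderTriple_flux (hp : 2 < p) :
    ENNReal.HolderTriple (ENNReal.ofReal (p / (p - 1))) (ENNReal.ofReal p) 1 := by
  have h : Real.HolderConjugate (p / (p - 1)) p :=
    (Real.HolderConjugate.conjExponent (by linarith : 1 < p)).symm
  exact h.ennrealOfReal

lemma one_le_flux_exponent (hp : 2 < p) : 1 ≤ ENNReal.ofReal (p / (p - 1)) := by
  rw [← ENNReal.ofReal_one]
  exact ENNReal.ofReal_le_ofReal ((one_le_div (by linarith)).2 (by linarith))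

end Flux

/-! ### Test pairs, energy pairs and time-integrated sub- and supersolutions. -/

/-- `φ ≥ 0` lies in `W₀^{1,p}(a,c)`, with derivative `q`. -/
structure TestPair (p a c : ℝ) (φ q : ℝ → ℝ) : Prop where
  memLp : MemLp q (ENNReal.ofReal p) (volume.restrict (Ioc a c))
  eq_integral : ∀ x ∈ Icc a c, φ x = ∫ y in a..x, q y
  right : φ c = 0
  nonneg : ∀ x ∈ Icc a c, 0 ≤ φ x

/-- A continuous function with a space derivative in `L^p`. -/
structure EnergyPair (p a c T : ℝ) (w g : ℝ × ℝ → ℝ) : Prop where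
  cont : Continuous w
  meas : Measurable g
  memLp : MemLp g (ENNReal.ofReal p)
  primitive : ∀ᵐ t ∂(volume.restrict (Ioo 0 T)), ∀ x ∈ Icc a c,
    w (x, t) = w (a, t) + ∫ y in a..x, g (y, t)

/-- A bounded measurable source with compact support. -/
structure IsSource (h : ℝ × ℝ → ℝ) : Prop where
  meas : Measurable h
  bound : ∃ M, ∀ z, |h z| ≤ M
  supp : HasCompactSupport h

/-- The time-integrated form of `∂ₜ b(w) - (flux p g)ₓ ≤ h` on `(a,c) × (0,T)`. -/
def IsSubsolution (p : ℝ) (b : ℝ → ℝ) (a c T : ℝ) (w g h : ℝ × ℝ → ℝ) : Prop :=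
  ∀ t' t, 0 ≤ t' → t' < t → t < T → ∀ φ q, TestPair p a c φ q →
    (∫ x in a..c, (b (w (x, t)) - b (w (x, t'))) * φ x)
      + ∫ x in a..c, (∫ r in t'..t, flux p (g (x, r))) * q x
      ≤ ∫ x in a..c, (∫ r in t'..t, h (x, r)) * φ x

/-- The time-integrated form of `∂ₜ b(w) - (flux p g)ₓ ≥ h` on `(a,c) × (0,T)`. -/
def IsSupersolution (p : ℝ) (b : ℝ → ℝ) (a c T : ℝ) (w g h : ℝ × ℝ → ℝ) : Prop :=
  ∀ t' t, 0 ≤ t' → t' < t → t < T → ∀ φ q, TestPair p a c φ q →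
    ∫ x in a..c, (∫ r in t'..t, h (x, r)) * φ x ≤
    (∫ x in a..c, (b (w (x, t)) - b (w (x, t'))) * φ x)
      + ∫ x in a..c, (∫ r in t'..t, flux p (g (x, r))) * q x

lemma EnergyPair.ae_memLp_slice {p a c T : ℝ} (hp : 2 < p) {w g : ℝ × ℝ → ℝ}
    (h : EnergyPair p a c T w g) :
    ∀ᵐ t : ℝ, MemLp (fun x => g (x, t)) (ENNReal.ofReal p) := by
  have h1 := h.memLp.integrable_norm_rpow (by simp; linarith) (by simp)
  have h2 := h1.prod_left_ae
  filter_upwards [h2] with t ht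
  exact (integrable_norm_rpow_iff
    (h.meas.comp (measurable_id.prodMk measurable_const)).aestronglyMeasurable
    (by simp; linarith) (by simp)).1 ht

/-- `H(w₁(x,t) - w₂(x,s))`. -/
noncomputable def doubledTest (ρ : ℝ → ℝ) (w₁ w₂ : ℝ × ℝ → ℝ) (z : (ℝ × ℝ) × ℝ) : ℝ :=
  smoothStep ρ (w₁ (z.2, z.1.1) - w₂ (z.2, z.1.2))

/-- The space derivative of `H(w₁(x,t) - w₂(x,s))`. -/
noncomputable def doubledTestDeriv (ρ : ℝ → ℝ) (w₁ w₂ g₁ g₂ : ℝ × ℝ → ℝ) (z : (ℝ × ℝ) × ℝ) : ℝ :=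
  ρ (w₁ (z.2, z.1.1) - w₂ (z.2, z.1.2)) * (g₁ (z.2, z.1.1) - g₂ (z.2, z.1.2))

/-- The lateral ordering must hold between different times `t` and `s`: it is what makes `H(w₁(·,t)
- w₂(·,s))` vanish at both ends. The derivative formula is the chain rule for primitives, and
boundedness of `ρ` keeps it in `L^p`. -/
lemma testPair_doubledTest {p a c T R : ℝ} {ρ : ℝ → ℝ} (hp : 2 < p) (hac : a < c)
    (hρ : IsBump R ρ) {w₁ w₂ g₁ g₂ : ℝ × ℝ → ℝ} (h₁ : EnergyPair p a c T w₁ g₁)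
    (h₂ : EnergyPair p a c T w₂ g₂) {t s : ℝ}
    (ht : MemLp (fun x => g₁ (x, t)) (ENNReal.ofReal p))
    (hs : MemLp (fun x => g₂ (x, s)) (ENNReal.ofReal p))
    (ht' : ∀ x ∈ Icc a c, w₁ (x, t) = w₁ (a, t) + ∫ y in a..x, g₁ (y, t))
    (hs' : ∀ x ∈ Icc a c, w₂ (x, s) = w₂ (a, s) + ∫ y in a..x, g₂ (y, s))
    (hla : w₁ (a, t) ≤ w₂ (a, s)) (hlc : w₁ (c, t) ≤ w₂ (c, s)) :
    TestPair p a c (fun x => doubledTest ρ w₁ w₂ ((t, s), x))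
      (fun x => doubledTestDeriv ρ w₁ w₂ g₁ g₂ ((t, s), x)) := by
  obtain ⟨M, hM⟩ := hρ.exists_bound
  have hp1 : 1 ≤ ENNReal.ofReal p := by
    rw [← ENNReal.ofReal_one]; exact ENNReal.ofReal_le_ofReal (by linarith)
  have hint : ∀ {g : ℝ → ℝ}, MemLp g (ENNReal.ofReal p) → ∀ u v, IntervalIntegrable g volume u v :=
    fun hg u v => by
      rw [intervalIntegrable_iff, uIoc]
      exact (hg.restrict _).integrable hp1
  have hM0 : 0 ≤ M := (abs_nonneg _).trans (hM 0)
  have hK : LipschitzWith ⟨M, hM0⟩ (smoothStep ρ) := by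
    refine lipschitzWith_of_nnnorm_deriv_le
      (fun r => (hρ.hasDerivAt_smoothStep r).differentiableAt) fun r => ?_
    rw [(hρ.hasDerivAt_smoothStep r).deriv]
    exact hM r
  have hw₁ := h₁.cont
  have hw₂ := h₂.cont
  have hc := hρ.cont
  refine ⟨?_, ?_, ?_, ?_⟩
  · have hd : MemLp (fun x => g₁ (x, t) - g₂ (x, s)) (ENNReal.ofReal p)
      (volume.restrict (Ioc a c)) := (ht.sub hs).restrict _
    refine (hd.norm.const_mul M).mono ?_ (.of_forall fun x => ?_)
    · exact (Continuous.aestronglyMeasurable (by fun_prop)).mul hd.aestronglyMeasurable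
    · simp only [doubledTestDeriv, norm_mul, Real.norm_eq_abs, abs_abs, abs_of_nonneg hM0]
      exact mul_le_mul_of_nonneg_right (hM _) (abs_nonneg _)
  · intro x hx
    have := comp_primitive_eq (f := fun x => w₁ (x, t) - w₂ (x, s))
      (q := fun x => g₁ (x, t) - g₂ (x, s)) hac.le ((hint ht a c).sub (hint hs a c))
      (fun x hx => ?_) hρ.hasDerivAt_smoothStep hK x hx
    · simp only [doubledTest, doubledTestDeriv]
      rw [this, hρ.smoothStep_of_nonpos (sub_nonpos.2 hla), zero_add]
    · rw [intervalIntegral.integral_sub (hint ht a x) (hint hs a x), ht' x hx, hs' x hx]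
      ring
  · exact hρ.smoothStep_of_nonpos (sub_nonpos.2 hlc)
  · intro x _
    exact hρ.smoothStep_nonneg _

/-! ### Space-integrated entropies and their increments. -/

/-- The space integral of the upper entropy of `w₁(·,t)` relative to `w₂(·,s)`. -/
noncomputable def upperEnergy (R : ℝ) (ρ b : ℝ → ℝ) (a c : ℝ) (w₁ w₂ : ℝ × ℝ → ℝ) (y : ℝ × ℝ) : ℝ :=
  ∫ x in a..c, upperEntropy R ρ b (w₁ (x, y.1)) (w₂ (x, y.2))

/-- The space integral of the lower entropy of `w₂(·,s)` relative to `w₁(·,t)`. -/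
noncomputable def lowerEnergy (R : ℝ) (ρ b : ℝ → ℝ) (a c : ℝ) (w₁ w₂ : ℝ × ℝ → ℝ) (y : ℝ × ℝ) : ℝ :=
  ∫ x in a..c, lowerEntropy R ρ b (w₁ (x, y.1)) (w₂ (x, y.2))

/-- `∫ (b(w₁(x,t)) - b(w₂(x,s)))⁺ dx`. -/
noncomputable def positiveEnergy (b : ℝ → ℝ) (a c : ℝ) (w₁ w₂ : ℝ × ℝ → ℝ) (y : ℝ × ℝ) : ℝ :=
  ∫ x in a..c, max (b (w₁ (x, y.1)) - b (w₂ (x, y.2))) 0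

section Energy

variable {p a c T R : ℝ} {ρ b : ℝ → ℝ} {w₁ w₂ : ℝ × ℝ → ℝ}

lemma continuous_upperEnergy (hρ : IsBump R ρ) (hb : Continuous b) (h₁ : Continuous w₁)
    (h₂ : Continuous w₂) : Continuous (upperEnergy R ρ b a c w₁ w₂) := by
  refine intervalIntegral.continuous_parametric_intervalIntegral_of_continuous' ?_ _ _
  exact (continuous_upperEntropy hρ hb).comp (f := fun y : (ℝ × ℝ) × ℝ =>
    (w₁ (y.2, y.1.1), w₂ (y.2, y.1.2))) (by fun_prop)

lemma continuous_lowerEnergy (hρ : IsBump R ρ) (hb : Continuous b) (h₁ : Continuous w₁)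
    (h₂ : Continuous w₂) : Continuous (lowerEnergy R ρ b a c w₁ w₂) := by
  refine intervalIntegral.continuous_parametric_intervalIntegral_of_continuous' ?_ _ _
  exact (continuous_lowerEntropy hρ hb).comp (f := fun y : (ℝ × ℝ) × ℝ =>
    (w₁ (y.2, y.1.1), w₂ (y.2, y.1.2))) (by fun_prop)

lemma continuous_positiveEnergy (hb : Continuous b) (h₁ : Continuous w₁)
    (h₂ : Continuous w₂) : Continuous (positiveEnergy b a c w₁ w₂) := by
  refine intervalIntegral.continuous_parametric_intervalIntegral_of_continuous' ?_ _ _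
  fun_prop

/-- The entropy inequalities of `w₁` in `t` and of `w₂` in `s`, added. -/
lemma energy_increments_le {g₁ g₂ f₁ f₂ : ℝ × ℝ → ℝ} (hac : a < c) (hρ : IsBump R ρ)
    (hb : Continuous b) (hm : StrictMono b) (h₁ : Continuous w₁) (h₂ : Continuous w₂)
    (hsub : IsSubsolution p b a c T w₁ g₁ f₁) (hsup : IsSupersolution p b a c T w₂ g₂ f₂)
    {t s τ : ℝ} (hτ : 0 < τ) (ht : τ ≤ t) (hs : τ ≤ s) (htT : t < T) (hsT : s < T)
    (hφ : TestPair p a c (fun x => doubledTest ρ w₁ w₂ ((t, s), x))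
      (fun x => doubledTestDeriv ρ w₁ w₂ g₁ g₂ ((t, s), x))) :
    (upperEnergy R ρ b a c w₁ w₂ (t, s) - upperEnergy R ρ b a c w₁ w₂ (t - τ, s))
      + (lowerEnergy R ρ b a c w₁ w₂ (t, s) - lowerEnergy R ρ b a c w₁ w₂ (t, s - τ))
      ≤ (∫ x in a..c, (∫ r in (t - τ)..t, f₁ (x, r)) * doubledTest ρ w₁ w₂ ((t, s), x))
        - (∫ x in a..c, (∫ r in (s - τ)..s, f₂ (x, r)) * doubledTest ρ w₁ w₂ ((t, s), x))
        - (∫ x in a..c, (∫ r in (t - τ)..t, flux p (g₁ (x, r)))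
            * doubledTestDeriv ρ w₁ w₂ g₁ g₂ ((t, s), x))
        + ∫ x in a..c, (∫ r in (s - τ)..s, flux p (g₂ (x, r)))
            * doubledTestDeriv ρ w₁ w₂ g₁ g₂ ((t, s), x) := by
  -- The same test function, frozen at the end times `(t,s)`, enters both inequalities. Because it
  -- is evaluated at the end times, the subgradient inequalities bound the entropy increments from
  -- above.
  have e1 := hsub (t - τ) t (by linarith) (by linarith) htT _ _ hφ
  have e2 := hsup (s - τ) s (by linarith) (by linarith) hsT _ _ hφ
  have hH := hρ.continuous_smoothStep
  have hU := continuous_upperEntropy hρ hb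
  have hL := continuous_lowerEntropy hρ hb
  have cU : ∀ t s, Continuous fun x => upperEntropy R ρ b (w₁ (x, t)) (w₂ (x, s)) := fun t s =>
    hU.comp (f := fun x => (w₁ (x, t), w₂ (x, s))) (by fun_prop)
  have cL : ∀ t s, Continuous fun x => lowerEntropy R ρ b (w₁ (x, t)) (w₂ (x, s)) := fun t s =>
    hL.comp (f := fun x => (w₁ (x, t), w₂ (x, s))) (by fun_prop)
  have i1 : upperEnergy R ρ b a c w₁ w₂ (t, s) - upperEnergy R ρ b a c w₁ w₂ (t - τ, s)
      ≤ ∫ x in a..c, (b (w₁ (x, t)) - b (w₁ (x, t - τ))) * doubledTest ρ w₁ w₂ ((t, s), x) := by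
    unfold upperEnergy
    rw [← intervalIntegral.integral_sub ((cU _ _).intervalIntegrable _ _)
      ((cU _ _).intervalIntegrable _ _)]
    refine intervalIntegral.integral_mono_on hac.le
      (((cU _ _).sub (cU _ _)).intervalIntegrable _ _)
      (Continuous.intervalIntegrable (by unfold doubledTest; fun_prop) _ _) fun x _ => ?_
    have := upperEntropy_sub_le hρ hb hm (w₁ (x, t)) (w₁ (x, t - τ)) (w₂ (x, s))
    simp only [doubledTest]
    linarith
  have i2 : lowerEnergy R ρ b a c w₁ w₂ (t, s) - lowerEnergy R ρ b a c w₁ w₂ (t, s - τ)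
      ≤ -∫ x in a..c, (b (w₂ (x, s)) - b (w₂ (x, s - τ))) * doubledTest ρ w₁ w₂ ((t, s), x) := by
    unfold lowerEnergy
    rw [← intervalIntegral.integral_sub ((cL _ _).intervalIntegrable _ _)
      ((cL _ _).intervalIntegrable _ _), ← intervalIntegral.integral_neg]
    refine intervalIntegral.integral_mono_on hac.le
      (((cL _ _).sub (cL _ _)).intervalIntegrable _ _)
      (Continuous.intervalIntegrable (by unfold doubledTest; fun_prop) _ _) fun x _ => ?_
    have := lowerEntropy_sub_le hρ hb hm (w₁ (x, t)) (w₂ (x, s)) (w₂ (x, s - τ))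
    simp only [doubledTest]
    linarith
  linarith

lemma abs_upperEnergy_sub_le (hac : a < c) (hρ : IsBump R ρ) (hb : Continuous b)
    (h₁ : Continuous w₁) (h₂ : Continuous w₂) {y : ℝ × ℝ} {κ : ℝ}
    (hκ : ∀ x ∈ Icc a c, ∀ l ∈ Icc 0 R, |b (w₂ (x, y.2) + l) - b (w₂ (x, y.2))| ≤ κ) :
    |upperEnergy R ρ b a c w₁ w₂ y - positiveEnergy b a c w₁ w₂ y| ≤ κ * (c - a) := by
  unfold upperEnergy positiveEnergy
  have cU : Continuous fun x => upperEntropy R ρ b (w₁ (x, y.1)) (w₂ (x, y.2)) :=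
    (continuous_upperEntropy hρ hb).comp (f := fun x => (w₁ (x, y.1), w₂ (x, y.2))) (by fun_prop)
  rw [← intervalIntegral.integral_sub (cU.intervalIntegrable _ _)
    (Continuous.intervalIntegrable (by fun_prop) _ _)]
  have := intervalIntegral.norm_integral_le_of_norm_le_const (a := a) (b := c) (C := κ)
    (f := fun x => upperEntropy R ρ b (w₁ (x, y.1)) (w₂ (x, y.2))
      - max (b (w₁ (x, y.1)) - b (w₂ (x, y.2))) 0) fun x hx => by
    rw [uIoc_of_le hac.le] at hx
    exact abs_upperEntropy_sub_le hρ hb (hκ x ⟨hx.1.le, hx.2⟩)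
  rwa [abs_of_pos (sub_pos.2 hac)] at this

lemma abs_lowerEnergy_sub_le (hac : a < c) (hρ : IsBump R ρ) (hb : Continuous b)
    (h₁ : Continuous w₁) (h₂ : Continuous w₂) {y : ℝ × ℝ} {κ : ℝ}
    (hκ : ∀ x ∈ Icc a c, ∀ l ∈ Icc 0 R, |b (w₁ (x, y.1) - l) - b (w₁ (x, y.1))| ≤ κ) :
    |lowerEnergy R ρ b a c w₁ w₂ y - positiveEnergy b a c w₁ w₂ y| ≤ κ * (c - a) := by
  unfold lowerEnergy positiveEnergy
  have cL : Continuous fun x => lowerEntropy R ρ b (w₁ (x, y.1)) (w₂ (x, y.2)) :=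
    (continuous_lowerEntropy hρ hb).comp (f := fun x => (w₁ (x, y.1), w₂ (x, y.2))) (by fun_prop)
  rw [← intervalIntegral.integral_sub (cL.intervalIntegrable _ _)
    (Continuous.intervalIntegrable (by fun_prop) _ _)]
  have := intervalIntegral.norm_integral_le_of_norm_le_const (a := a) (b := c) (C := κ)
    (f := fun x => lowerEntropy R ρ b (w₁ (x, y.1)) (w₂ (x, y.2))
      - max (b (w₁ (x, y.1)) - b (w₂ (x, y.2))) 0) fun x hx => by
    rw [uIoc_of_le hac.le] at hx
    exact abs_lowerEntropy_sub_le hρ hb (hκ x ⟨hx.1.le, hx.2⟩)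
  rwa [abs_of_pos (sub_pos.2 hac)] at this

end Energy

/-! ### Steklov averages with two time variables. -/

section Lift

variable {p q : ENNReal} {a c T : ℝ}

instance isAddRightInvariant_volume_triple :
    Measure.IsAddRightInvariant (volume : Measure ((ℝ × ℝ) × ℝ)) :=
  inferInstanceAs (Measure.IsAddRightInvariant
    ((volume : Measure (ℝ × ℝ)).prod (volume : Measure ℝ)))

lemma measurePreserving_swap_fst :
    MeasurePreserving (fun z : (ℝ × ℝ) × ℝ => (z.1.swap, z.2)) :=
  (Measure.measurePreserving_swap (μ := (volume : Measure ℝ)) (ν := (volume : Measure ℝ))).prod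
    (MeasurePreserving.id volume)

lemma measurePreserving_rotate :
    MeasurePreserving (fun z : (ℝ × ℝ) × ℝ => ((z.2, z.1.1), z.1.2)) := by
  have h1 : MeasurePreserving (Prod.swap : (ℝ × ℝ) × ℝ → ℝ × (ℝ × ℝ)) :=
    Measure.measurePreserving_swap
  have h2 := (volume_preserving_prodAssoc (α₁ := ℝ) (β₁ := ℝ) (γ₁ := ℝ)).symm
  exact h2.comp h1

/-- A function of `(x,t)` alone is not `L^q` in `((t,s),x)`, as it does not decay in `s`. Cutting
off to `s ∈ [0,T]` cures this and is invisible to weights supported there. -/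
lemma memLp_lift_fst {f : ℝ × ℝ → ℝ} (hf : MemLp f q) :
    MemLp (fun z : (ℝ × ℝ) × ℝ => (Icc 0 T).indicator (fun _ => f (z.2, z.1.1)) z.1.2) q := by
  have h1 : MemLp (fun y : (ℝ × ℝ) × ℝ => f y.1) q
      ((volume : Measure (ℝ × ℝ)).prod ((volume : Measure ℝ).restrict (Icc 0 T))) :=
    hf.comp_fst _
  have e : (volume : Measure (ℝ × ℝ)).prod ((volume : Measure ℝ).restrict (Icc 0 T))
      = (volume : Measure ((ℝ × ℝ) × ℝ)).restrict (univ ×ˢ Icc 0 T) := by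
    rw [Measure.volume_eq_prod (ℝ × ℝ) ℝ, ← Measure.prod_restrict, Measure.restrict_univ]
  rw [e, ← memLp_indicator_iff_restrict (MeasurableSet.univ.prod measurableSet_Icc)] at h1
  have h2 := h1.comp_measurePreserving measurePreserving_rotate
  have e2 : (fun z : (ℝ × ℝ) × ℝ => (Icc 0 T).indicator (fun _ => f (z.2, z.1.1)) z.1.2)
      = (univ ×ˢ Icc 0 T).indicator (fun y : (ℝ × ℝ) × ℝ => f y.1)
        ∘ fun z : (ℝ × ℝ) × ℝ => ((z.2, z.1.1), z.1.2) := by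
    ext z; simp [indicator]
  rw [e2]
  exact h2

lemma measurable_lift_fst {f : ℝ × ℝ → ℝ} (hf : Measurable f) :
    Measurable (fun z : (ℝ × ℝ) × ℝ => (Icc 0 T).indicator (fun _ => f (z.2, z.1.1)) z.1.2) := by
  have : (fun z : (ℝ × ℝ) × ℝ => (Icc 0 T).indicator (fun _ => f (z.2, z.1.1)) z.1.2)
      = {z : (ℝ × ℝ) × ℝ | z.1.2 ∈ Icc 0 T}.indicator fun z => f (z.2, z.1.1) := by
    ext z; simp [indicator]
  rw [this]
  exact (hf.comp (by fun_prop)).indicator (measurableSet_Icc.preimage (by fun_prop))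

lemma memLp_lift_snd {f : ℝ × ℝ → ℝ} (hf : MemLp f q) :
    MemLp (fun z : (ℝ × ℝ) × ℝ => (Icc 0 T).indicator (fun _ => f (z.2, z.1.2)) z.1.1) q :=
  (memLp_lift_fst hf).comp_measurePreserving measurePreserving_swap_fst

/-- A weight in the two times, times a function on `Ioc a c` in space. -/
noncomputable def weighted (a c : ℝ) (η : ℝ × ℝ → ℝ) (K : (ℝ × ℝ) × ℝ → ℝ) (z : (ℝ × ℝ) × ℝ) : ℝ :=
  η z.1 * (Ioc a c).indicator (fun x => K (z.1, x)) z.2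

lemma measurable_weighted {η : ℝ × ℝ → ℝ} {K : (ℝ × ℝ) × ℝ → ℝ} (hη : Measurable η)
    (hK : Measurable K) : Measurable (weighted a c η K) := by
  have : weighted a c η K
      = fun z => η z.1 * {z : (ℝ × ℝ) × ℝ | z.2 ∈ Ioc a c}.indicator K z := by
    ext z; simp [indicator, weighted]
  rw [this]
  exact (hη.comp measurable_fst).mul (hK.indicator (measurableSet_Ioc.preimage (by fun_prop)))

lemma integral_weighted_slice {η : ℝ × ℝ → ℝ} {K : (ℝ × ℝ) × ℝ → ℝ} (hac : a ≤ c)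
    (F : (ℝ × ℝ) × ℝ → ℝ) (y : ℝ × ℝ) :
    ∫ x, F (y, x) * weighted a c η K (y, x) = η y * ∫ x in a..c, F (y, x) * K (y, x) := by
  rw [intervalIntegral.integral_of_le hac, ← integral_indicator measurableSet_Ioc,
    ← integral_const_mul]
  refine integral_congr_ae (.of_forall fun x => ?_)
  by_cases hx : x ∈ Ioc a c <;> simp [weighted, hx]
  ring

variable {f : ℝ × ℝ → ℝ} {η : ℝ × ℝ → ℝ} {K : (ℝ × ℝ) × ℝ → ℝ}

lemma integrable_lift_fst_mul [ENNReal.HolderTriple q p 1] (hf : MemLp f q)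
    (hG : MemLp (weighted a c η K) p) (hη : ∀ y, η y ≠ 0 → y.2 ∈ Icc 0 T) :
    Integrable fun z : (ℝ × ℝ) × ℝ => f (z.2, z.1.1) * weighted a c η K z := by
  refine ((memLp_lift_fst (T := T) hf).integrable_mul hG).congr (.of_forall fun z => ?_)
  by_cases hz : η z.1 = 0
  · simp [weighted, hz]
  · simp only [Pi.mul_apply]
    rw [indicator_of_mem (hη _ hz)]

lemma integrable_lift_snd_mul [ENNReal.HolderTriple q p 1] (hf : MemLp f q)
    (hG : MemLp (weighted a c η K) p) (hη : ∀ y, η y ≠ 0 → y.1 ∈ Icc 0 T) :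
    Integrable fun z : (ℝ × ℝ) × ℝ => f (z.2, z.1.2) * weighted a c η K z := by
  refine ((memLp_lift_snd (T := T) hf).integrable_mul hG).congr (.of_forall fun z => ?_)
  by_cases hz : η z.1 = 0
  · simp [weighted, hz]
  · simp only [Pi.mul_apply]
    rw [indicator_of_mem (hη _ hz)]

/-- Convergence of Steklov averages in the first time variable. -/
lemma steklov_fst [ENNReal.HolderTriple q p 1] (hq1 : 1 ≤ q) (hq : q ≠ ⊤) (hac : a ≤ c)
    (hfm : Measurable f) (hf : MemLp f q) (hηm : Measurable η) (hK : Measurable K)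
    (hG : MemLp (weighted a c η K) p) (hη : ∀ y, η y ≠ 0 → y.2 ∈ Icc 0 T) :
    (∀ τ > 0, Integrable fun y : ℝ × ℝ =>
      η y * ∫ x in a..c, (∫ r in (y.1 - τ)..y.1, f (x, r)) * K (y, x)) ∧
    Tendsto (fun τ : ℝ => τ⁻¹ * ∫ y : ℝ × ℝ,
        η y * ∫ x in a..c, (∫ r in (y.1 - τ)..y.1, f (x, r)) * K (y, x)) (𝓝[>] 0)
      (𝓝 (∫ z : (ℝ × ℝ) × ℝ, f (z.2, z.1.1) * weighted a c η K z)) := by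
  set F : (ℝ × ℝ) × ℝ → ℝ := fun z => (Icc 0 T).indicator (fun _ => f (z.2, z.1.1)) z.1.2 with hF
  have hFm : Measurable F := measurable_lift_fst hfm
  have hFL : MemLp F q := memLp_lift_fst hf
  have hGm : Measurable (weighted a c η K) := measurable_weighted hηm hK
  -- Translation along `t` only, which leaves the cutoff in `s` and the weight untouched.
  set e : (ℝ × ℝ) × ℝ := ((1, 0), 0) with he
  have hpt : ∀ z : (ℝ × ℝ) × ℝ, ∀ r : ℝ, F (z + (-r) • e) * weighted a c η K z
      = f (z.2, z.1.1 - r) * weighted a c η K z := by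
    intro z r
    by_cases hz : η z.1 = 0
    · simp [weighted, hz]
    · have h2 := hη _ hz
      simp only [hF, he, Prod.smul_mk, smul_eq_mul, Prod.snd_add, Prod.fst_add, mul_zero, add_zero,
        mul_one, ← sub_eq_add_neg]
      rw [indicator_of_mem h2]
  have hint : ∀ τ > 0, ∀ z : (ℝ × ℝ) × ℝ, ∫ r in Ioc 0 τ, F (z + (-r) • e) * weighted a c η K z
      = (∫ r in (z.1.1 - τ)..z.1.1, f (z.2, r)) * weighted a c η K z := by
    intro τ hτ z
    simp_rw [hpt z]
    rw [integral_mul_const, ← intervalIntegral.integral_of_le (le_of_lt hτ),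
      intervalIntegral.integral_comp_sub_left (fun r => f (z.2, r)), sub_zero]
  have hI : ∀ τ > 0, Integrable fun z : (ℝ × ℝ) × ℝ =>
      (∫ r in (z.1.1 - τ)..z.1.1, f (z.2, r)) * weighted a c η K z := by
    intro τ hτ
    refine (integrable_prod_translate_mul hFm hGm hFL hG e τ).integral_prod_left.congr
      (.of_forall fun z => ?_)
    exact hint τ hτ z
  have hsl : ∀ τ : ℝ, ∀ y : ℝ × ℝ,
      ∫ x, (∫ r in (y.1 - τ)..y.1, f (x, r)) * weighted a c η K (y, x)
      = η y * ∫ x in a..c, (∫ r in (y.1 - τ)..y.1, f (x, r)) * K (y, x) := fun τ y =>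
    integral_weighted_slice hac (fun z => ∫ r in (z.1.1 - τ)..z.1.1, f (z.2, r)) y
  refine ⟨fun τ hτ => ?_, ?_⟩
  · refine (hI τ hτ).integral_prod_left.congr (.of_forall fun y => ?_)
    exact hsl τ y
  · have hlim := tendsto_steklov hq1 hq hFm hGm hFL hG e
    have e0 : ∫ z, F z * weighted a c η K z
        = ∫ z : (ℝ × ℝ) × ℝ, f (z.2, z.1.1) * weighted a c η K z := by
      refine integral_congr_ae (.of_forall fun z => ?_)
      simpa using hpt z 0
    rw [e0] at hlim
    refine hlim.congr' ?_
    filter_upwards [self_mem_nhdsWithin] with τ hτ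
    congr 1
    rw [integral_congr_ae (.of_forall (hint τ hτ)), Measure.volume_eq_prod (ℝ × ℝ) ℝ,
      integral_prod _ (hI τ hτ)]
    exact integral_congr_ae (.of_forall (hsl τ))

/-- Convergence of Steklov averages in the second time variable. -/
lemma steklov_snd [ENNReal.HolderTriple q p 1] (hq1 : 1 ≤ q) (hq : q ≠ ⊤) (hac : a ≤ c)
    (hfm : Measurable f) (hf : MemLp f q) (hηm : Measurable η) (hK : Measurable K)
    (hG : MemLp (weighted a c η K) p) (hη : ∀ y, η y ≠ 0 → y.1 ∈ Icc 0 T) :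
    (∀ τ > 0, Integrable fun y : ℝ × ℝ =>
      η y * ∫ x in a..c, (∫ r in (y.2 - τ)..y.2, f (x, r)) * K (y, x)) ∧
    Tendsto (fun τ : ℝ => τ⁻¹ * ∫ y : ℝ × ℝ,
        η y * ∫ x in a..c, (∫ r in (y.2 - τ)..y.2, f (x, r)) * K (y, x)) (𝓝[>] 0)
      (𝓝 (∫ z : (ℝ × ℝ) × ℝ, f (z.2, z.1.2) * weighted a c η K z)) := by
  have hsw : MeasurePreserving (Prod.swap : ℝ × ℝ → ℝ × ℝ) := Measure.measurePreserving_swap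
  have hse : MeasurableEmbedding (Prod.swap : ℝ × ℝ → ℝ × ℝ) :=
    MeasurableEquiv.prodComm.measurableEmbedding
  have hse3 : MeasurableEmbedding (fun z : (ℝ × ℝ) × ℝ => (z.1.swap, z.2)) :=
    (MeasurableEquiv.prodCongr MeasurableEquiv.prodComm (MeasurableEquiv.refl ℝ)).measurableEmbedding
  -- Exchanging the two times reduces the claim to the first time variable.
  obtain ⟨h1, h2⟩ := steklov_fst (T := T) (η := fun y => η y.swap)
    (K := fun z => K (z.1.swap, z.2)) hq1 hq hac hfm hf (hηm.comp measurable_swap)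
    (hK.comp (by fun_prop)) (hG.comp_measurePreserving measurePreserving_swap_fst)
    (fun y hy => hη _ hy)
  refine ⟨fun τ hτ => ?_, ?_⟩
  · rw [← hsw.integrable_comp_emb hse]
    exact h1 τ hτ
  · have e0 : ∫ z : (ℝ × ℝ) × ℝ, f (z.2, z.1.1)
          * weighted a c (fun y => η y.swap) (fun z => K (z.1.swap, z.2)) z
        = ∫ z : (ℝ × ℝ) × ℝ, f (z.2, z.1.2) * weighted a c η K z := by
      rw [← measurePreserving_swap_fst.integral_comp hse3]
      rfl
    rw [e0] at h2
    refine h2.congr fun τ => ?_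
    rw [← hsw.integral_comp hse]
    rfl

end Lift

/-! ### The doubled entropy inequality. -/

lemma IsSource.memLp {h : ℝ × ℝ → ℝ} (hh : IsSource h) (q : ENNReal) : MemLp h q := by
  obtain ⟨M, hM⟩ := hh.bound
  have hK : MemLp ((tsupport h).indicator fun _ => M) q :=
    memLp_indicator_const q (isClosed_tsupport h).measurableSet M
      (Or.inr hh.supp.isCompact.measure_lt_top.ne)
  refine hK.mono hh.meas.aestronglyMeasurable (.of_forall fun z => ?_)
  by_cases hz : z ∈ tsupport h
  · rw [indicator_of_mem hz, Real.norm_eq_abs, Real.norm_eq_abs]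
    exact (hM z).trans (le_abs_self M)
  · rw [image_eq_zero_of_notMem_tsupport hz]; simp

/-- Discrete integration by parts, in the limit. -/
lemma tendsto_integral_mul_diffQuot {A η : ℝ × ℝ → ℝ} (hA : Continuous A) (hη : ContDiff ℝ 1 η)
    (hs : HasCompactSupport η) (e : ℝ × ℝ) :
    Tendsto (fun τ : ℝ => τ⁻¹ * ∫ y, η y * (A y - A (y - τ • e))) (𝓝[>] 0)
      (𝓝 (-∫ y, A y * fderiv ℝ η y e)) := by
  let L := ContinuousLinearMap.mul ℝ ℝ
  have hA' : Continuous fun y => A (-y) := by fun_prop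
  -- The integral of `A y * η (x + y)` is a convolution in `x`, so it is differentiable with the
  -- derivative falling on `η`; continuity of `A` is enough.
  have hd := hs.hasFDerivAt_convolution_right L (μ := volume)
    (f := fun y => A (-y)) hA'.locallyIntegrable hη 0
  have hline : HasDerivAt (fun τ : ℝ => τ • e) e 0 := by
    simpa using (hasDerivAt_id (0 : ℝ)).smul_const e
  have hd2 := HasFDerivAt.comp_hasDerivAt (0 : ℝ) (f := fun τ : ℝ => τ • e)
    (by simpa using hd) hline
  rw [convolution_precompR_apply L hA'.locallyIntegrable (hs.fderiv ℝ)
    (hη.continuous_fderiv one_ne_zero)] at hd2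
  have key : ∀ B : ℝ × ℝ → ℝ, ∀ x, (convolution (fun y => A (-y)) B L volume) x
      = ∫ y, A y * B (x + y) := by
    intro B x
    rw [convolution, ← integral_neg_eq_self]
    simp [L]
  rw [key] at hd2
  simp only [zero_add] at hd2
  have hq := (hasDerivAt_iff_tendsto_slope_zero.1 hd2).mono_left
    (nhdsWithin_mono 0 (fun x (hx : 0 < x) => hx.ne' : Ioi (0 : ℝ) ⊆ {0}ᶜ))
  refine hq.neg.congr fun τ => ?_
  have i1 : Integrable fun y => A y * η y :=
    (hA.mul hη.continuous).integrable_of_hasCompactSupport hs.mul_left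
  have i2 : Integrable fun y => η y * A (y - τ • e) :=
    (hη.continuous.mul (by fun_prop)).integrable_of_hasCompactSupport hs.mul_right
  have e1 : ∫ y, A y * η (τ • e + y) = ∫ y, η y * A (y - τ • e) := by
    rw [← integral_add_left_eq_self (fun y => η y * A (y - τ • e)) (τ • e)]
    refine integral_congr_ae (.of_forall fun y => ?_)
    simp [mul_comm]
  simp only [Function.comp_apply, zero_add, zero_smul, key, smul_eq_mul]
  simp only [mul_sub]
  rw [integral_sub (by simpa only [mul_comm] using i1) i2, e1]
  simp only [mul_comm (A _)]
  ring

lemma integral_sub_sub_add {α : Type*} [MeasurableSpace α] {μ : Measure α} {u₁ u₂ u₃ u₄ : α → ℝ}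
    (h₁ : Integrable u₁ μ) (h₂ : Integrable u₂ μ) (h₃ : Integrable u₃ μ) (h₄ : Integrable u₄ μ) :
    ∫ x, u₁ x ∂μ - ∫ x, u₂ x ∂μ - ∫ x, u₃ x ∂μ + ∫ x, u₄ x ∂μ
      = ∫ x, (u₁ x - u₂ x - u₃ x + u₄ x) ∂μ := by
  rw [integral_add (f := fun x => u₁ x - u₂ x - u₃ x) ((h₁.sub h₂).sub h₃) h₄,
    integral_sub (f := fun x => u₁ x - u₂ x) (h₁.sub h₂) h₃, integral_sub h₁ h₂]

section Doubling

variable {p a c T R : ℝ} {ρ b : ℝ → ℝ} {w₁ w₂ g₁ g₂ f₁ f₂ η : ℝ × ℝ → ℝ}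

lemma memLp_weighted_of_abs_le_one {K : (ℝ × ℝ) × ℝ → ℝ} (hmeas : Measurable K)
    (hK1 : ∀ z, |K z| ≤ 1) (hη : Continuous η) (hs : HasCompactSupport η) (q : ENNReal) :
    MemLp (weighted a c η K) q := by
  obtain ⟨M, hM⟩ := hη.bounded_above_of_compact_support hs
  have hK : MemLp ((tsupport η ×ˢ Icc a c).indicator fun _ => M) q
      (volume : Measure ((ℝ × ℝ) × ℝ)) :=
    memLp_indicator_const q ((isClosed_tsupport η).measurableSet.prod measurableSet_Icc) M
      (Or.inr (hs.isCompact.prod isCompact_Icc).measure_lt_top.ne)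
  refine hK.mono (measurable_weighted hη.measurable hmeas).aestronglyMeasurable
    (.of_forall fun z => ?_)
  by_cases hz : z.1 ∈ tsupport η
  · by_cases hx : z.2 ∈ Ioc a c
    · rw [indicator_of_mem (show z ∈ tsupport η ×ˢ Icc a c from ⟨hz, hx.1.le, hx.2⟩), weighted,
        indicator_of_mem hx, norm_mul]
      refine le_trans ?_ (le_abs_self M)
      calc ‖η z.1‖ * ‖K (z.1, z.2)‖ ≤ M * 1 :=
            mul_le_mul (hM _) (hK1 _) (norm_nonneg _) ((norm_nonneg _).trans (hM z.1))
        _ = M := mul_one M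
    · simp [weighted, hx]
  · simp [weighted, image_eq_zero_of_notMem_tsupport hz]

lemma abs_doubledTest_le_one (hρ : IsBump R ρ) (z : (ℝ × ℝ) × ℝ) :
    |doubledTest ρ w₁ w₂ z| ≤ 1 := by
  rw [doubledTest, abs_of_nonneg (hρ.smoothStep_nonneg _)]
  exact hρ.smoothStep_le_one _

lemma memLp_weighted_doubledTestDeriv (hρ : IsBump R ρ) (h₁ : EnergyPair p a c T w₁ g₁)
    (h₂ : EnergyPair p a c T w₂ g₂) (hη : Continuous η) (hs : HasCompactSupport η)
    (hη1 : ∀ y, η y ≠ 0 → y ∈ Icc 0 T ×ˢ Icc 0 T) :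
    MemLp (weighted a c η (doubledTestDeriv ρ w₁ w₂ g₁ g₂)) (ENNReal.ofReal p) := by
  obtain ⟨M, hM⟩ := hη.bounded_above_of_compact_support hs
  obtain ⟨N, hN⟩ := hρ.exists_bound
  have hM0 : 0 ≤ M := (norm_nonneg _).trans (hM 0)
  have hN0 : 0 ≤ N := (abs_nonneg _).trans (hN 0)
  have hw₁ := h₁.cont
  have hw₂ := h₂.cont
  have hc := hρ.cont
  have hmeas : Measurable (doubledTestDeriv ρ w₁ w₂ g₁ g₂) := by
    refine (Continuous.measurable (by fun_prop)).mul ?_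
    exact (h₁.meas.comp (by fun_prop)).sub (h₂.meas.comp (by fun_prop))
  have hK := (((memLp_lift_fst (T := T) h₁.memLp).norm.add
    (memLp_lift_snd (T := T) h₂.memLp).norm).const_mul (M * N))
  refine hK.mono (measurable_weighted hη.measurable hmeas).aestronglyMeasurable
    (.of_forall fun z => ?_)
  by_cases hz : η z.1 = 0
  · simp only [weighted, hz, zero_mul, norm_zero]; exact norm_nonneg _
  · obtain ⟨ht, hs⟩ := hη1 _ hz
    by_cases hx : z.2 ∈ Ioc a c
    · simp only [weighted, indicator_of_mem hx, Pi.add_apply, indicator_of_mem ht,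
        indicator_of_mem hs]
      rw [norm_mul, Real.norm_of_nonneg (mul_nonneg (mul_nonneg hM0 hN0)
        (add_nonneg (norm_nonneg _) (norm_nonneg _))), mul_assoc, doubledTestDeriv, norm_mul]
      refine mul_le_mul (hM _) ?_ (by positivity) hM0
      exact mul_le_mul (hN _) (norm_sub_le _ _) (norm_nonneg _) hN0
    · simp only [weighted, indicator_of_notMem hx, mul_zero, norm_zero]; exact norm_nonneg _

lemma integrable_excess_mul_weighted (hp : 2 < p) (hf₁ : IsSource f₁) (hf₂ : IsSource f₂)
    (hη : Continuous η) (hs : HasCompactSupport η) (hη1 : ∀ y, η y ≠ 0 → y.1 ∈ Icc 0 T)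
    (hη2 : ∀ y, η y ≠ 0 → y.2 ∈ Icc 0 T) :
    Integrable fun z : (ℝ × ℝ) × ℝ =>
      max (f₁ (z.2, z.1.1) - f₂ (z.2, z.1.2)) 0 * weighted a c η (fun _ => 1) z := by
  have := holderTriple_flux hp
  have hmaxm : Measurable fun z : (ℝ × ℝ) × ℝ =>
      max (f₁ (z.2, z.1.1) - f₂ (z.2, z.1.2)) 0 :=
    ((hf₁.meas.comp (by fun_prop)).sub (hf₂.meas.comp (by fun_prop))).max measurable_const
  have hG1 := memLp_weighted_of_abs_le_one (a := a) (c := c) (K := fun _ => 1) measurable_const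
    (fun _ => by simp) hη hs (ENNReal.ofReal p)
  have m1 := integrable_lift_fst_mul (T := T) (hf₁.memLp (ENNReal.ofReal (p / (p - 1)))) hG1 hη2
  have m2 := integrable_lift_snd_mul (T := T) (hf₂.memLp (ENNReal.ofReal (p / (p - 1)))) hG1 hη1
  refine (m1.sub m2).mono (hmaxm.mul
    (measurable_weighted hη.measurable measurable_const)).aestronglyMeasurable
    (.of_forall fun z => ?_)
  rw [Pi.sub_apply, ← sub_mul, norm_mul, norm_mul]
  refine mul_le_mul_of_nonneg_right ?_ (norm_nonneg _)
  rw [Real.norm_of_nonneg (le_max_right _ _)]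
  exact max_le (le_abs_self _) (abs_nonneg _)

lemma weighted_excess_slice (hac : a ≤ c) (y : ℝ × ℝ) :
    ∫ x, max (f₁ (x, y.1) - f₂ (x, y.2)) 0 * weighted a c η (fun _ => 1) (y, x)
      = η y * ∫ x in a..c, max (f₁ (x, y.1) - f₂ (x, y.2)) 0 := by
  simpa using integral_weighted_slice (η := η) (K := fun _ => 1) hac
    (fun z : (ℝ × ℝ) × ℝ => max (f₁ (z.2, z.1.1) - f₂ (z.2, z.1.2)) 0) y

lemma integrable_weight_mul_excess (hp : 2 < p) (hac : a ≤ c) (hf₁ : IsSource f₁)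
    (hf₂ : IsSource f₂) (hη : Continuous η) (hs : HasCompactSupport η)
    (hη1 : ∀ y, η y ≠ 0 → y.1 ∈ Icc 0 T) (hη2 : ∀ y, η y ≠ 0 → y.2 ∈ Icc 0 T) :
    Integrable fun y => η y * ∫ x in a..c, max (f₁ (x, y.1) - f₂ (x, y.2)) 0 :=
  (integrable_excess_mul_weighted hp hf₁ hf₂ hη hs hη1 hη2).integral_prod_left.congr
    (.of_forall fun y => weighted_excess_slice hac y)

/-- The doubled entropy inequality for a smoothed Heaviside function. -/
lemma doubling_smoothed (hp : 2 < p) (hac : a < c) (hρ : IsBump R ρ) (hb : Continuous b)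
    (hm : StrictMono b) (h₁ : EnergyPair p a c T w₁ g₁) (h₂ : EnergyPair p a c T w₂ g₂)
    (hla : ∀ t ∈ Icc 0 T, ∀ s ∈ Icc 0 T, w₁ (a, t) ≤ w₂ (a, s))
    (hlc : ∀ t ∈ Icc 0 T, ∀ s ∈ Icc 0 T, w₁ (c, t) ≤ w₂ (c, s))
    (hf₁ : IsSource f₁) (hf₂ : IsSource f₂)
    (hsub : IsSubsolution p b a c T w₁ g₁ f₁) (hsup : IsSupersolution p b a c T w₂ g₂ f₂)
    (hη : ContDiff ℝ 1 η) (hs : HasCompactSupport η) (hη0 : ∀ y, 0 ≤ η y)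
    (hηT : tsupport η ⊆ Ioo 0 T ×ˢ Ioo 0 T) :
    -(∫ y, upperEnergy R ρ b a c w₁ w₂ y * fderiv ℝ η y (1, 0))
      - (∫ y, lowerEnergy R ρ b a c w₁ w₂ y * fderiv ℝ η y (0, 1))
      ≤ ∫ y, η y * ∫ x in a..c, max (f₁ (x, y.1) - f₂ (x, y.2)) 0 := by
  have := holderTriple_flux hp
  have hq1 := one_le_flux_exponent hp
  have hqt : ENNReal.ofReal (p / (p - 1)) ≠ ⊤ := ENNReal.ofReal_ne_top
  have hηc := hη.continuous
  have hmem : ∀ y, η y ≠ 0 → y ∈ Ioo 0 T ×ˢ Ioo 0 T := fun y hy =>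
    hηT (subset_tsupport η hy)
  have hη1 : ∀ y, η y ≠ 0 → y.1 ∈ Icc 0 T := fun y hy => Ioo_subset_Icc_self (hmem y hy).1
  have hη2 : ∀ y, η y ≠ 0 → y.2 ∈ Icc 0 T := fun y hy => Ioo_subset_Icc_self (hmem y hy).2
  -- The support of `η` stays at distance `δ` from the axes, so for `τ < δ` the earlier times `t -
  -- τ` and `s - τ` remain nonnegative.
  obtain ⟨δ, hδ, hδs⟩ : ∃ δ > 0, ∀ y, η y ≠ 0 → δ ≤ y.1 ∧ δ ≤ y.2 := by
    rcases (tsupport η).eq_empty_or_nonempty with he | hne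
    · refine ⟨1, one_pos, fun y hy => absurd (subset_tsupport η hy) ?_⟩
      simp [he]
    · obtain ⟨y₀, hy₀, hmin⟩ := hs.isCompact.exists_isMinOn hne
        (f := fun y : ℝ × ℝ => min y.1 y.2) (by fun_prop)
      refine ⟨min y₀.1 y₀.2, lt_min (hηT hy₀).1.1 (hηT hy₀).2.1, fun y hy => ?_⟩
      have := hmin (subset_tsupport η hy)
      exact ⟨le_trans this (min_le_left _ _), le_trans this (min_le_right _ _)⟩
  have hcA := continuous_upperEnergy (a := a) (c := c) hρ hb h₁.cont h₂.cont
  have hcB := continuous_lowerEnergy (a := a) (c := c) hρ hb h₁.cont h₂.cont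
  set A := upperEnergy R ρ b a c w₁ w₂
  set B := lowerEnergy R ρ b a c w₁ w₂
  set φ := doubledTest ρ w₁ w₂ with hφ
  set ψ := doubledTestDeriv ρ w₁ w₂ g₁ g₂ with hψ
  have hw₁ := h₁.cont
  have hw₂ := h₂.cont
  have hH := hρ.continuous_smoothStep
  have hρc := hρ.cont
  have hφm : Measurable φ := Continuous.measurable (by rw [hφ]; unfold doubledTest; fun_prop)
  have hψm : Measurable ψ := by
    refine (Continuous.measurable (by fun_prop)).mul ?_
    exact (h₁.meas.comp (by fun_prop)).sub (h₂.meas.comp (by fun_prop))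
  have hGφ : MemLp (weighted a c η φ) (ENNReal.ofReal p) :=
    memLp_weighted_of_abs_le_one hφm (abs_doubledTest_le_one hρ) hηc hs _
  have hGψ : MemLp (weighted a c η ψ) (ENNReal.ofReal p) :=
    memLp_weighted_doubledTestDeriv hρ h₁ h₂ hηc hs
      fun y hy => ⟨hη1 y hy, hη2 y hy⟩
  have hP₁ := memLp_flux hp h₁.memLp
  have hP₂ := memLp_flux hp h₂.memLp
  have hP₁m : Measurable fun z => flux p (g₁ z) := (continuous_flux hp).measurable.comp h₁.meas
  have hP₂m : Measurable fun z => flux p (g₂ z) := (continuous_flux hp).measurable.comp h₂.meas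
  obtain ⟨i1, l1⟩ := steklov_fst hq1 hqt hac.le hf₁.meas (hf₁.memLp _) hηc.measurable hφm hGφ hη2
  obtain ⟨i2, l2⟩ := steklov_snd hq1 hqt hac.le hf₂.meas (hf₂.memLp _) hηc.measurable hφm hGφ hη1
  obtain ⟨i3, l3⟩ := steklov_fst hq1 hqt hac.le hP₁m hP₁ hηc.measurable hψm hGψ hη2
  obtain ⟨i4, l4⟩ := steklov_snd hq1 hqt hac.le hP₂m hP₂ hηc.measurable hψm hGψ hη1
  have lA := tendsto_integral_mul_diffQuot hcA hη hs (1, 0)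
  have lB := tendsto_integral_mul_diffQuot hcB hη hs (0, 1)
  -- Each requirement involves a single time and holds for almost every one; pulling it back along a
  -- projection gives it for almost every pair.
  have hae : ∀ᵐ y : ℝ × ℝ, η y ≠ 0 → TestPair p a c (fun x => φ (y, x)) (fun x => ψ (y, x)) := by
    have a1 := (Measure.quasiMeasurePreserving_fst (μ := (volume : Measure ℝ))
      (ν := (volume : Measure ℝ))).ae
      ((ae_restrict_iff' measurableSet_Ioo).1 h₁.primitive)
    have a2 := (Measure.quasiMeasurePreserving_snd (μ := (volume : Measure ℝ))
      (ν := (volume : Measure ℝ))).ae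
      ((ae_restrict_iff' measurableSet_Ioo).1 h₂.primitive)
    have a3 := (Measure.quasiMeasurePreserving_fst (μ := (volume : Measure ℝ))
      (ν := (volume : Measure ℝ))).ae (h₁.ae_memLp_slice hp)
    have a4 := (Measure.quasiMeasurePreserving_snd (μ := (volume : Measure ℝ))
      (ν := (volume : Measure ℝ))).ae (h₂.ae_memLp_slice hp)
    rw [← Measure.volume_eq_prod] at a1 a2 a3 a4
    filter_upwards [a1, a2, a3, a4] with y y1 y2 y3 y4 hy
    exact testPair_doubledTest hp hac hρ h₁ h₂ y3 y4 (y1 (hmem y hy).1) (y2 (hmem y hy).2)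
      (hla _ (hη1 y hy) _ (hη2 y hy)) (hlc _ (hη1 y hy) _ (hη2 y hy))
  have hineq : ∀ᶠ τ in 𝓝[>] (0 : ℝ),
      τ⁻¹ * (∫ y, η y * (A y - A (y - τ • ((1, 0) : ℝ × ℝ))))
        + τ⁻¹ * (∫ y, η y * (B y - B (y - τ • ((0, 1) : ℝ × ℝ))))
      ≤ τ⁻¹ * (∫ y : ℝ × ℝ, η y * ∫ x in a..c, (∫ r in (y.1 - τ)..y.1, f₁ (x, r)) * φ (y, x))
        - τ⁻¹ * (∫ y : ℝ × ℝ, η y * ∫ x in a..c, (∫ r in (y.2 - τ)..y.2, f₂ (x, r)) * φ (y, x))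
        - τ⁻¹ * (∫ y : ℝ × ℝ, η y * ∫ x in a..c,
            (∫ r in (y.1 - τ)..y.1, flux p (g₁ (x, r))) * ψ (y, x))
        + τ⁻¹ * (∫ y : ℝ × ℝ, η y * ∫ x in a..c,
            (∫ r in (y.2 - τ)..y.2, flux p (g₂ (x, r))) * ψ (y, x)) := by
    filter_upwards [Ioo_mem_nhdsGT hδ] with τ hτ
    rw [← mul_add, ← mul_sub, ← mul_sub, ← mul_add]
    refine mul_le_mul_of_nonneg_left ?_ (inv_nonneg.2 hτ.1.le)
    have j1 : Integrable fun y => η y * (A y - A (y - τ • ((1, 0) : ℝ × ℝ))) :=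
      Continuous.integrable_of_hasCompactSupport (by fun_prop) hs.mul_right
    have j2 : Integrable fun y => η y * (B y - B (y - τ • ((0, 1) : ℝ × ℝ))) :=
      Continuous.integrable_of_hasCompactSupport (by fun_prop) hs.mul_right
    rw [← integral_add j1 j2,
      integral_sub_sub_add (i1 τ hτ.1) (i2 τ hτ.1) (i3 τ hτ.1) (i4 τ hτ.1)]
    refine integral_mono_ae (j1.add j2)
      ((((i1 τ hτ.1).sub (i2 τ hτ.1)).sub (i3 τ hτ.1)).add (i4 τ hτ.1)) ?_
    filter_upwards [hae] with y hy
    by_cases hyη : η y = 0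
    · simp [hyη]
    · have key := energy_increments_le hac hρ hb hm hw₁ hw₂ hsub hsup hτ.1
        (hτ.2.le.trans (hδs y hyη).1) (hτ.2.le.trans (hδs y hyη).2) (hmem y hyη).1.2
        (hmem y hyη).2.2 (hy hyη)
      have := mul_le_mul_of_nonneg_left key (hη0 y)
      have e1 : y - τ • ((1, 0) : ℝ × ℝ) = (y.1 - τ, y.2) := by ext <;> simp
      have e2 : y - τ • ((0, 1) : ℝ × ℝ) = (y.1, y.2 - τ) := by ext <;> simp
      simp only [e1, e2]
      refine le_trans (le_of_eq ?_) (le_trans this (le_of_eq ?_))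
      · simp only [A, B]; ring
      · ring
  have hlim := le_of_tendsto_of_tendsto (lA.add lB) (((l1.sub l2).sub l3).add l4) hineq
  have k1 := integrable_lift_fst_mul (T := T) (hf₁.memLp (ENNReal.ofReal (p / (p - 1)))) hGφ hη2
  have k2 := integrable_lift_snd_mul (T := T) (hf₂.memLp (ENNReal.ofReal (p / (p - 1)))) hGφ hη1
  have k3 := integrable_lift_fst_mul (T := T) hP₁ hGψ hη2
  have k4 := integrable_lift_snd_mul (T := T) hP₂ hGψ hη1
  rw [integral_sub_sub_add k1 k2 k3 k4] at hlim
  rw [sub_eq_add_neg]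
  refine hlim.trans ?_
  have k5 := integrable_excess_mul_weighted (a := a) (c := c) hp hf₁ hf₂ hηc hs hη1 hη2
  have e5 : ∫ y, η y * ∫ x in a..c, max (f₁ (x, y.1) - f₂ (x, y.2)) 0
      = ∫ z : (ℝ × ℝ) × ℝ, max (f₁ (z.2, z.1.1) - f₂ (z.2, z.1.2)) 0
          * weighted a c η (fun _ => 1) z := by
    rw [Measure.volume_eq_prod (ℝ × ℝ) ℝ, integral_prod _ k5]
    refine integral_congr_ae (.of_forall fun y => ?_)
    exact (weighted_excess_slice hac.le y).symm
  rw [e5]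
  refine integral_mono (((k1.sub k2).sub k3).add k4) k5 fun z => ?_
  -- Monotonicity of the flux and `ρ ≥ 0` give the diffusion term a sign, so it can be discarded. No
  -- doubling in space is needed because both gradients are taken at the same `x`.
  have hψ0 : 0 ≤ (flux p (g₁ (z.2, z.1.1)) - flux p (g₂ (z.2, z.1.2))) * ψ z := by
    have := mul_nonneg (hρ.nonneg (w₁ (z.2, z.1.1) - w₂ (z.2, z.1.2)))
      (flux_sub_mul_sub_nonneg hp (g₁ (z.2, z.1.1)) (g₂ (z.2, z.1.2)))
    rw [hψ, doubledTestDeriv]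
    linarith
  have hφ0 : 0 ≤ φ z := hρ.smoothStep_nonneg _
  have hφ1 : φ z ≤ 1 := hρ.smoothStep_le_one _
  have hfφ : (f₁ (z.2, z.1.1) - f₂ (z.2, z.1.2)) * φ z
      ≤ max (f₁ (z.2, z.1.1) - f₂ (z.2, z.1.2)) 0 := by
    calc _ ≤ max (f₁ (z.2, z.1.1) - f₂ (z.2, z.1.2)) 0 * φ z :=
          mul_le_mul_of_nonneg_right (le_max_left _ _) hφ0
      _ ≤ max (f₁ (z.2, z.1.1) - f₂ (z.2, z.1.2)) 0 * 1 :=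
          mul_le_mul_of_nonneg_left hφ1 (le_max_right _ _)
      _ = _ := mul_one _
  by_cases hx : z.2 ∈ Ioc a c
  · simp only [weighted, indicator_of_mem hx]
    have := mul_le_mul_of_nonneg_left (show (f₁ (z.2, z.1.1) - f₂ (z.2, z.1.2)) * φ z
      - (flux p (g₁ (z.2, z.1.1)) - flux p (g₂ (z.2, z.1.2))) * ψ z
      ≤ max (f₁ (z.2, z.1.1) - f₂ (z.2, z.1.2)) 0 by linarith) (hη0 z.1)
    refine le_trans (le_of_eq ?_) (le_trans this (le_of_eq ?_)) <;> ring
  · simp [weighted, hx]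

end Doubling

section Doubling

variable {p a c T : ℝ} {b : ℝ → ℝ} {w₁ w₂ g₁ g₂ f₁ f₂ η : ℝ × ℝ → ℝ}

lemma exists_modulus (hb : Continuous b) {N κ : ℝ} (hκ : 0 < κ) :
    ∃ R > 0, ∀ y, |y| ≤ N → ∀ l, |l| ≤ R → |b (y + l) - b y| ≤ κ := by
  have hu := (isCompact_Icc (a := -N - 1) (b := N + 1)).uniformContinuousOn_of_continuous
    hb.continuousOn
  obtain ⟨δ, hδ, h⟩ := Metric.uniformContinuousOn_iff.1 hu κ hκ
  refine ⟨min (δ / 2) 1, by positivity, fun y hy l hl => ?_⟩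
  have h1 := abs_le.1 hy
  have h2 := abs_le.1 (hl.trans (min_le_right _ _))
  refine (h (y + l) ⟨by linarith, by linarith⟩ y ⟨by linarith, by linarith⟩ ?_).le
  rw [Real.dist_eq, add_sub_cancel_left]
  exact (hl.trans (min_le_left _ _)).trans_lt (half_lt_self hδ)

/-- The doubled entropy inequality. -/
lemma doubling (hp : 2 < p) (hac : a < c) (hb : Continuous b)
    (hm : StrictMono b) (h₁ : EnergyPair p a c T w₁ g₁) (h₂ : EnergyPair p a c T w₂ g₂)
    (hla : ∀ t ∈ Icc 0 T, ∀ s ∈ Icc 0 T, w₁ (a, t) ≤ w₂ (a, s))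
    (hlc : ∀ t ∈ Icc 0 T, ∀ s ∈ Icc 0 T, w₁ (c, t) ≤ w₂ (c, s))
    (hf₁ : IsSource f₁) (hf₂ : IsSource f₂)
    (hsub : IsSubsolution p b a c T w₁ g₁ f₁) (hsup : IsSupersolution p b a c T w₂ g₂ f₂)
    (hη : ContDiff ℝ 1 η) (hs : HasCompactSupport η) (hη0 : ∀ y, 0 ≤ η y)
    (hηT : tsupport η ⊆ Ioo 0 T ×ˢ Ioo 0 T) :
    -(∫ y, positiveEnergy b a c w₁ w₂ y * fderiv ℝ η y (1, 1))
      ≤ ∫ y, η y * ∫ x in a..c, max (f₁ (x, y.1) - f₂ (x, y.2)) 0 := by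
  obtain ⟨N₁, hN₁⟩ := (isCompact_Icc (a := a) (b := c)).prod (isCompact_Icc (a := 0) (b := T))
    |>.exists_bound_of_continuousOn h₁.cont.continuousOn
  obtain ⟨N₂, hN₂⟩ := (isCompact_Icc (a := a) (b := c)).prod (isCompact_Icc (a := 0) (b := T))
    |>.exists_bound_of_continuousOn h₂.cont.continuousOn
  have hfd : ∀ e : ℝ × ℝ, Continuous fun y => fderiv ℝ η y e := fun e =>
    (hη.continuous_fderiv one_ne_zero).clm_apply continuous_const
  have hfs : ∀ e : ℝ × ℝ, HasCompactSupport fun y => fderiv ℝ η y e := fun e =>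
    (hs.fderiv ℝ).comp_left (g := fun L : ℝ × ℝ →L[ℝ] ℝ => L e) rfl
  have hz : ∀ e : ℝ × ℝ, ∀ y, y ∉ Icc 0 T ×ˢ Icc 0 T → fderiv ℝ η y e = 0 := fun e y hy => by
    have : y ∉ tsupport (fderiv ℝ η) := fun h => hy <| by
      have := hηT (tsupport_fderiv_subset ℝ h)
      exact ⟨Ioo_subset_Icc_self this.1, Ioo_subset_Icc_self this.2⟩
    rw [image_eq_zero_of_notMem_tsupport this]; rfl
  set P := positiveEnergy b a c w₁ w₂ with hP
  have hPc : Continuous P := continuous_positiveEnergy hb h₁.cont h₂.cont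
  have hint : ∀ (A : ℝ × ℝ → ℝ) (e : ℝ × ℝ), Continuous A →
      Integrable fun y => A y * fderiv ℝ η y e := fun A e hA =>
    (hA.mul (hfd e)).integrable_of_hasCompactSupport (hfs e).mul_left
  have hiD : ∀ e, Integrable fun y => |fderiv ℝ η y e| := fun e =>
    ((hfd e).integrable_of_hasCompactSupport (hfs e)).abs
  set C := (c - a) * ((∫ y, |fderiv ℝ η y (1, 0)|) + ∫ y, |fderiv ℝ η y (0, 1)|) with hC
  have hbound : ∀ (A : ℝ × ℝ → ℝ) (e : ℝ × ℝ) (κ : ℝ), Continuous A →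
      (∀ y ∈ Icc 0 T ×ˢ Icc 0 T, |A y - P y| ≤ κ * (c - a)) →
      ∫ y, A y * fderiv ℝ η y e
        ≤ (∫ y, P y * fderiv ℝ η y e) + κ * (c - a) * ∫ y, |fderiv ℝ η y e| := by
    intro A e κ hA hAP
    rw [← integral_const_mul, ← integral_add (hint P e hPc) ((hiD e).const_mul _)]
    refine integral_mono (hint A e hA) ((hint P e hPc).add ((hiD e).const_mul _)) fun y => ?_
    by_cases hy : y ∈ Icc 0 T ×ˢ Icc 0 T
    · have h1 : (A y - P y) * fderiv ℝ η y e ≤ κ * (c - a) * |fderiv ℝ η y e| := by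
        refine (le_abs_self _).trans ?_
        rw [abs_mul]
        exact mul_le_mul_of_nonneg_right (hAP y hy) (abs_nonneg _)
      simp only
      linarith
    · simp [hz e y hy]
  -- The width `R` is chosen from the modulus of `b` on the ranges of `w₁` and `w₂`, so both
  -- energies are within `κ * (c - a)` of their common limit. The constant `C` depends on `η` and
  -- the interval but not on `κ`.
  have hall : ∀ κ > 0, -(∫ y, P y * fderiv ℝ η y (1, 1))
      ≤ (∫ y, η y * ∫ x in a..c, max (f₁ (x, y.1) - f₂ (x, y.2)) 0) + κ * C := by
    intro κ hκ
    obtain ⟨R, hR, hmod⟩ := exists_modulus hb (N := max N₁ N₂) hκ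
    obtain ⟨ρ, hρ, -⟩ := exists_contDiff_isBump hR
    have hmain := doubling_smoothed hp hac hρ hb hm h₁ h₂ hla hlc hf₁ hf₂ hsub hsup hη hs hη0 hηT
    have b1 := hbound (upperEnergy R ρ b a c w₁ w₂) (1, 0) κ
      (continuous_upperEnergy hρ hb h₁.cont h₂.cont) fun y hy => by
        refine abs_upperEnergy_sub_le hac hρ hb h₁.cont h₂.cont fun x hx l hl => ?_
        refine hmod _ ((hN₂ (x, y.2) ⟨hx, hy.2⟩).trans (le_max_right _ _)) l ?_
        rw [abs_of_nonneg hl.1]; exact hl.2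
    have b2 := hbound (lowerEnergy R ρ b a c w₁ w₂) (0, 1) κ
      (continuous_lowerEnergy hρ hb h₁.cont h₂.cont) fun y hy => by
        refine abs_lowerEnergy_sub_le hac hρ hb h₁.cont h₂.cont fun x hx l hl => ?_
        refine hmod _ ((hN₁ (x, y.1) ⟨hx, hy.1⟩).trans (le_max_left _ _)) (-l) ?_
        rw [abs_neg, abs_of_nonneg hl.1]; exact hl.2
    -- Only now, with a single limit entropy, do the two partial derivatives of `η` combine into the
    -- derivative along the diagonal.
    have e1 : ∫ y, P y * fderiv ℝ η y (1, 1)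
        = (∫ y, P y * fderiv ℝ η y (1, 0)) + ∫ y, P y * fderiv ℝ η y (0, 1) := by
      rw [← integral_add (hint P _ hPc) (hint P _ hPc)]
      refine integral_congr_ae (.of_forall fun y => ?_)
      have : ((1, 1) : ℝ × ℝ) = (1, 0) + (0, 1) := by ext <;> simp
      simp only [this, map_add, mul_add]
    have e2 : κ * C = κ * (c - a) * (∫ y, |fderiv ℝ η y (1, 0)|)
        + κ * (c - a) * ∫ y, |fderiv ℝ η y (0, 1)| := by rw [hC]; ring
    linarith
  refine le_of_forall_pos_le_add fun ε hε => ?_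
  have hC0 : 0 ≤ C := mul_nonneg (sub_pos.2 hac).le
    (add_nonneg (integral_nonneg fun _ => abs_nonneg _) (integral_nonneg fun _ => abs_nonneg _))
  have h := hall (ε / (C + 1)) (by positivity)
  have : ε / (C + 1) * C ≤ ε := by
    rw [div_mul_eq_mul_div, div_le_iff₀ (by positivity)]
    nlinarith
  linarith

end Doubling

/-! ### Return to the diagonal and the comparison principle. -/

lemma IsBump.integral_mul_eq {R : ℝ} {ρ : ℝ → ℝ} (h : IsBump R ρ) (F : ℝ → ℝ) :
    ∫ r, ρ r * F r = ∫ r in (0 : ℝ)..R, ρ r * F r := by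
  rw [intervalIntegral.integral_of_le h.pos.le, setIntegral_eq_integral_of_forall_compl_eq_zero]
  intro x hx
  rw [h.eq_zero x fun hx' => hx ⟨hx'.1, hx'.2.le⟩, zero_mul]

lemma IsBump.contDiff_smoothStep {R : ℝ} {ρ : ℝ → ℝ} (h : IsBump R ρ) :
    ContDiff ℝ 1 (smoothStep ρ) := by
  rw [contDiff_one_iff_deriv]
  refine ⟨fun r => (h.hasDerivAt_smoothStep r).differentiableAt, ?_⟩
  rw [show deriv (smoothStep ρ) = ρ from funext fun r => (h.hasDerivAt_smoothStep r).deriv]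
  exact h.cont

section Diagonal

variable {p a c T : ℝ} {b : ℝ → ℝ} {w₁ w₂ g₁ g₂ f₁ f₂ : ℝ × ℝ → ℝ}

lemma measurePreserving_shear :
    MeasurePreserving (fun z : ℝ × ℝ => (z.1, z.1 + z.2)) :=
  measurePreserving_prod_add volume volume

lemma measurableEmbedding_shear :
    MeasurableEmbedding (fun z : ℝ × ℝ => (z.1, z.1 + z.2)) :=
  (MeasurableEquiv.shearAddRight ℝ).measurableEmbedding

/-- The source excess along shifted diagonals is small for small shifts. -/
lemma tendsto_shift_excess {h : ℝ × ℝ → ℝ} (hh : IsSource h) :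
    Tendsto (fun σ : ℝ => ∫ z : ℝ × ℝ, |h (z.1, z.2 + σ) - h z|) (𝓝 0) (𝓝 0) := by
  have h1 := tendsto_eLpNorm_translate_sub le_rfl ENNReal.one_ne_top (hh.memLp 1)
  have h2 : Tendsto (fun σ : ℝ => ((0, σ) : ℝ × ℝ)) (𝓝 0) (𝓝 0) := by
    have : Continuous fun σ : ℝ => ((0, σ) : ℝ × ℝ) := by fun_prop
    exact this.tendsto 0
  have h3 := (ENNReal.tendsto_toReal ENNReal.zero_ne_top).comp (h1.comp h2)
  refine h3.congr fun σ => ?_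
  have hm : AEStronglyMeasurable (fun z : ℝ × ℝ => h (z + (0, σ)) - h z) :=
    ((memLp_translate (hh.memLp 1) _).sub (hh.memLp 1)).aestronglyMeasurable
  simp only [Function.comp_apply]
  rw [eLpNorm_one_eq_lintegral_enorm, ← integral_norm_eq_lintegral_enorm hm]
  refine integral_congr_ae (.of_forall fun z => ?_)
  have : z + (0, σ) = (z.1, z.2 + σ) := by ext <;> simp
  simp only [this, Real.norm_eq_abs]

/-- Since `f₁ ≤ f₂` at equal times, the excess `f₁(t) - f₂(t + σ)` is at most `|f₂(t + σ) - f₂(t)|`,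
which is small in `L¹` for small shifts. No continuity of the sources is needed. -/
lemma integral_excess_le (hac : a ≤ c) (hf₂ : IsSource f₂)
    (hf : ∀ᵐ z ∂(volume.restrict (Ioo a c ×ˢ Ioo 0 T)), f₁ z ≤ f₂ z) {θ : ℝ → ℝ}
    (hθ0 : ∀ t, 0 ≤ θ t)
    (hθ1 : ∀ t, θ t ≤ 1) (hθT : ∀ t, θ t ≠ 0 → t ∈ Ioo 0 T) (σ : ℝ) :
    ∫ t, θ t * ∫ x in a..c, max (f₁ (x, t) - f₂ (x, t + σ)) 0
      ≤ ∫ z : ℝ × ℝ, |f₂ (z.1, z.2 + σ) - f₂ z| := by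
  have hI : Integrable fun z : ℝ × ℝ => |f₂ (z.1, z.2 + σ) - f₂ z| := by
    have h1 : Integrable fun z : ℝ × ℝ => f₂ (z + (0, σ)) - f₂ z :=
      memLp_one_iff_integrable.1 ((memLp_translate (hf₂.memLp 1) _).sub (hf₂.memLp 1))
    refine h1.abs.congr (.of_forall fun z => ?_)
    have : z + (0, σ) = (z.1, z.2 + σ) := by ext <;> simp
    simp only [this]
  have hI' := hI
  rw [Measure.volume_eq_prod] at hI'
  have haef : ∀ᵐ t : ℝ, ∀ᵐ x : ℝ, (x, t) ∈ Ioo a c ×ˢ Ioo 0 T → f₁ (x, t) ≤ f₂ (x, t) := by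
    have h1 := (ae_restrict_iff' (measurableSet_Ioo.prod measurableSet_Ioo)).1 hf
    have h2 := (Measure.measurePreserving_swap (μ := (volume : Measure ℝ))
      (ν := (volume : Measure ℝ))).quasiMeasurePreserving.ae h1
    exact Measure.ae_ae_of_ae_prod h2
  rw [Measure.volume_eq_prod, integral_prod_symm _ hI']
  -- Without integrability the left side is `0` by convention, and the right side is nonnegative.
  by_cases hL : Integrable fun t => θ t * ∫ x in a..c, max (f₁ (x, t) - f₂ (x, t + σ)) 0
  swap
  · rw [integral_undef hL]
    exact integral_nonneg fun _ => integral_nonneg fun _ => abs_nonneg _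
  refine integral_mono_ae hL hI'.integral_prod_right ?_
  filter_upwards [haef, hI'.prod_left_ae] with t ht htI
  by_cases h0 : θ t = 0
  · rw [h0, zero_mul]; exact integral_nonneg fun _ => abs_nonneg _
  have htT := hθT t h0
  have h1 : ∫ x in a..c, max (f₁ (x, t) - f₂ (x, t + σ)) 0
      ≤ ∫ x, |f₂ (x, t + σ) - f₂ (x, t)| := by
    rw [intervalIntegral.integral_of_le hac, integral_Ioc_eq_integral_Ioo]
    refine le_trans ?_ (setIntegral_le_integral (s := Ioo a c) htI
      (.of_forall fun _ => abs_nonneg _))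
    refine integral_mono_of_nonneg (.of_forall fun _ => le_max_right _ _) htI.integrableOn ?_
    rw [EventuallyLE, ae_restrict_iff' measurableSet_Ioo]
    filter_upwards [ht] with x hx hxI
    have := hx ⟨hxI, htT⟩
    refine max_le ?_ (abs_nonneg _)
    have := neg_abs_le (f₂ (x, t + σ) - f₂ (x, t))
    linarith
  have h2 : 0 ≤ ∫ x, |f₂ (x, t + σ) - f₂ (x, t)| := integral_nonneg fun _ => abs_nonneg _
  calc _ ≤ θ t * ∫ x, |f₂ (x, t + σ) - f₂ (x, t)| := mul_le_mul_of_nonneg_left h1 (hθ0 t)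
    _ ≤ 1 * ∫ x, |f₂ (x, t + σ) - f₂ (x, t)| := mul_le_mul_of_nonneg_right (hθ1 t) h2
    _ = _ := one_mul _

/-- Differential form of the comparison on the diagonal `s = t`. -/
lemma integral_diagonal_mul_deriv_nonneg (hp : 2 < p) (hac : a < c) (hb : Continuous b)
    (hm : StrictMono b) (h₁ : EnergyPair p a c T w₁ g₁) (h₂ : EnergyPair p a c T w₂ g₂)
    (hla : ∀ t ∈ Icc 0 T, ∀ s ∈ Icc 0 T, w₁ (a, t) ≤ w₂ (a, s))
    (hlc : ∀ t ∈ Icc 0 T, ∀ s ∈ Icc 0 T, w₁ (c, t) ≤ w₂ (c, s))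
    (hf₁ : IsSource f₁) (hf₂ : IsSource f₂)
    (hsub : IsSubsolution p b a c T w₁ g₁ f₁) (hsup : IsSupersolution p b a c T w₂ g₂ f₂)
    (hf : ∀ᵐ z ∂(volume.restrict (Ioo a c ×ˢ Ioo 0 T)), f₁ z ≤ f₂ z)
    {θ θ' : ℝ → ℝ} {t₁ t₂ : ℝ} (ht₁ : 0 < t₁) (ht₂ : t₂ < T) (hθ : ContDiff ℝ 1 θ)
    (hθd : ∀ t, HasDerivAt θ (θ' t) t) (hθc : Continuous θ') (hθ0 : ∀ t, 0 ≤ θ t)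
    (hθ1 : ∀ t, θ t ≤ 1) (hθT : ∀ t, t ∉ Icc t₁ t₂ → θ t = 0) (hθT' : ∀ t, t ∉ Icc t₁ t₂ → θ' t = 0) :
    0 ≤ ∫ t, positiveEnergy b a c w₁ w₂ (t, t) * θ' t := by
  set P := positiveEnergy b a c w₁ w₂ with hP
  have hPc : Continuous P := continuous_positiveEnergy hb h₁.cont h₂.cont
  have hθ's : HasCompactSupport θ' := HasCompactSupport.intro isCompact_Icc hθT'
  have hθs : HasCompactSupport θ := HasCompactSupport.intro isCompact_Icc hθT
  have hiθ : Integrable fun t => |θ' t| := (hθc.integrable_of_hasCompactSupport hθ's).abs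
  set I := ∫ t, |θ' t| with hI
  have hI0 : 0 ≤ I := integral_nonneg fun _ => abs_nonneg _
  -- The summand `κ` comes from shifting the source, and `κ * I` from replacing averages of `P` near
  -- the diagonal by its diagonal values.
  have hall : ∀ κ > 0, -(∫ t, P (t, t) * θ' t) ≤ κ + κ * I := by
    intro κ hκ
    obtain ⟨δ₁, hδ₁, hmod⟩ : ∃ δ > 0, ∀ t ∈ Icc t₁ t₂, ∀ l ∈ Icc 0 δ,
        |P (t, t + l) - P (t, t)| ≤ κ := by
      have hu := ((isCompact_Icc (a := t₁) (b := t₂)).prod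
        (isCompact_Icc (a := 0) (b := 1))).uniformContinuousOn_of_continuous
        (f := fun y : ℝ × ℝ => P (y.1, y.1 + y.2)) (by fun_prop)
      obtain ⟨δ, hδ, h⟩ := Metric.uniformContinuousOn_iff.1 hu κ hκ
      refine ⟨min (δ / 2) 1, by positivity, fun t ht l hl => ?_⟩
      have := h (t, l) ⟨ht, hl.1, hl.2.trans (min_le_right _ _)⟩ (t, 0) ⟨ht, le_rfl, zero_le_one⟩ (by
        rw [Prod.dist_eq]
        simp only [dist_self, Real.dist_eq, sub_zero, abs_of_nonneg hl.1]
        exact max_lt hδ ((hl.2.trans (min_le_left _ _)).trans_lt (half_lt_self hδ)))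
      simpa [Real.dist_eq] using this.le
    obtain ⟨δ₂, hδ₂, hsh⟩ := Metric.eventually_nhds_iff.1
      ((tendsto_shift_excess hf₂).eventually (gt_mem_nhds hκ))
    -- The three bounds on the width control the oscillation of `P` off the diagonal, control the
    -- shift of the source, and keep the support of `η` inside the open time square.
    obtain ⟨ρ, hρ, hρs⟩ := exists_contDiff_isBump
      (R := min (min δ₁ (δ₂ / 2)) ((T - t₂) / 2)) (by
        have := sub_pos.2 ht₂
        positivity)
    set R := min (min δ₁ (δ₂ / 2)) ((T - t₂) / 2) with hR
    have hR1 : R ≤ δ₁ := (min_le_left _ _).trans (min_le_left _ _)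
    have hR2 : R ≤ δ₂ / 2 := (min_le_left _ _).trans (min_le_right _ _)
    have hR3 : R ≤ (T - t₂) / 2 := min_le_right _ _
    have hρc := hρ.cont
    have hρcs : HasCompactSupport ρ := HasCompactSupport.intro isCompact_Icc
      fun r hr => hρ.eq_zero r fun hr' => hr (Ioo_subset_Icc_self hr')
    set η : ℝ × ℝ → ℝ := fun y => θ y.1 * ρ (y.2 - y.1) with hη
    have hηC : ContDiff ℝ 1 η :=
      (hθ.comp contDiff_fst).mul ((hρs.of_le (by simp)).comp (contDiff_snd.sub contDiff_fst))
    have hηz : ∀ y : ℝ × ℝ, y ∉ Icc t₁ t₂ ×ˢ Icc t₁ (t₂ + R) → η y = 0 := by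
      intro y hy
      by_contra hne
      have h1 : y.1 ∈ Icc t₁ t₂ := by
        by_contra h; exact hne (by simp [hη, hθT _ h])
      have h2 : y.2 - y.1 ∈ Ioo 0 R := by
        by_contra h; exact hne (by simp [hη, hρ.eq_zero _ h])
      exact hy ⟨h1, by linarith [h1.1, h2.1], by linarith [h1.2, h2.2]⟩
    have hηs : HasCompactSupport η :=
      HasCompactSupport.intro (isCompact_Icc.prod isCompact_Icc) hηz
    have hηsub : tsupport η ⊆ Icc t₁ t₂ ×ˢ Icc t₁ (t₂ + R) := by
      refine closure_minimal (fun y hy => ?_) (isClosed_Icc.prod isClosed_Icc)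
      by_contra h
      exact hy (hηz y h)
    have hηT : tsupport η ⊆ Ioo 0 T ×ˢ Ioo 0 T := fun y hy => by
      have := hηsub hy
      exact ⟨⟨by linarith [this.1.1], by linarith [this.1.2]⟩,
        ⟨by linarith [this.2.1], by linarith [this.2.2]⟩⟩
    -- Along `(1,1)` the factor `ρ (y.2 - y.1)` is constant. Its derivative, which blows up as the
    -- width shrinks, therefore never appears.
    have hfd : ∀ y : ℝ × ℝ, fderiv ℝ η y (1, 1) = θ' y.1 * ρ (y.2 - y.1) := by
      intro y
      have hl : HasDerivAt (fun r : ℝ => y + r • ((1, 1) : ℝ × ℝ)) (1, 1) 0 := by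
        simpa using ((hasDerivAt_id (0 : ℝ)).smul_const ((1, 1) : ℝ × ℝ)).const_add y
      have h1 := (hηC.differentiable one_ne_zero (y + (0 : ℝ) • ((1, 1) : ℝ × ℝ))).hasFDerivAt.comp_hasDerivAt
        (0 : ℝ) hl
      have h2 : HasDerivAt (fun r : ℝ => θ (y.1 + r) * ρ (y.2 - y.1)) (θ' y.1 * ρ (y.2 - y.1)) 0 := by
        refine HasDerivAt.mul_const ?_ _
        exact HasDerivAt.comp_const_add y.1 0 (by simpa using hθd y.1)
      have h3 : (η ∘ fun r : ℝ => y + r • ((1, 1) : ℝ × ℝ))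
          = fun r : ℝ => θ (y.1 + r) * ρ (y.2 - y.1) := by
        ext r; simp [hη]
      rw [h3] at h1
      have := h1.unique h2
      simpa using this
    have hη0 : ∀ y, 0 ≤ η y := fun y => mul_nonneg (hθ0 _) (hρ.nonneg _)
    have hD := doubling hp hac hb hm h₁ h₂ hla hlc hf₁ hf₂ hsub hsup hηC hηs hη0 hηT
    have hLHS : ∫ y, P y * fderiv ℝ η y (1, 1)
        = ∫ t, θ' t * ∫ l in (0 : ℝ)..R, ρ l * P (t, t + l) := by
      rw [← measurePreserving_shear.integral_comp measurableEmbedding_shear,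
        Measure.volume_eq_prod, integral_prod]
      · refine integral_congr_ae (.of_forall fun t => ?_)
        simp only [hfd]
        rw [← hρ.integral_mul_eq, ← integral_const_mul]
        refine integral_congr_ae (.of_forall fun l => ?_)
        simp only [add_sub_cancel_left]
        ring
      · rw [← Measure.volume_eq_prod]
        simp only [hfd, add_sub_cancel_left]
        refine Continuous.integrable_of_hasCompactSupport (by fun_prop) ?_
        refine HasCompactSupport.intro (hθ's.isCompact.prod hρcs.isCompact) fun z hz => ?_
        by_cases h1 : z.1 ∈ tsupport θ'
        · have h2 : z.2 ∉ tsupport ρ := fun h2 => hz ⟨h1, h2⟩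
          rw [image_eq_zero_of_notMem_tsupport h2]; ring
        · rw [image_eq_zero_of_notMem_tsupport h1]; ring
    have hRHS : ∫ y, η y * ∫ x in a..c, max (f₁ (x, y.1) - f₂ (x, y.2)) 0 ≤ κ := by
      have hint := integrable_weight_mul_excess (T := T) hp hac.le hf₁ hf₂ hηC.continuous hηs
        (fun y hy => Ioo_subset_Icc_self (hηT (subset_tsupport η hy)).1)
        (fun y hy => Ioo_subset_Icc_self (hηT (subset_tsupport η hy)).2)
      have hint2 := (measurePreserving_shear.integrable_comp_emb measurableEmbedding_shear).2 hint
      rw [← measurePreserving_shear.integral_comp measurableEmbedding_shear,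
        Measure.volume_eq_prod]
      rw [Measure.volume_eq_prod] at hint2
      refine (integral_prod_symm _ hint2).trans_le ?_
      simp only [Function.comp_apply]
      have e1 : ∀ l : ℝ, ∫ t, η (t, t + l) * ∫ x in a..c, max (f₁ (x, t) - f₂ (x, t + l)) 0
          = ρ l * ∫ t, θ t * ∫ x in a..c, max (f₁ (x, t) - f₂ (x, t + l)) 0 := by
        intro l
        rw [← integral_const_mul]
        refine integral_congr_ae (.of_forall fun t => ?_)
        simp only [hη, add_sub_cancel_left]
        ring
      simp only [e1]
      have hint3 := hint2.integral_prod_right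
      simp only [Function.comp_apply, e1] at hint3
      have hκρ : ∫ l, ρ l * κ = κ := by
        rw [hρ.integral_mul_eq, intervalIntegral.integral_mul_const, hρ.integral, one_mul]
      refine (integral_mono hint3
        ((hρc.integrable_of_hasCompactSupport hρcs).mul_const κ) fun l => ?_).trans hκρ.le
      by_cases hl : l ∈ Ioo 0 R
      · refine mul_le_mul_of_nonneg_left ?_ (hρ.nonneg l)
        refine (integral_excess_le hac.le hf₂ hf hθ0 hθ1 (fun t ht => ?_) l).trans ?_
        · have : t ∈ Icc t₁ t₂ := by by_contra h; exact ht (hθT t h)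
          exact ⟨by linarith [this.1], by linarith [this.2]⟩
        · refine (hsh (y := l) ?_).le
          rw [Real.dist_eq, sub_zero, abs_of_pos hl.1]
          linarith [hl.2]
      · simp [hρ.eq_zero l hl]
    have hi1 : Integrable fun t => P (t, t) * θ' t :=
      Continuous.integrable_of_hasCompactSupport (by fun_prop) hθ's.mul_left
    have hi2 : Integrable fun t => θ' t * ∫ l in (0 : ℝ)..R, ρ l * P (t, t + l) := by
      refine Continuous.integrable_of_hasCompactSupport ?_ hθ's.mul_right
      exact hθc.mul (intervalIntegral.continuous_parametric_intervalIntegral_of_continuous'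
        (by fun_prop) _ _)
    have hdiff : ∫ t, θ' t * ∫ l in (0 : ℝ)..R, ρ l * P (t, t + l)
        ≤ (∫ t, P (t, t) * θ' t) + κ * I := by
      rw [hI, ← integral_const_mul, ← integral_add hi1 (hiθ.const_mul κ)]
      refine integral_mono hi2 (hi1.add (hiθ.const_mul κ)) fun t => ?_
      by_cases ht : t ∈ Icc t₁ t₂
      · have h1 := hρ.abs_integral_mul_sub_le (f := fun l => P (t, t + l)) (m := P (t, t))
          (by fun_prop) fun l hl => hmod t ht l ⟨hl.1, hl.2.trans hR1⟩
        have h2 : θ' t * ((∫ l in (0 : ℝ)..R, ρ l * P (t, t + l)) - P (t, t)) ≤ |θ' t| * κ := by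
          refine (le_abs_self _).trans ?_
          rw [abs_mul]
          exact mul_le_mul_of_nonneg_left h1 (abs_nonneg _)
        simp only
        linarith
      · simp [hθT' t ht]
    rw [hLHS] at hD
    linarith
  have h0 : -(∫ t, P (t, t) * θ' t) ≤ 0 := by
    refine le_of_forall_pos_le_add fun ε hε => ?_
    have h := hall (ε / (1 + I)) (by positivity)
    have : ε / (1 + I) + ε / (1 + I) * I = ε := by field_simp
    linarith
  linarith

/-- **Comparison principle** for the doubly nonlinear equation. -/
theorem comparison (hp : 2 < p) (hac : a < c) (hb : Continuous b)
    (hm : StrictMono b) (h₁ : EnergyPair p a c T w₁ g₁) (h₂ : EnergyPair p a c T w₂ g₂)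
    (hla : ∀ t ∈ Icc 0 T, ∀ s ∈ Icc 0 T, w₁ (a, t) ≤ w₂ (a, s))
    (hlc : ∀ t ∈ Icc 0 T, ∀ s ∈ Icc 0 T, w₁ (c, t) ≤ w₂ (c, s))
    (hini : ∀ x ∈ Icc a c, w₁ (x, 0) ≤ w₂ (x, 0))
    (hf₁ : IsSource f₁) (hf₂ : IsSource f₂)
    (hsub : IsSubsolution p b a c T w₁ g₁ f₁) (hsup : IsSupersolution p b a c T w₂ g₂ f₂)
    (hf : ∀ᵐ z ∂(volume.restrict (Ioo a c ×ˢ Ioo 0 T)), f₁ z ≤ f₂ z) :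
    ∀ x ∈ Icc a c, ∀ t ∈ Ioo 0 T, w₁ (x, t) ≤ w₂ (x, t) := by
  set m : ℝ → ℝ := fun t => positiveEnergy b a c w₁ w₂ (t, t) with hmdef
  have hmc : Continuous m :=
    (continuous_positiveEnergy hb h₁.cont h₂.cont).comp (by fun_prop : Continuous fun t : ℝ => (t, t))
  have hdec : ∀ t₁ t₂, 0 < t₁ → t₁ < t₂ → t₂ < T → m t₂ ≤ m t₁ := by
    intro t₁ t₂ ht₁ h12 ht₂
    refine le_of_forall_pos_le_add fun ε hε => ?_
    obtain ⟨δ₁, hδ₁, hc1⟩ := Metric.continuous_iff.1 hmc t₁ (ε / 2) (half_pos hε)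
    obtain ⟨δ₂, hδ₂, hc2⟩ := Metric.continuous_iff.1 hmc t₂ (ε / 2) (half_pos hε)
    obtain ⟨ρ, hρ, -⟩ := exists_contDiff_isBump
      (R := min (min (δ₁ / 2) (δ₂ / 2)) ((T - t₂) / 2)) (by
        have := sub_pos.2 ht₂
        positivity)
    set R := min (min (δ₁ / 2) (δ₂ / 2)) ((T - t₂) / 2) with hR
    have hR1 : R ≤ δ₁ / 2 := (min_le_left _ _).trans (min_le_left _ _)
    have hR2 : R ≤ δ₂ / 2 := (min_le_left _ _).trans (min_le_right _ _)
    have hR3 : R ≤ (T - t₂) / 2 := min_le_right _ _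
    have hρc := hρ.cont
    have hshift : ∀ t' t, HasDerivAt (fun t => smoothStep ρ (t - t')) (ρ (t - t')) t :=
      fun t' t => HasDerivAt.comp_sub_const t t' (hρ.hasDerivAt_smoothStep (t - t'))
    have hRpos := hρ.pos
    -- The weight is a smoothed indicator of `(t₁,t₂)`, so the inequality compares an average of `m`
    -- just after `t₁` with one just after `t₂`.
    have key := integral_diagonal_mul_deriv_nonneg hp hac hb hm h₁ h₂ hla hlc hf₁ hf₂ hsub hsup hf
      (θ := fun t => smoothStep ρ (t - t₁) - smoothStep ρ (t - t₂))
      (θ' := fun t => ρ (t - t₁) - ρ (t - t₂)) (t₁ := t₁) (t₂ := t₂ + R) ht₁ (by linarith)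
      ((hρ.contDiff_smoothStep.comp (contDiff_id.sub contDiff_const)).sub
        (hρ.contDiff_smoothStep.comp (contDiff_id.sub contDiff_const)))
      (fun t => (hshift t₁ t).sub (hshift t₂ t)) (by fun_prop)
      (fun t => sub_nonneg.2 (hρ.monotone_smoothStep (by linarith)))
      (fun t => by
        have := hρ.smoothStep_le_one (t - t₁)
        have := hρ.smoothStep_nonneg (t - t₂)
        linarith)
      (fun t ht => by
        rcases lt_or_ge t t₁ with h | h
        · rw [hρ.smoothStep_of_nonpos (by linarith), hρ.smoothStep_of_nonpos (by linarith), sub_self]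
        · have : t₂ + R < t := by by_contra h'; exact ht ⟨h, not_lt.1 h'⟩
          rw [hρ.smoothStep_of_le (by linarith), hρ.smoothStep_of_le (by linarith), sub_self])
      (fun t ht => by
        rcases lt_or_ge t t₁ with h | h
        · rw [hρ.eq_zero _ fun h' => by linarith [h'.1], hρ.eq_zero _ fun h' => by linarith [h'.1],
            sub_self]
        · have : t₂ + R < t := by by_contra h'; exact ht ⟨h, not_lt.1 h'⟩
          rw [hρ.eq_zero _ fun h' => by linarith [h'.2], hρ.eq_zero _ fun h' => by linarith [h'.2],
            sub_self])
    have hρcs : HasCompactSupport ρ := HasCompactSupport.intro isCompact_Icc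
      fun r hr => hρ.eq_zero r fun hr' => hr (Ioo_subset_Icc_self hr')
    have hconv : ∀ t', ∫ t, m t * ρ (t - t') = ∫ l in (0 : ℝ)..R, ρ l * m (l + t') := by
      intro t'
      rw [← hρ.integral_mul_eq, ← integral_sub_right_eq_self (fun l => ρ l * m (l + t')) t']
      refine integral_congr_ae (.of_forall fun t => ?_)
      simp [mul_comm]
    have hii : ∀ t', Integrable fun t => m t * ρ (t - t') := fun t' => by
      refine Continuous.integrable_of_hasCompactSupport (by fun_prop) ?_
      exact (hρcs.comp_homeomorph (Homeomorph.subRight t')).mul_left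
    have e1 : ∫ t, m t * (ρ (t - t₁) - ρ (t - t₂))
        = (∫ l in (0 : ℝ)..R, ρ l * m (l + t₁)) - ∫ l in (0 : ℝ)..R, ρ l * m (l + t₂) := by
      rw [← hconv, ← hconv, ← integral_sub (hii t₁) (hii t₂)]
      simp only [mul_sub]
    have key' : 0 ≤ ∫ t, m t * (ρ (t - t₁) - ρ (t - t₂)) := key
    rw [e1] at key'
    have a1 := hρ.abs_integral_mul_sub_le (f := fun l => m (l + t₁)) (m := m t₁) (κ := ε / 2)
      (by fun_prop) fun l hl => by
        have := hc1 (l + t₁) (by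
          rw [Real.dist_eq, add_sub_cancel_right, abs_of_nonneg hl.1]; linarith [hl.2])
        exact this.le
    have a2 := hρ.abs_integral_mul_sub_le (f := fun l => m (l + t₂)) (m := m t₂) (κ := ε / 2)
      (by fun_prop) fun l hl => by
        have := hc2 (l + t₂) (by
          rw [Real.dist_eq, add_sub_cancel_right, abs_of_nonneg hl.1]; linarith [hl.2])
        exact this.le
    linarith [(abs_le.1 a1).2, (abs_le.1 a2).1]
  have hm0 : m 0 = 0 := by
    simp only [hmdef, positiveEnergy]
    rw [intervalIntegral.integral_congr (g := fun _ => 0), intervalIntegral.integral_zero]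
    intro x hx
    rw [uIcc_of_le hac.le] at hx
    exact max_eq_right (sub_nonpos.2 (hm.monotone (hini x hx)))
  intro x hx t ht
  have hmt : m t ≤ 0 := by
    rw [← hm0]
    -- Monotonicity is known only for positive times; continuity of `m` carries it down to the
    -- initial time.
    refine ge_of_tendsto (hmc.continuousWithinAt (s := Ioi 0) (x := 0)) ?_
    filter_upwards [Ioo_mem_nhdsGT ht.1] with r hr
    exact hdec r t hr.1 hr.2 ht.2
  have hw₁ := h₁.cont
  have hw₂ := h₂.cont
  by_contra hlt
  have hpos : 0 < m t := by
    refine intervalIntegral.integral_pos hac (by fun_prop) (fun _ _ => le_max_right _ _)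
      ⟨x, hx, lt_max_of_lt_left (sub_pos.2 (hm (not_le.1 hlt)))⟩
  linarith

end Diagonal

/-! ### Du Bois-Reymond lemmas and traces. -/

/-- The du Bois-Reymond lemma: a weak primitive is a primitive. -/
lemma exists_eq_primitive {f n : ℝ → ℝ} {A B : ℝ} (hAB : A < B)
    (hf : IntegrableOn f (Ioo A B)) (hn : IntegrableOn n (Ioo A B))
    (h : ∀ θ : ℝ → ℝ, ContDiff ℝ ∞ θ → HasCompactSupport θ → tsupport θ ⊆ Ioo A B →
      ∫ x in Ioo A B, f x * deriv θ x = -∫ x in Ioo A B, n x * θ x) :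
    ∃ κ, ∀ᵐ x ∂(volume.restrict (Ioo A B)), f x = κ + ∫ y in A..x, n y := by
  have hnI : IntervalIntegrable n volume A B := by
    rw [intervalIntegrable_iff_integrableOn_Ioo_of_le hAB.le]; exact hn
  set N : ℝ → ℝ := fun x => ∫ y in A..x, n y with hN
  have hNc : ContinuousOn N (Icc A B) := by
    have := intervalIntegral.continuousOn_primitive_interval' hnI left_mem_uIcc
    rwa [uIcc_of_le hAB.le] at this
  set F : ℝ → ℝ := fun x => f x - N x with hF
  have hFi : IntegrableOn F (Ioo A B) :=
    hf.sub ((hNc.integrableOn_compact isCompact_Icc).mono_set Ioo_subset_Icc_self)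
  have hval : ∀ θ : ℝ → ℝ, tsupport θ ⊆ Ioo A B → ∀ x, x ∉ Ioo A B → θ x = 0 := fun θ hθ x hx =>
    image_eq_zero_of_notMem_tsupport fun h' => hx (hθ h')
  have hset : ∀ (u θ : ℝ → ℝ), tsupport θ ⊆ Ioo A B →
      ∫ x in Ioo A B, u x * θ x = ∫ x, u x * θ x := fun u θ hθ =>
    setIntegral_eq_integral_of_forall_compl_eq_zero fun x hx => by rw [hval θ hθ x hx, mul_zero]
  have hbdd : ∀ θ : ℝ → ℝ, Continuous θ → HasCompactSupport θ → ∀ u, IntegrableOn u (Ioo A B) →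
      IntegrableOn (fun x => u x * θ x) (Ioo A B) := fun θ hc hs u hu => by
    obtain ⟨M, hM⟩ := hc.bounded_above_of_compact_support hs
    exact hu.mul_bdd (c := M) hc.aestronglyMeasurable (.of_forall hM)
  have horth : ∀ θ : ℝ → ℝ, ContDiff ℝ ∞ θ → HasCompactSupport θ → tsupport θ ⊆ Ioo A B →
      ∫ x in Ioo A B, F x * deriv θ x = 0 := by
    intro θ hθ hs hsub
    have hdc : Continuous (deriv θ) := hθ.continuous_deriv (by simp)
    have h1 := integral_mul_of_primitive (F := N) (D := n) (φ := θ) (q := deriv θ) (κ := 0) hAB.le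
      hnI (hdc.intervalIntegrable _ _) (.of_forall fun x => by simp [hN]) (fun x hx => by
        rw [intervalIntegral.integral_deriv_eq_sub
          (fun y _ => (hθ.differentiable (by simp)).differentiableAt)
          (hdc.intervalIntegrable _ _), hval θ hsub A (by simp), sub_zero])
      (hval θ hsub B (by simp))
    rw [intervalIntegral.integral_of_le hAB.le, intervalIntegral.integral_of_le hAB.le,
      integral_Ioc_eq_integral_Ioo, integral_Ioc_eq_integral_Ioo] at h1
    have e : ∀ x, F x * deriv θ x = f x * deriv θ x - N x * deriv θ x := fun x => sub_mul _ _ _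
    simp only [e]
    rw [integral_sub (hbdd _ hdc hs.deriv f hf) (hbdd _ hdc hs.deriv N
      ((hNc.integrableOn_compact isCompact_Icc).mono_set Ioo_subset_Icc_self)), h θ hθ hs hsub, h1]
    ring
  -- A fixed bump `X` of integral one identifies the constant as `κ = ∫ F X`.
  let χ : ContDiffBump ((A + B) / 2) := ⟨(B - A) / 8, (B - A) / 4, by linarith, by linarith⟩
  set X : ℝ → ℝ := χ.normed volume with hX
  have hXc : ContDiff ℝ ∞ X := χ.contDiff_normed
  have hXs : HasCompactSupport X := χ.hasCompactSupport_normed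
  have hXsub : tsupport X ⊆ Icc ((A + B) / 2 - (B - A) / 4) ((A + B) / 2 + (B - A) / 4) := by
    rw [hX, χ.tsupport_normed_eq, Real.closedBall_eq_Icc]
  have hX1 : ∫ x, X x = 1 := χ.integral_normed
  set κ := ∫ x in Ioo A B, F x * X x with hκ
  have hzero : ∀ᵐ x, x ∈ Ioo A B → F x - κ = 0 := by
    refine isOpen_Ioo.ae_eq_zero_of_integral_contDiff_smul_eq_zero
      (hFi.sub (integrableOn_const (by simp))).locallyIntegrableOn fun ζ hζ hζs hζsub => ?_
    set I := ∫ x, ζ x with hI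
    -- Removing the mean makes the primitive of `μ` compactly supported in `(A,B)`, hence an
    -- admissible test function with derivative `μ`.
    set μ : ℝ → ℝ := fun x => ζ x - I * X x with hμ
    have hμc : ContDiff ℝ ∞ μ := hζ.sub (contDiff_const.mul hXc)
    obtain ⟨A', B', hA', hB', hA'B', hz⟩ : ∃ A' B', A < A' ∧ B' < B ∧ A' ≤ B' ∧
        ∀ x, x ∉ Icc A' B' → μ x = 0 := by
      have hK : IsCompact (tsupport ζ ∪ Icc ((A + B) / 2 - (B - A) / 4)
        ((A + B) / 2 + (B - A) / 4)) := hζs.isCompact.union isCompact_Icc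
      have hKsub : tsupport ζ ∪ Icc ((A + B) / 2 - (B - A) / 4)
          ((A + B) / 2 + (B - A) / 4) ⊆ Ioo A B :=
        union_subset hζsub fun x hx => ⟨by linarith [hx.1], by linarith [hx.2]⟩
      have hKne : (tsupport ζ ∪ Icc ((A + B) / 2 - (B - A) / 4)
          ((A + B) / 2 + (B - A) / 4)).Nonempty :=
        ⟨(A + B) / 2, Or.inr ⟨by linarith, by linarith⟩⟩
      refine ⟨sInf _, sSup _, (hKsub (hK.sInf_mem hKne)).1, (hKsub (hK.sSup_mem hKne)).2,
        Real.sInf_le_sSup _ hK.bddBelow hK.bddAbove, fun x hx => ?_⟩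
      have hxK : x ∉ tsupport ζ ∪ Icc ((A + B) / 2 - (B - A) / 4)
          ((A + B) / 2 + (B - A) / 4) := fun h' =>
        hx ⟨csInf_le hK.bddBelow h', le_csSup hK.bddAbove h'⟩
      have h1 : ζ x = 0 := image_eq_zero_of_notMem_tsupport fun h' => hxK (Or.inl h')
      have h2 : X x = 0 := image_eq_zero_of_notMem_tsupport fun h' => hxK (Or.inr (hXsub h'))
      simp [hμ, h1, h2]
    have hXi : Integrable X := hXc.continuous.integrable_of_hasCompactSupport hXs
    have hζi : Integrable ζ := hζ.continuous.integrable_of_hasCompactSupport hζs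
    have hμ0 : ∫ x, μ x = 0 := by
      rw [hμ, integral_sub hζi (hXi.const_mul I), integral_const_mul, hX1, ← hI]; ring
    set θ : ℝ → ℝ := fun x => ∫ y in A..x, μ y with hθ
    have hθd : ∀ x, HasDerivAt θ (μ x) x := fun x =>
      intervalIntegral.integral_hasDerivAt_right (hμc.continuous.intervalIntegrable _ _)
        (hμc.continuous.stronglyMeasurableAtFilter _ _) hμc.continuous.continuousAt
    have hθderiv : deriv θ = μ := funext fun x => (hθd x).deriv
    have hθc : ContDiff ℝ ∞ θ := by
      rw [contDiff_infty_iff_deriv, hθderiv]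
      exact ⟨fun x => (hθd x).differentiableAt, hμc⟩
    have hθz : ∀ x, x ∉ Icc A' B' → θ x = 0 := by
      intro x hx
      rcases lt_or_ge x A' with hxA | hxA
      · rw [hθ]
        simp only
        rw [intervalIntegral.integral_congr (g := fun _ => 0), intervalIntegral.integral_zero]
        intro y hy
        refine hz y fun hy' => ?_
        have := hy.2
        rcases le_max_iff.1 this with h' | h' <;> linarith [hy'.1]
      · have hxB : B' < x := by by_contra h'; exact hx ⟨hxA, not_lt.1 h'⟩
        rw [hθ]
        simp only
        rw [intervalIntegral.integral_of_le (by linarith),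
          setIntegral_eq_integral_of_forall_compl_eq_zero, hμ0]
        intro y hy
        exact hz y fun hy' => hy ⟨by linarith [hy'.1], by linarith [hy'.2]⟩
    have hθs : HasCompactSupport θ := HasCompactSupport.intro isCompact_Icc hθz
    have hθsub : tsupport θ ⊆ Ioo A B := by
      refine (closure_minimal (fun y hy => ?_) isClosed_Icc).trans
        (Icc_subset_Ioo hA' hB')
      by_contra h'
      exact hy (hθz y h')
    have h0 := horth θ hθc hθs hθsub
    rw [hθderiv] at h0
    have e1 : ∫ x in Ioo A B, F x * μ x = (∫ x in Ioo A B, F x * ζ x) - I * κ := by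
      have e : ∀ x, F x * μ x = F x * ζ x - I * (F x * X x) := fun x => by simp only [hμ]; ring
      simp only [e]
      rw [integral_sub (hbdd _ hζ.continuous hζs F hFi)
        ((hbdd _ hXc.continuous hXs F hFi).const_mul I), integral_const_mul]
    have e2 : ∫ x, ζ x • (F x - κ) = ∫ x in Ioo A B, (F x - κ) * ζ x := by
      rw [hset (fun x => F x - κ) ζ hζsub]
      exact integral_congr_ae (.of_forall fun x => mul_comm _ _)
    have e3 : ∫ x in Ioo A B, κ * ζ x = κ * I := by
      rw [hset (fun _ => κ) ζ hζsub, integral_const_mul]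
    rw [e2]
    simp only [sub_mul]
    rw [integral_sub (hbdd _ hζ.continuous hζs F hFi)
      (hbdd _ hζ.continuous hζs (fun _ => κ) (integrableOn_const (by simp))), e3]
    linarith
  refine ⟨κ, ?_⟩
  rw [ae_restrict_iff' measurableSet_Ioo]
  filter_upwards [hzero] with x hx hxI
  have := hx hxI
  simp only [hF] at this
  linarith

/-- Functions of `W₀^{1,p}` are primitives of their weak derivative and vanish at `±1`. -/
lemma MemW0.eq_primitive {p : ℝ} (hp : 2 < p) {v g : ℝ → ℝ} (h : MemW0 p v g)
    (hv : ContinuousOn v (Icc (-1) 1)) :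
    (∀ x ∈ Icc (-1 : ℝ) 1, v x = ∫ y in (-1)..x, g y) ∧ v 1 = 0 := by
  obtain ⟨hvp, hgp, φ, hφ, hφv, hφg⟩ := h
  have hp1 : 1 ≤ ENNReal.ofReal p := by
    rw [← ENNReal.ofReal_one]; exact ENNReal.ofReal_le_ofReal (by linarith)
  have hp0 : ENNReal.ofReal p ≠ 0 := (zero_lt_one.trans_le hp1).ne'
  have hgI : IntervalIntegrable g volume (-1) 1 := by
    rw [intervalIntegrable_iff_integrableOn_Ioo_of_le (by norm_num)]
    exact hgp.integrable hp1
  have hdc : ∀ n, Continuous (deriv (φ n)) := fun n => (hφ n).1.continuous_deriv (by simp)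
  have hφx : ∀ n x, φ n x = ∫ y in (-1)..x, deriv (φ n) y := by
    intro n x
    rw [intervalIntegral.integral_deriv_eq_sub
      (fun y _ => ((hφ n).1.differentiable (by simp)).differentiableAt)
      ((hdc n).intervalIntegrable _ _), image_eq_zero_of_notMem_tsupport (f := φ n) (x := -1) ?_,
      sub_zero]
    exact fun h' => by simpa using (hφ n).2.2 h'
  have hφ1 : ∀ n, φ n 1 = 0 := fun n =>
    image_eq_zero_of_notMem_tsupport fun h' => by simpa using (hφ n).2.2 h'
  -- On a bounded interval `L^p` convergence of the derivatives implies `L¹` convergence, which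
  -- makes `φ n` converge pointwise to the primitive of `g`.
  have hL1 : Tendsto (fun n => eLpNorm (fun x => deriv (φ n) x - g x) 1
      (volume.restrict (Ioo (-1) 1))) atTop (𝓝 0) := by
    have hm : ∀ n, AEStronglyMeasurable (fun x => deriv (φ n) x - g x)
        (volume.restrict (Ioo (-1) 1)) := fun n =>
      (hdc n).aestronglyMeasurable.sub hgp.aestronglyMeasurable
    have := ENNReal.Tendsto.mul_const (b := (volume.restrict (Ioo (-1 : ℝ) 1)) univ ^
      (1 / (1 : ENNReal).toReal - 1 / (ENNReal.ofReal p).toReal)) hφg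
      (Or.inr (by
        refine ENNReal.rpow_ne_top_of_nonneg ?_ (by simp)
        rw [ENNReal.toReal_ofReal (by linarith), ENNReal.toReal_one]
        rw [sub_nonneg]
        exact one_div_le_one_div_of_le one_pos (by linarith)))
    rw [zero_mul] at this
    exact tendsto_of_tendsto_of_tendsto_of_le_of_le tendsto_const_nhds this (fun _ => zero_le)
      fun n => eLpNorm_le_eLpNorm_mul_rpow_measure_univ hp1 (hm n)
  have hlim : ∀ x ∈ Icc (-1 : ℝ) 1, Tendsto (fun n => φ n x) atTop (𝓝 (∫ y in (-1)..x, g y)) := by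
    intro x hx
    simp only [hφx _ x, intervalIntegral.integral_of_le hx.1, integral_Ioc_eq_integral_Ioo]
    have h1 := tendsto_setIntegral_of_L1' g hgp.aestronglyMeasurable (.of_forall fun n =>
      (((hdc n).integrable_of_hasCompactSupport (hφ n).2.1.deriv).integrableOn
        (s := Ioo (-1) 1))) hL1 (Ioo (-1) x)
    rwa [Measure.restrict_restrict measurableSet_Ioo,
      inter_eq_left.2 (Ioo_subset_Ioo_right hx.2)] at h1
  -- A subsequence converges a.e. to `v`, so `v` is that primitive a.e.; continuity of both sides
  -- removes the exceptional set.
  obtain ⟨ns, hns, hae⟩ := (tendstoInMeasure_of_tendsto_eLpNorm (f := φ) (g := v) hp0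
    (fun n => (hφ n).1.continuous.aestronglyMeasurable) hvp.aestronglyMeasurable
    hφv).exists_seq_tendsto_ae
  have hEq : v =ᵐ[volume.restrict (Icc (-1) 1)] fun x => ∫ y in (-1)..x, g y := by
    rw [← Measure.restrict_congr_set (Ioo_ae_eq_Icc (μ := volume) (a := (-1 : ℝ)) (b := 1))]
    filter_upwards [hae, ae_restrict_mem measurableSet_Ioo] with x hx hxI
    exact tendsto_nhds_unique hx ((hlim x (Ioo_subset_Icc_self hxI)).comp hns.tendsto_atTop)
  have hcont : ContinuousOn (fun x => ∫ y in (-1 : ℝ)..x, g y) (Icc (-1) 1) := by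
    have := intervalIntegral.continuousOn_primitive_interval' hgI left_mem_uIcc
    rwa [uIcc_of_le (by norm_num)] at this
  have hall := Measure.eqOn_Icc_of_ae_eq volume (by norm_num) hEq hv hcont
  refine ⟨hall, ?_⟩
  rw [hall (right_mem_Icc.2 (by norm_num))]
  have := hlim 1 (right_mem_Icc.2 (by norm_num))
  simp only [hφ1] at this
  exact tendsto_nhds_unique this tendsto_const_nhds

/-- The du Bois-Reymond lemma with an initial value. -/
lemma eq_primitive_of_initial {m n : ℝ → ℝ} {T m₀ : ℝ} (hT : 0 < T) (hm : Continuous m)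
    (hn : IntegrableOn n (Ioo 0 T))
    (h : ∀ θ : ℝ → ℝ, ContDiff ℝ ∞ θ → HasCompactSupport θ → tsupport θ ⊆ Iio T →
      ∫ t in Ioo 0 T, m t * deriv θ t = -(∫ t in Ioo 0 T, n t * θ t) - m₀ * θ 0) :
    ∀ t ∈ Icc 0 T, m t = m₀ + ∫ r in 0..t, n r := by
  -- Continuing `m` by `m₀` to negative times turns the initial term into an integral: `m₀ * θ 0 = ∫
  -- m₀ θ'` over `(-1,0)`. The identity becomes one without initial data on `(-1,T)`.
  set f : ℝ → ℝ := fun t => if t < 0 then m₀ else m t with hf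
  set N : ℝ → ℝ := (Ioo 0 T).indicator n with hN
  have hNi : Integrable N := (integrable_indicator_iff measurableSet_Ioo).2 hn
  have hfm : IntegrableOn f (Ioo (-1) T) := by
    have h1 : IntegrableOn f (Ioo (-1) T ∩ Iio 0) := by
      refine (integrableOn_const (C := m₀) (s := Ioo (-1) T ∩ Iio 0) (by
        exact ((measure_mono inter_subset_left).trans_lt measure_Ioo_lt_top).ne)).congr_fun
        (fun t ht => ?_) (measurableSet_Ioo.inter measurableSet_Iio)
      simp only [hf, if_pos (show t < 0 from ht.2)]
    have h2 : IntegrableOn f (Ioo (-1) T ∩ Ici 0) := by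
      refine ((hm.continuousOn.integrableOn_compact (isCompact_Icc (a := -1) (b := T))).mono_set
        (inter_subset_left.trans Ioo_subset_Icc_self)).congr_fun (fun t ht => ?_)
        (measurableSet_Ioo.inter measurableSet_Ici)
      simp only [hf, if_neg (not_lt.2 (show 0 ≤ t from ht.2))]
    refine (h1.union h2).mono_set fun t ht => ?_
    rcases lt_or_ge t 0 with h0 | h0
    · exact Or.inl ⟨ht, h0⟩
    · exact Or.inr ⟨ht, h0⟩
  obtain ⟨κ, hκ⟩ := exists_eq_primitive (by linarith : (-1 : ℝ) < T) hfm hNi.integrableOn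
    fun θ hθ hs hsub => by
      have hdc : Continuous (deriv θ) := hθ.continuous_deriv (by simp)
      obtain ⟨M, hM⟩ := hdc.bounded_above_of_compact_support hs.deriv
      have hfθ : IntegrableOn (fun t => f t * deriv θ t) (Ioo (-1) T) :=
        hfm.mul_bdd (c := M) hdc.aestronglyMeasurable (.of_forall hM)
      have hI : ∀ u v, -1 ≤ u → u ≤ v → v ≤ T →
          IntervalIntegrable (fun t => f t * deriv θ t) volume u v := fun u v hu huv hv => by
        rw [intervalIntegrable_iff_integrableOn_Ioo_of_le huv]
        exact hfθ.mono_set (Ioo_subset_Ioo hu hv)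
      have e1 : ∫ t in Ioo (-1) T, f t * deriv θ t
          = (∫ t in (-1)..0, f t * deriv θ t) + ∫ t in 0..T, f t * deriv θ t := by
        rw [intervalIntegral.integral_add_adjacent_intervals (hI (-1) 0 le_rfl (by norm_num) hT.le)
          (hI 0 T (by norm_num) hT.le le_rfl), intervalIntegral.integral_of_le (by linarith),
          integral_Ioc_eq_integral_Ioo]
      have e2 : ∫ t in (-1)..0, f t * deriv θ t = m₀ * θ 0 := by
        rw [intervalIntegral.integral_of_le (by norm_num), integral_Ioc_eq_integral_Ioo,
          setIntegral_congr_fun (g := fun t => m₀ * deriv θ t) measurableSet_Ioo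
          (fun t ht => by simp only [hf, if_pos ht.2]), ← integral_Ioc_eq_integral_Ioo,
          ← intervalIntegral.integral_of_le (by norm_num), intervalIntegral.integral_const_mul,
          intervalIntegral.integral_deriv_eq_sub
          (fun y _ => (hθ.differentiable (by simp)).differentiableAt)
          (hdc.intervalIntegrable _ _), image_eq_zero_of_notMem_tsupport (f := θ) (x := -1) ?_,
          sub_zero]
        exact fun h' => by simpa using (hsub h').1
      have e3 : ∫ t in 0..T, f t * deriv θ t = ∫ t in Ioo 0 T, m t * deriv θ t := by
        rw [intervalIntegral.integral_of_le hT.le, integral_Ioc_eq_integral_Ioo]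
        exact setIntegral_congr_fun measurableSet_Ioo fun t ht => by
          simp only [hf, if_neg (not_lt.2 ht.1.le)]
      have e4 : ∫ t in Ioo (-1) T, N t * θ t = ∫ t in Ioo 0 T, n t * θ t := by
        have : ∀ t, N t * θ t = (Ioo 0 T).indicator (fun t => n t * θ t) t := fun t => by
          by_cases ht : t ∈ Ioo 0 T <;> simp [hN, ht]
        simp only [this]
        rw [setIntegral_indicator measurableSet_Ioo,
          inter_eq_right.2 (Ioo_subset_Ioo_left (by norm_num))]
      rw [e1, e2, e3, e4, h θ hθ hs (fun x hx => (hsub hx).2)]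
      ring
  have hN0 : ∀ t, t ≤ 0 → -1 ≤ t → ∫ y in (-1)..t, N y = 0 := fun t ht ht' => by
    rw [intervalIntegral.integral_congr (g := fun _ => 0), intervalIntegral.integral_zero]
    intro y hy
    rw [uIcc_of_le ht'] at hy
    exact indicator_of_notMem (fun h' : y ∈ Ioo 0 T => by linarith [h'.1, hy.2]) n
  rw [ae_restrict_iff' measurableSet_Ioo] at hκ
  -- At negative times `f = m₀` and the primitive of `N` is zero, which identifies the constant.
  have hκ0 : κ = m₀ := by
    have hpos : ∃ᵐ t ∂(volume : Measure ℝ), t ∈ Ioo (-1 : ℝ) 0 := by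
      rw [frequently_ae_iff]
      exact (isOpen_Ioo.measure_pos volume (nonempty_Ioo.2 (by norm_num))).ne'
    obtain ⟨t, ht, h2⟩ := (hpos.and_eventually hκ).exists
    have := h2 ⟨ht.1, ht.2.trans hT⟩
    simp only [hf, if_pos ht.2] at this
    rw [hN0 t ht.2.le ht.1.le] at this
    linarith
  have hnI : IntervalIntegrable n volume 0 T := by
    rw [intervalIntegrable_iff_integrableOn_Ioo_of_le hT.le]; exact hn
  have hae : m =ᵐ[volume.restrict (Icc 0 T)] fun t => m₀ + ∫ r in 0..t, n r := by
    rw [← Measure.restrict_congr_set (Ioo_ae_eq_Icc (μ := volume) (a := (0 : ℝ)) (b := T)),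
      EventuallyEq, ae_restrict_iff' measurableSet_Ioo]
    filter_upwards [hκ] with t ht htI
    have := ht ⟨by linarith [htI.1], htI.2⟩
    simp only [hf, if_neg (not_lt.2 htI.1.le)] at this
    rw [this, hκ0, ← intervalIntegral.integral_add_adjacent_intervals
      (hNi.intervalIntegrable (a := -1) (b := 0)) hNi.intervalIntegrable,
      hN0 0 le_rfl (by norm_num), zero_add]
    congr 1
    rw [intervalIntegral.integral_of_le htI.1.le, intervalIntegral.integral_of_le htI.1.le]
    exact setIntegral_congr_fun measurableSet_Ioc fun y hy =>
      indicator_of_mem (show y ∈ Ioo 0 T from ⟨hy.1, hy.2.trans_lt htI.2⟩) n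
  refine Measure.eqOn_Icc_of_ae_eq volume hT.ne hae hm.continuousOn (continuousOn_const.add ?_)
  have := intervalIntegral.continuousOn_primitive_interval' hnI left_mem_uIcc
  rwa [uIcc_of_le hT.le] at this

/-! ### From weak solutions to the time-integrated equation. -/

/-- Extension of a function on `[-1,1] × [0,T]` to the plane, constant along normals. -/
noncomputable def clampExtend (T : ℝ) (w : ℝ × ℝ → ℝ) (z : ℝ × ℝ) : ℝ :=
  w (max (-1) (min 1 z.1), max 0 (min T z.2))

lemma continuous_clampExtend {T : ℝ} (hT : 0 < T) {w : ℝ × ℝ → ℝ}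
    (hw : ContinuousOn w (Icc (-1) 1 ×ˢ Icc 0 T)) : Continuous (clampExtend T w) := by
  refine hw.comp_continuous (by fun_prop) fun z => ⟨⟨le_max_left _ _, ?_⟩, ⟨le_max_left _ _, ?_⟩⟩
  · exact max_le (by norm_num) (min_le_left _ _)
  · exact max_le hT.le (min_le_left _ _)

lemma clampExtend_eq {T : ℝ} {w : ℝ × ℝ → ℝ} {x t : ℝ} (hx : x ∈ Icc (-1 : ℝ) 1)
    (ht : t ∈ Icc 0 T) : clampExtend T w (x, t) = w (x, t) := by
  simp only [clampExtend, min_eq_right hx.2, min_eq_right ht.2, max_eq_right hx.1,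
    max_eq_right ht.1]

/-- Extension of a function on `[0,∞)` vanishing at `0` by the identity on the negative axis. -/
noncomputable def extendLaw (b : ℝ → ℝ) (s : ℝ) : ℝ := b (max s 0) + min s 0

lemma extendLaw_of_nonneg (b : ℝ → ℝ) {s : ℝ} (hs : 0 ≤ s) : extendLaw b s = b s := by
  simp [extendLaw, hs]

lemma continuous_extendLaw {b : ℝ → ℝ} (hb : ContinuousOn b (Ici 0)) :
    Continuous (extendLaw b) :=
  (hb.comp_continuous (by fun_prop) fun s => le_max_right s 0).add (by fun_prop)

/-- The lower entropy evaluates the law at `w - l`, which may be negative, so the comparison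
principle needs a continuous strictly increasing law on the whole line. -/
lemma strictMono_extendLaw {b : ℝ → ℝ} (hb : StrictMonoOn b (Ici 0)) :
    StrictMono (extendLaw b) := by
  intro s r hsr
  unfold extendLaw
  have h1 : b (max s 0) ≤ b (max r 0) := hb.monotoneOn (le_max_right s 0) (le_max_right r 0)
    (max_le_max_right 0 hsr.le)
  have h2 : min s 0 ≤ min r 0 := min_le_min_right 0 hsr.le
  rcases lt_or_ge s 0 with hs | hs
  · have : min s 0 < min r 0 := by
      rw [min_eq_left hs.le]; exact lt_min hsr hs
    linarith
  · have : b (max s 0) < b (max r 0) := by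
      rw [max_eq_left hs, max_eq_left (hs.trans hsr.le)]
      exact hb hs (hs.trans hsr.le) hsr
    linarith

/-- A solution in time-integrated form: the time integral of the flux has a weak space derivative
given by the equation. -/
structure IntegratedSolution (p : ℝ) (b : ℝ → ℝ) (T : ℝ) (w g h : ℝ × ℝ → ℝ) : Prop where
  energy : EnergyPair p (-1) 1 T w g
  source : IsSource h
  left : ∀ t ∈ Icc 0 T, w (-1, t) = 0
  right : ∀ t ∈ Icc 0 T, w (1, t) = 0
  eq : ∀ t' t, 0 ≤ t' → t' < t → t < T → ∃ κ, ∀ᵐ x ∂(volume.restrict (Ioo (-1) 1)),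
    ∫ r in t'..t, flux p (g (x, r))
      = κ + ∫ y in (-1)..x, (b (w (y, t)) - b (w (y, t')) - ∫ r in t'..t, h (y, r))

lemma IsSource.intervalIntegrable_slice {h : ℝ × ℝ → ℝ} (hh : IsSource h) (x t' t : ℝ) :
    IntervalIntegrable (fun r => h (x, r)) volume t' t := by
  obtain ⟨M, hM⟩ := hh.bound
  refine (intervalIntegrable_const (c := M)).mono_fun
    (hh.meas.comp (measurable_const.prodMk measurable_id)).aestronglyMeasurable
    (.of_forall fun r => (hM _).trans (le_abs_self M))

lemma IsSource.intervalIntegrable_timeIntegral {h : ℝ × ℝ → ℝ} (hh : IsSource h) (t' t a c : ℝ) :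
    IntervalIntegrable (fun x => ∫ r in t'..t, h (x, r)) volume a c := by
  obtain ⟨M, hM⟩ := hh.bound
  refine (intervalIntegrable_const (c := M * |t - t'|)).mono_fun ?_ (.of_forall fun x => ?_)
  · unfold intervalIntegral
    exact (hh.meas.stronglyMeasurable.integral_prod_right'.sub
      hh.meas.stronglyMeasurable.integral_prod_right').aestronglyMeasurable
  · have := intervalIntegral.norm_integral_le_of_norm_le_const (a := t') (b := t) (C := M)
      (f := fun r => h (x, r)) fun r _ => hM _
    exact this.trans (le_abs_self _)

section

variable {p a c T : ℝ} {b : ℝ → ℝ} {w g h : ℝ × ℝ → ℝ}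

/-- Integration by parts against the primitive form of the flux. Passing to a subinterval only
changes the additive constant, which the test function does not see. -/
lemma IntegratedSolution.test_eq (hp : 2 < p) (hb : Continuous b)
    (hs : IntegratedSolution p b T w g h) (ha : -1 ≤ a) (hac : a < c) (hc : c ≤ 1)
    {t' t : ℝ} (ht' : 0 ≤ t') (htt : t' < t) (ht : t < T) {φ q : ℝ → ℝ}
    (hφ : TestPair p a c φ q) :
    (∫ x in a..c, (b (w (x, t)) - b (w (x, t'))) * φ x)
      + ∫ x in a..c, (∫ r in t'..t, flux p (g (x, r))) * q x
      = ∫ x in a..c, (∫ r in t'..t, h (x, r)) * φ x := by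
  obtain ⟨κ, hκ⟩ := hs.eq t' t ht' htt ht
  have hw := hs.energy.cont
  set D : ℝ → ℝ := fun y => b (w (y, t)) - b (w (y, t')) - ∫ r in t'..t, h (y, r) with hD
  have hDi : ∀ u v, IntervalIntegrable D volume u v := fun u v =>
    (Continuous.intervalIntegrable (by fun_prop) u v).sub
      (hs.source.intervalIntegrable_timeIntegral t' t u v)
  have hp1 : 1 ≤ ENNReal.ofReal p := by
    rw [← ENNReal.ofReal_one]; exact ENNReal.ofReal_le_ofReal (by linarith)
  have hq : IntervalIntegrable q volume a c := by
    rw [intervalIntegrable_iff_integrableOn_Ioc_of_le hac.le]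
    exact hφ.memLp.integrable hp1
  have hφc : ContinuousOn φ (Icc a c) := by
    have := intervalIntegral.continuousOn_primitive_interval' hq left_mem_uIcc
    rw [uIcc_of_le hac.le] at this
    exact this.congr hφ.eq_integral
  have hF : ∀ᵐ x ∂(volume.restrict (Ioo a c)), ∫ r in t'..t, flux p (g (x, r))
      = (κ + ∫ y in (-1)..a, D y) + ∫ y in a..x, D y := by
    refine (ae_restrict_of_ae_restrict_of_subset (Ioo_subset_Ioo ha hc) hκ).mono fun x hx => ?_
    rw [hx, add_assoc, intervalIntegral.integral_add_adjacent_intervals (hDi _ _) (hDi _ _)]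
  have hibp := integral_mul_of_primitive hac.le (hDi a c) hq hF hφ.eq_integral hφ.right
  have i1 : IntervalIntegrable (fun x => (b (w (x, t)) - b (w (x, t'))) * φ x) volume a c := by
    refine ContinuousOn.intervalIntegrable ?_
    rw [uIcc_of_le hac.le]
    exact ContinuousOn.mul (Continuous.continuousOn (by fun_prop)) hφc
  have i2 : IntervalIntegrable (fun x => (∫ r in t'..t, h (x, r)) * φ x) volume a c := by
    refine (hs.source.intervalIntegrable_timeIntegral t' t a c).mul_continuousOn ?_
    rwa [uIcc_of_le hac.le]
  have e : ∀ x, D x * φ x = (b (w (x, t)) - b (w (x, t'))) * φ x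
      - (∫ r in t'..t, h (x, r)) * φ x := fun x => sub_mul _ _ _
  simp only [e] at hibp
  rw [intervalIntegral.integral_sub i1 i2] at hibp
  linarith

lemma IntegratedSolution.isSubsolution (hp : 2 < p) (hb : Continuous b)
    (hs : IntegratedSolution p b T w g h) (ha : -1 ≤ a) (hac : a < c) (hc : c ≤ 1) :
    IsSubsolution p b a c T w g h := fun _ _ ht' htt ht _ _ hφ =>
  (hs.test_eq hp hb ha hac hc ht' htt ht hφ).le

lemma IntegratedSolution.isSupersolution (hp : 2 < p) (hb : Continuous b)
    (hs : IntegratedSolution p b T w g h) (ha : -1 ≤ a) (hac : a < c) (hc : c ≤ 1) :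
    IsSupersolution p b a c T w g h := fun _ _ ht' htt ht _ _ hφ =>
  (hs.test_eq hp hb ha hac hc ht' htt ht hφ).ge

lemma EnergyPair.mono {T' : ℝ} (h : EnergyPair p (-1) 1 T w g) (hT : T' ≤ T)
    (hp : 2 < p)
    (ha : -1 ≤ a) (hac : a ≤ c) (hc : c ≤ 1) : EnergyPair p a c T' w g := by
  refine ⟨h.cont, h.meas, h.memLp, ?_⟩
  have hp1 : 1 ≤ ENNReal.ofReal p := by
    rw [← ENNReal.ofReal_one]; exact ENNReal.ofReal_le_ofReal (by linarith)
  filter_upwards [ae_restrict_of_ae_restrict_of_subset (Ioo_subset_Ioo_right hT) h.primitive,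
    ae_restrict_of_ae (h.ae_memLp_slice hp)] with t ht hgt x hx
  have hI : ∀ u v, IntervalIntegrable (fun y => g (y, t)) volume u v := fun u v => by
    rw [intervalIntegrable_iff, uIoc]
    exact (hgt.restrict _).integrable hp1
  rw [ht x ⟨ha.trans hx.1, hx.2.trans hc⟩, ht a ⟨ha, hac.trans hc⟩, add_assoc,
    intervalIntegral.integral_add_adjacent_intervals (hI _ _) (hI _ _)]

end

lemma restrict_cylinder (T : ℝ) : (volume : Measure (ℝ × ℝ)).restrict (cylinder T)
    = ((volume : Measure ℝ).restrict (Ioo (-1) 1)).prod ((volume : Measure ℝ).restrict (Ioo 0 T)) := by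
  rw [cylinder, Measure.volume_eq_prod, Measure.prod_restrict]

lemma measurableSet_cylinder (T : ℝ) : MeasurableSet (cylinder T) :=
  measurableSet_Ioo.prod measurableSet_Ioo

lemma cylinder_subset (T : ℝ) : cylinder T ⊆ Icc (-1) 1 ×ˢ Icc 0 T :=
  prod_mono Ioo_subset_Icc_self Ioo_subset_Icc_self

instance isFiniteMeasure_cylinder (T : ℝ) :
    IsFiniteMeasure ((volume : Measure (ℝ × ℝ)).restrict (cylinder T)) := by
  rw [restrict_cylinder]; infer_instance

lemma integral_cylinder_mul {T : ℝ} {F : ℝ × ℝ → ℝ} (hF : IntegrableOn F (cylinder T))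
    {θ : ℝ → ℝ} (hθ : Continuous θ) (hs : HasCompactSupport θ) :
    IntegrableOn (fun z => F z * θ z.2) (cylinder T) ∧
    IntegrableOn (fun t => (∫ x in Ioo (-1) 1, F (x, t)) * θ t) (Ioo 0 T) ∧
    ∫ z in cylinder T, F z * θ z.2 = ∫ t in Ioo 0 T, (∫ x in Ioo (-1) 1, F (x, t)) * θ t := by
  obtain ⟨M, hM⟩ := hθ.bounded_above_of_compact_support hs
  have hi : IntegrableOn (fun z => F z * θ z.2) (cylinder T) :=
    hF.mul_bdd (c := M) (by fun_prop) (.of_forall fun z => hM z.2)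
  have hi' := hi
  rw [IntegrableOn, restrict_cylinder] at hi'
  refine ⟨hi, ?_, ?_⟩
  · refine hi'.integral_prod_right.congr (.of_forall fun t => ?_)
    simp only [integral_mul_const]
  · rw [restrict_cylinder, integral_prod_symm _ hi']
    simp only [integral_mul_const]

lemma integral_time_swap {T : ℝ} {F : ℝ × ℝ → ℝ} (hF : IntegrableOn F (cylinder T))
    {t' t : ℝ} (ht' : 0 ≤ t') (htt : t' ≤ t) (ht : t ≤ T) :
    IntegrableOn (fun x => ∫ r in t'..t, F (x, r)) (Ioo (-1) 1) ∧
    ∫ r in t'..t, ∫ x in Ioo (-1) 1, F (x, r) = ∫ x in Ioo (-1) 1, ∫ r in t'..t, F (x, r) := by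
  have h1 : Integrable F (((volume : Measure ℝ).restrict (Ioo (-1) 1)).prod
      ((volume : Measure ℝ).restrict (Ioo t' t))) := by
    rw [Measure.prod_restrict, ← Measure.volume_eq_prod]
    exact hF.mono_set (prod_mono subset_rfl (Ioo_subset_Ioo ht' ht))
  simp only [intervalIntegral.integral_of_le htt, integral_Ioc_eq_integral_Ioo]
  exact ⟨h1.integral_prod_left, (integral_integral_swap (f := fun x r => F (x, r)) h1).symm⟩

lemma isTestFunction_mul {T : ℝ} {χ θ : ℝ → ℝ} (hχ : ContDiff ℝ ∞ χ) (hχs : HasCompactSupport χ)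
    (hχsub : tsupport χ ⊆ Ioo (-1) 1) (hθ : ContDiff ℝ ∞ θ) (hθs : HasCompactSupport θ)
    (hθsub : tsupport θ ⊆ Iio T) : IsTestFunction T fun z => χ z.1 * θ z.2 := by
  have hsub : tsupport (fun z : ℝ × ℝ => χ z.1 * θ z.2) ⊆ tsupport χ ×ˢ tsupport θ := by
    refine closure_minimal (fun z hz => ?_) ((isClosed_tsupport χ).prod (isClosed_tsupport θ))
    exact ⟨subset_tsupport χ fun h => hz (by simp [h]), subset_tsupport θ fun h => hz (by simp [h])⟩
  refine ⟨(hχ.comp contDiff_fst).mul (hθ.comp contDiff_snd), ?_,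
    hsub.trans (prod_mono hχsub hθsub)⟩
  exact (hχs.isCompact.prod hθs.isCompact).of_isClosed_subset (isClosed_tsupport _) hsub

/-- Weak solutions are solutions in integrated form; they are nonnegative, vanish laterally and
attain the initial value. -/
theorem IsWeakSolution.exists_integratedSolution {p T : ℝ} {b : ℝ → ℝ} {h w H : ℝ × ℝ → ℝ}
    {u₀ : ℝ → ℝ} (hp : 2 < p) (hT : 0 < T) (hb : ContinuousOn b (Ici 0))
    (hbm : StrictMonoOn b (Ici 0)) (hw : ContinuousOn w (Icc (-1) 1 ×ˢ Icc 0 T))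
    (hsol : IsWeakSolution p b T h u₀ w) (hH : IsSource H)
    (hHh : ∀ᵐ z ∂(volume.restrict (cylinder T)), h z = H z)
    (hu : ContinuousOn u₀ (Icc (-1) 1)) (hu0 : ∀ x ∈ Icc (-1 : ℝ) 1, 0 ≤ u₀ x) :
    (∀ z ∈ Icc (-1 : ℝ) 1 ×ˢ Icc 0 T, 0 ≤ w z) ∧ (∀ x ∈ Icc (-1 : ℝ) 1, w (x, 0) = u₀ x) ∧
    ∃ g, IntegratedSolution p (extendLaw b) T (clampExtend T w) g H := by
  obtain ⟨hpos, -, g, ⟨-, hg, hslice⟩, hweak⟩ := hsol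
  have hW := continuous_clampExtend hT hw
  have hWw : ∀ z ∈ Icc (-1 : ℝ) 1 ×ˢ Icc 0 T, clampExtend T w z = w z := fun z hz =>
    clampExtend_eq hz.1 hz.2
  have hB := continuous_extendLaw hb
  have hBm := strictMono_extendLaw hbm
  set W := clampExtend T w with hWdef
  set B := extendLaw b with hBdef
  have hw0 : ∀ z ∈ Icc (-1 : ℝ) 1 ×ˢ Icc 0 T, 0 ≤ w z := by
    have h1 : (fun z => min (w z) 0) =ᵐ[volume.restrict (Icc (-1) 1 ×ˢ Icc 0 T)] fun _ => 0 := by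
      have e : (volume : Measure (ℝ × ℝ)).restrict (Icc (-1) 1 ×ˢ Icc 0 T)
          = volume.restrict (cylinder T) := by
        rw [restrict_cylinder, Measure.volume_eq_prod, ← Measure.prod_restrict,
          Measure.restrict_congr_set (Ioo_ae_eq_Icc (μ := volume) (a := (-1 : ℝ)) (b := 1)),
          Measure.restrict_congr_set (Ioo_ae_eq_Icc (μ := volume) (a := (0 : ℝ)) (b := T))]
      rw [e]
      filter_upwards [hpos] with z hz using min_eq_right hz
    have h2 := Measure.eqOn_of_ae_eq h1 (continuous_min.comp_continuousOn (hw.prodMk continuousOn_const)) continuousOn_const (by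
      rw [interior_prod_eq, closure_prod_eq, interior_Icc, interior_Icc,
        closure_Ioo (by norm_num), closure_Ioo hT.ne])
    exact fun z hz => min_eq_right_iff.1 (h2 hz)
  -- A Borel representative of the weak derivative, set to zero outside the cylinder so that it lies
  -- in `L^p` of the plane.
  set G : ℝ × ℝ → ℝ := (cylinder T).indicator (hg.aestronglyMeasurable.mk g) with hG
  have hGm : Measurable G :=
    hg.aestronglyMeasurable.stronglyMeasurable_mk.measurable.indicator (measurableSet_cylinder T)
  have hgG : ∀ᵐ z ∂(volume.restrict (cylinder T)), g z = G z := by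
    filter_upwards [hg.aestronglyMeasurable.ae_eq_mk, ae_restrict_mem (measurableSet_cylinder T)]
      with z hz hzc
    rw [hG, indicator_of_mem hzc, hz]
  have hGp : MemLp G (ENNReal.ofReal p) := by
    rw [hG, memLp_indicator_iff_restrict (measurableSet_cylinder T)]
    exact (memLp_congr_ae hg.aestronglyMeasurable.ae_eq_mk).1 hg
  have hslices : ∀ᵐ t ∂(volume.restrict (Ioo 0 T)),
      (∀ x ∈ Icc (-1 : ℝ) 1, w (x, t) = ∫ y in (-1)..x, G (y, t)) ∧ w (1, t) = 0 := by
    have h1 := hgG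
    rw [restrict_cylinder] at h1
    have h2 := Measure.ae_ae_of_ae_prod ((Measure.measurePreserving_swap
      (μ := (volume : Measure ℝ).restrict (Ioo 0 T))
      (ν := (volume : Measure ℝ).restrict (Ioo (-1) 1))).quasiMeasurePreserving.ae h1)
    filter_upwards [hslice, h2, ae_restrict_mem measurableSet_Ioo] with t ht ht2 htI
    have hwt : ContinuousOn (fun x => w (x, t)) (Icc (-1) 1) :=
      hw.comp (f := fun x : ℝ => (x, t)) (Continuous.continuousOn (by fun_prop))
        fun x hx => ⟨hx, Ioo_subset_Icc_self htI⟩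
    obtain ⟨h3, h4⟩ := ht.eq_primitive hp hwt
    refine ⟨fun x hx => ?_, h4⟩
    rw [h3 x hx, intervalIntegral.integral_of_le hx.1, intervalIntegral.integral_of_le hx.1,
      integral_Ioc_eq_integral_Ioo, integral_Ioc_eq_integral_Ioo]
    exact integral_congr_ae (ae_restrict_of_ae_restrict_of_subset (Ioo_subset_Ioo_right hx.2) ht2)
  have hlat : ∀ x₀ ∈ Icc (-1 : ℝ) 1, (∀ᵐ t ∂(volume.restrict (Ioo 0 T)), w (x₀, t) = 0) →
      ∀ t ∈ Icc 0 T, W (x₀, t) = 0 := by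
    intro x₀ hx₀ hae t ht
    have h1 : (fun t => W (x₀, t)) =ᵐ[volume.restrict (Icc 0 T)] fun _ => 0 := by
      rw [← Measure.restrict_congr_set (Ioo_ae_eq_Icc (μ := volume) (a := (0 : ℝ)) (b := T))]
      filter_upwards [hae, ae_restrict_mem measurableSet_Ioo] with t ht htI
      rw [hWw _ ⟨hx₀, Ioo_subset_Icc_self htI⟩, ht]
    exact Measure.eqOn_Icc_of_ae_eq volume hT.ne h1 (Continuous.continuousOn (by fun_prop))
      continuousOn_const ht
  have hleft := hlat (-1) (by simp) (hslices.mono fun t ht => by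
    rw [ht.1 (-1) (by simp), intervalIntegral.integral_same])
  have hright := hlat 1 (by simp) (hslices.mono fun t ht => ht.2)
  have henergy : EnergyPair p (-1) 1 T W G := by
    refine ⟨hW, hGm, hGp, ?_⟩
    filter_upwards [hslices, ae_restrict_mem measurableSet_Ioo] with t ht htI x hx
    have htI' := Ioo_subset_Icc_self htI
    rw [hleft t htI', zero_add, hWw _ ⟨hx, htI'⟩, ht.1 x hx]
  have hp1 : 1 ≤ ENNReal.ofReal p := by
    rw [← ENNReal.ofReal_one]; exact ENNReal.ofReal_le_ofReal (by linarith)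
  have hPi : IntegrableOn (fun z => flux p (G z)) (cylinder T) :=
    ((memLp_flux hp hGp).restrict _).integrable (one_le_flux_exponent hp)
  have hHi : IntegrableOn H (cylinder T) := ((hH.memLp 1).restrict _).integrable le_rfl
  have hBi : IntegrableOn (fun z => B (W z)) (cylinder T) :=
    ((hB.comp hW).continuousOn.integrableOn_compact (isCompact_Icc.prod isCompact_Icc)).mono_set
      (cylinder_subset T)
  have hmulχ : ∀ {F : ℝ × ℝ → ℝ}, IntegrableOn F (cylinder T) → ∀ {χ : ℝ → ℝ}, Continuous χ →
      HasCompactSupport χ → IntegrableOn (fun z => F z * χ z.1) (cylinder T) := by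
    intro F hF χ hχ hχs
    obtain ⟨M, hM⟩ := hχ.bounded_above_of_compact_support hχs
    exact hF.mul_bdd (c := M) (by fun_prop) (.of_forall fun z => hM z.1)
  -- the equation tested with functions of space only
  have hmain : ∀ χ : ℝ → ℝ, ContDiff ℝ ∞ χ → HasCompactSupport χ → tsupport χ ⊆ Ioo (-1) 1 →
      ∀ t ∈ Icc 0 T, ∫ x in Ioo (-1) 1, B (W (x, t)) * χ x
        = (∫ x in Ioo (-1) 1, b (u₀ x) * χ x)
          + ∫ r in 0..t, ((∫ x in Ioo (-1) 1, H (x, r) * χ x)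
            - ∫ x in Ioo (-1) 1, flux p (G (x, r)) * deriv χ x) := by
    intro χ hχ hχs hχsub
    have hχd : Continuous (deriv χ) := hχ.continuous_deriv (by simp)
    have j1 := hmulχ hBi hχ.continuous hχs
    have j2 := hmulχ hPi hχd hχs.deriv
    have j3 := hmulχ hHi hχ.continuous hχs
    -- Products `χ(x) θ(t)` reduce the weak formulation to an ordinary differential equation in
    -- distributions for `∫ B(W(x,t)) χ(x) dx`, with its initial value.
    refine eq_primitive_of_initial hT ?_ ?_ fun θ hθ hθs hθsub => ?_
    · simp only [← integral_Ioc_eq_integral_Ioo,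
        ← intervalIntegral.integral_of_le (show (-1 : ℝ) ≤ 1 by norm_num)]
      have := hχ.continuous
      exact intervalIntegral.continuous_parametric_intervalIntegral_of_continuous' (by fun_prop) _ _
    · rw [IntegrableOn, restrict_cylinder] at j2 j3
      exact j3.integral_prod_right.sub j2.integral_prod_right
    · have hθd : Continuous (deriv θ) := hθ.continuous_deriv (by simp)
      obtain ⟨a1, c1, d1⟩ := integral_cylinder_mul j1 hθd hθs.deriv
      obtain ⟨a2, c2, d2⟩ := integral_cylinder_mul j2 hθ.continuous hθs
      obtain ⟨a3, c3, d3⟩ := integral_cylinder_mul j3 hθ.continuous hθs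
      have key := hweak _ (isTestFunction_mul hχ hχs hχsub hθ hθs hθsub)
      have e1 : ∫ z in cylinder T, (-(b (w z) * deriv (fun s => χ z.1 * θ s) z.2)
            + flux p (g z) * deriv (fun y => χ y * θ z.2) z.1)
          = -(∫ z in cylinder T, B (W z) * χ z.1 * deriv θ z.2)
            + ∫ z in cylinder T, flux p (G z) * deriv χ z.1 * θ z.2 := by
        rw [← integral_neg,
          ← integral_add (f := fun z => -(B (W z) * χ z.1 * deriv θ z.2)) a1.neg a2]
        refine integral_congr_ae ?_
        filter_upwards [hgG, ae_restrict_mem (measurableSet_cylinder T)] with z hz hzc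
        have hzI := cylinder_subset T hzc
        have f1 : deriv (fun s => χ z.1 * θ s) z.2 = χ z.1 * deriv θ z.2 := deriv_const_mul_field _
        have f2 : deriv (fun y => χ y * θ z.2) z.1 = deriv χ z.1 * θ z.2 := deriv_mul_const_field _
        rw [f1, f2, hz, hWw z hzI, hBdef, extendLaw_of_nonneg b (hw0 z hzI)]
        ring
      have e2 : ∫ z in cylinder T, h z * (χ z.1 * θ z.2)
          = ∫ z in cylinder T, H z * χ z.1 * θ z.2 := by
        refine integral_congr_ae ?_
        filter_upwards [hHh] with z hz
        rw [hz]; ring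
      have e3 : ∫ x in Ioo (-1) 1, b (u₀ x) * (χ x * θ 0)
          = (∫ x in Ioo (-1) 1, b (u₀ x) * χ x) * θ 0 := by
        rw [← integral_mul_const]
        exact integral_congr_ae (.of_forall fun x => (mul_assoc _ _ _).symm)
      simp only [e1, e2, e3, d1, d2, d3] at key
      simp only [sub_mul]
      rw [integral_sub c3 c2]
      linarith
  have hBu : ContinuousOn (fun x => b (u₀ x)) (Icc (-1) 1) := hb.comp hu hu0
  -- At `t = 0` the time integral drops out, so `b(w(·,0))` and `b(u₀)` agree against every `χ`;
  -- continuity and injectivity of the law give the initial value pointwise.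
  have hinit : ∀ x ∈ Icc (-1 : ℝ) 1, w (x, 0) = u₀ x := by
    have hdiff : ContinuousOn (fun x => B (W (x, 0)) - b (u₀ x)) (Icc (-1) 1) :=
      ContinuousOn.sub (Continuous.continuousOn (by fun_prop)) hBu
    have h1 : ∀ᵐ x, x ∈ Ioo (-1 : ℝ) 1 → B (W (x, 0)) - b (u₀ x) = 0 := by
      refine isOpen_Ioo.ae_eq_zero_of_integral_contDiff_smul_eq_zero
        ((hdiff.integrableOn_compact isCompact_Icc).mono_set
          Ioo_subset_Icc_self).locallyIntegrableOn fun χ hχ hχs hχsub => ?_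
      have h2 := hmain χ hχ hχs hχsub 0 ⟨le_rfl, hT.le⟩
      rw [intervalIntegral.integral_same, add_zero] at h2
      obtain ⟨M, hM⟩ := hχ.continuous.bounded_above_of_compact_support hχs
      have i1 : IntegrableOn (fun x => B (W (x, 0)) * χ x) (Ioo (-1) 1) :=
        (Continuous.continuousOn (by have := hχ.continuous; fun_prop) |>.integrableOn_compact
          isCompact_Icc).mono_set Ioo_subset_Icc_self
      have i2 : IntegrableOn (fun x => b (u₀ x) * χ x) (Ioo (-1) 1) :=
        ((hBu.mul hχ.continuous.continuousOn).integrableOn_compact isCompact_Icc).mono_set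
          Ioo_subset_Icc_self
      rw [← setIntegral_eq_integral_of_forall_compl_eq_zero (s := Ioo (-1) 1) fun x hx => by
        rw [image_eq_zero_of_notMem_tsupport fun h' => hx (hχsub h'), zero_smul]]
      have e : ∀ x, χ x • (B (W (x, 0)) - b (u₀ x)) = B (W (x, 0)) * χ x - b (u₀ x) * χ x :=
        fun x => by rw [smul_eq_mul]; ring
      simp only [e]
      rw [integral_sub i1 i2, h2, sub_self]
    have h2 : (fun x => B (W (x, 0)) - b (u₀ x)) =ᵐ[volume.restrict (Icc (-1) 1)] fun _ => 0 := by
      rw [← Measure.restrict_congr_set (Ioo_ae_eq_Icc (μ := volume) (a := (-1 : ℝ)) (b := 1)),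
        EventuallyEq, ae_restrict_iff' measurableSet_Ioo]
      exact h1
    intro x hx
    have h3 : B (W (x, 0)) - b (u₀ x) = 0 :=
      Measure.eqOn_Icc_of_ae_eq volume (by norm_num) h2 hdiff continuousOn_const hx
    rw [hWw _ ⟨hx, le_rfl, hT.le⟩, ← extendLaw_of_nonneg b (hu0 x hx)] at h3
    exact hBm.injective (sub_eq_zero.1 h3)
  refine ⟨hw0, hinit, G, henergy, hH, hleft, hright, fun t' t ht' htt ht => ?_⟩
  obtain ⟨k1, -⟩ := integral_time_swap hPi ht' htt.le ht.le
  set D : ℝ → ℝ := fun y => B (W (y, t)) - B (W (y, t')) - ∫ r in t'..t, H (y, r) with hD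
  have hDi : IntegrableOn D (Ioo (-1) 1) := by
    rw [← intervalIntegrable_iff_integrableOn_Ioo_of_le (by norm_num)]
    exact (Continuous.intervalIntegrable (by fun_prop) _ _).sub
      (hH.intervalIntegrable_timeIntegral t' t _ _)
  -- The difference of the identities at `t` and `t'`, for all `χ`, says that `D` is the weak space
  -- derivative of the time-integrated flux.
  refine exists_eq_primitive (by norm_num) k1 hDi fun χ hχ hχs hχsub => ?_
  have hχc := hχ.continuous
  have hχd : Continuous (deriv χ) := hχ.continuous_deriv (by simp)
  have j2 := hmulχ hPi hχd hχs.deriv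
  have j3 := hmulχ hHi hχ.continuous hχs
  obtain ⟨l2, s2⟩ := integral_time_swap j2 ht' htt.le ht.le
  obtain ⟨l3, s3⟩ := integral_time_swap j3 ht' htt.le ht.le
  have m1 := hmain χ hχ hχs hχsub t ⟨ht'.trans htt.le, ht.le⟩
  have m2 := hmain χ hχ hχs hχsub t' ⟨ht', htt.le.trans ht.le⟩
  have hn : IntegrableOn (fun r => (∫ x in Ioo (-1) 1, H (x, r) * χ x)
      - ∫ x in Ioo (-1) 1, flux p (G (x, r)) * deriv χ x) (Ioo 0 T) := by
    rw [IntegrableOn, restrict_cylinder] at j2 j3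
    exact j3.integral_prod_right.sub j2.integral_prod_right
  have hnI : ∀ u v, 0 ≤ u → u ≤ v → v ≤ T → IntervalIntegrable
      (fun r => (∫ x in Ioo (-1) 1, H (x, r) * χ x)
      - ∫ x in Ioo (-1) 1, flux p (G (x, r)) * deriv χ x) volume u v := fun u v hu huv hv => by
    rw [intervalIntegrable_iff_integrableOn_Ioo_of_le huv]
    exact hn.mono_set (Ioo_subset_Ioo hu hv)
  have n2 : IntervalIntegrable (fun r => ∫ x in Ioo (-1) 1, flux p (G (x, r)) * deriv χ x)
      volume t' t := by
    rw [intervalIntegrable_iff_integrableOn_Ioo_of_le htt.le]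
    rw [IntegrableOn, restrict_cylinder] at j2
    exact IntegrableOn.mono_set (t := Ioo 0 T) j2.integral_prod_right (Ioo_subset_Ioo ht' ht.le)
  have n3 : IntervalIntegrable (fun r => ∫ x in Ioo (-1) 1, H (x, r) * χ x) volume t' t := by
    rw [intervalIntegrable_iff_integrableOn_Ioo_of_le htt.le]
    rw [IntegrableOn, restrict_cylinder] at j3
    exact IntegrableOn.mono_set (t := Ioo 0 T) j3.integral_prod_right (Ioo_subset_Ioo ht' ht.le)
  rw [← intervalIntegral.integral_add_adjacent_intervals (hnI 0 t' le_rfl ht' (htt.le.trans ht.le))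
    (hnI t' t ht' htt.le ht.le), intervalIntegral.integral_sub n3 n2, s2, s3] at m1
  have o1 : IntegrableOn (fun x => B (W (x, t)) * χ x) (Ioo (-1) 1) :=
    (Continuous.continuousOn (by fun_prop) |>.integrableOn_compact
      isCompact_Icc).mono_set Ioo_subset_Icc_self
  have o2 : IntegrableOn (fun x => B (W (x, t')) * χ x) (Ioo (-1) 1) :=
    (Continuous.continuousOn (by fun_prop) |>.integrableOn_compact
      isCompact_Icc).mono_set Ioo_subset_Icc_self
  have e1 : ∫ x in Ioo (-1) 1, D x * χ x = (∫ x in Ioo (-1) 1, B (W (x, t)) * χ x)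
      - (∫ x in Ioo (-1) 1, B (W (x, t')) * χ x)
      - ∫ x in Ioo (-1) 1, ∫ r in t'..t, H (x, r) * χ x := by
    rw [← integral_sub o1 o2, ← integral_sub
      (f := fun x => B (W (x, t)) * χ x - B (W (x, t')) * χ x) (o1.sub o2) l3]
    refine integral_congr_ae (.of_forall fun x => ?_)
    simp only [hD, intervalIntegral.integral_mul_const]
    ring
  have e2 : ∫ x in Ioo (-1) 1, ∫ r in t'..t, flux p (G (x, r)) * deriv χ x
      = ∫ x in Ioo (-1) 1, (∫ r in t'..t, flux p (G (x, r))) * deriv χ x := by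
    simp only [intervalIntegral.integral_mul_const]
  rw [e2] at m1
  rw [e1]
  linarith

/-! ### The barrier and its flux. -/

/-- The exponent `(α-1)(p-2) + α - 2` of the stationary source. -/
noncomputable def sourceExponent (p α : ℝ) : ℝ := (α - 1) * (p - 2) + α - 2

/-- The barrier `1 - |x|^α + c t |x|^β`. -/
noncomputable def barrier (α β c : ℝ) (z : ℝ × ℝ) : ℝ := profile α z.1 + c * z.2 * |z.1| ^ β

/-- The factor `α - c β t |x|^(β-α)` in the space derivative of the barrier. -/
noncomputable def barrierFactor (α β c : ℝ) (z : ℝ × ℝ) : ℝ :=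
  α - c * β * z.2 * |z.1| ^ (β - α)

/-- The space derivative of the barrier. -/
noncomputable def barrierSlope (α β c : ℝ) (z : ℝ × ℝ) : ℝ :=
  -(|z.1| ^ (α - 2) * z.1 * barrierFactor α β c z)

/-- The flux of the barrier. -/
noncomputable def barrierFlux (p α β c : ℝ) (z : ℝ × ℝ) : ℝ :=
  -(|z.1| ^ sourceExponent p α * z.1 * barrierFactor α β c z ^ (p - 1))

/-- The space derivative of the flux of the barrier. -/
noncomputable def barrierFluxDeriv (p α β c : ℝ) (z : ℝ × ℝ) : ℝ :=
  -((sourceExponent p α + 1) * |z.1| ^ sourceExponent p α * barrierFactor α β c z ^ (p - 1))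
    + (p - 1) * (c * β * z.2) * (β - α) * |z.1| ^ (sourceExponent p α + (β - α))
      * barrierFactor α β c z ^ (p - 2)

lemma hasDerivAt_abs_rpow_of_ne {x : ℝ} (hx : x ≠ 0) (s : ℝ) :
    HasDerivAt (fun y : ℝ => |y| ^ s) (s * |x| ^ (s - 2) * x) x := by
  have h := (hasDerivAt_abs hx).rpow_const (p := s) (Or.inl (abs_ne_zero.2 hx))
  convert h using 1
  have h1 : |x| ^ (s - 1) = |x| ^ (s - 2) * |x| := by
    rw [← Real.rpow_add_one (abs_ne_zero.2 hx)]; ring_nf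
  have h2 : (SignType.sign x : ℝ) * |x| = x := sign_mul_abs x
  rw [h1]
  linear_combination (-(s * |x| ^ (s - 2))) * h2

section

variable {p α β c : ℝ}

/-- This is the only place where `α ≥ p/(p-2)` enters: it makes the flux error of the barrier, of
order `|x|^(sourceExponent p α + β - α)`, no larger than `|x|^β` on `[-1,1]`. -/
lemma le_sourceExponent (hp : 2 < p) (hα : p / (p - 2) ≤ α) : α ≤ sourceExponent p α := by
  have h : p ≤ α * (p - 2) := (div_le_iff₀ (by linarith)).1 hα
  unfold sourceExponent
  nlinarith

lemma continuous_profile (hα : 2 ≤ α) : Continuous (profile α) := by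
  have : 0 ≤ α := by linarith
  unfold profile
  exact continuous_const.sub (continuous_abs.rpow_const fun _ => Or.inr this)

lemma continuous_barrier (hα : 2 ≤ α) (hβ : α < β) : Continuous (barrier α β c) := by
  have h1 := continuous_profile hα
  have h2 : Continuous fun z : ℝ × ℝ => |z.1| ^ β :=
    (continuous_abs.comp continuous_fst).rpow_const fun _ => Or.inr (by linarith)
  unfold barrier
  fun_prop

lemma continuous_barrierFactor (hβ : α < β) : Continuous (barrierFactor α β c) := by
  have h2 : Continuous fun z : ℝ × ℝ => |z.1| ^ (β - α) :=
    (continuous_abs.comp continuous_fst).rpow_const fun _ => Or.inr (by linarith)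
  unfold barrierFactor
  fun_prop

lemma continuous_barrierSlope (hα : 2 ≤ α) (hβ : α < β) : Continuous (barrierSlope α β c) := by
  have h1 := continuous_barrierFactor (c := c) hβ
  have h2 : Continuous fun z : ℝ × ℝ => |z.1| ^ (α - 2) :=
    (continuous_abs.comp continuous_fst).rpow_const fun _ => Or.inr (by linarith)
  unfold barrierSlope
  fun_prop

lemma continuous_barrierFlux (hp : 2 < p) (hm : 0 ≤ sourceExponent p α) (hβ : α < β) :
    Continuous (barrierFlux p α β c) := by
  have h1 : Continuous fun z => barrierFactor α β c z ^ (p - 1) :=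
    (continuous_barrierFactor hβ).rpow_const fun _ => Or.inr (by linarith)
  have h2 : Continuous fun z : ℝ × ℝ => |z.1| ^ sourceExponent p α :=
    (continuous_abs.comp continuous_fst).rpow_const fun _ => Or.inr hm
  unfold barrierFlux
  fun_prop

lemma continuous_barrierFluxDeriv (hp : 2 < p) (hm : 0 ≤ sourceExponent p α) (hβ : α < β) :
    Continuous (barrierFluxDeriv p α β c) := by
  have h1 : Continuous fun z => barrierFactor α β c z ^ (p - 1) :=
    (continuous_barrierFactor hβ).rpow_const fun _ => Or.inr (by linarith)
  have h2 : Continuous fun z => barrierFactor α β c z ^ (p - 2) :=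
    (continuous_barrierFactor hβ).rpow_const fun _ => Or.inr (by linarith)
  have h3 : Continuous fun z : ℝ × ℝ => |z.1| ^ sourceExponent p α :=
    (continuous_abs.comp continuous_fst).rpow_const fun _ => Or.inr hm
  have h4 : Continuous fun z : ℝ × ℝ => |z.1| ^ (sourceExponent p α + (β - α)) :=
    (continuous_abs.comp continuous_fst).rpow_const fun _ => Or.inr (by linarith)
  unfold barrierFluxDeriv
  fun_prop

lemma hasDerivAt_barrier (hα : 2 ≤ α) (hβ : α < β) (x t : ℝ) :
    HasDerivAt (fun y => barrier α β c (y, t)) (barrierSlope α β c (x, t)) x := by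
  have h : HasDerivAt (fun y => barrier α β c (y, t))
      (-(α * |x| ^ (α - 2) * x) + c * t * (β * |x| ^ (β - 2) * x)) x :=
    ((hasDerivAt_abs_rpow x (p := α) (by linarith)).const_sub 1).add
      ((hasDerivAt_abs_rpow x (p := β) (by linarith)).const_mul (c * t))
  convert h using 1
  rcases eq_or_ne x 0 with rfl | hx
  · simp [barrierSlope]
  have e : |x| ^ (β - 2) = |x| ^ (α - 2) * |x| ^ (β - α) := by
    rw [← Real.rpow_add (abs_pos.2 hx)]; ring_nf
  simp only [barrierSlope, barrierFactor, e]
  ring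

/-- Away from `0` the product rule applies. At `0` the powers cannot be differentiated separately,
but the derivative extends continuously, which suffices. -/
lemma hasDerivAt_barrierFlux (hp : 2 < p) (hm : 0 < sourceExponent p α) (hβ : α < β) (x t : ℝ) :
    HasDerivAt (fun y => barrierFlux p α β c (y, t)) (barrierFluxDeriv p α β c (x, t)) x := by
  have hne : ∀ y : ℝ, y ≠ 0 → HasDerivAt (fun y => barrierFlux p α β c (y, t))
      (barrierFluxDeriv p α β c (y, t)) y := by
    intro y hy
    have hF : HasDerivAt (fun y => barrierFactor α β c (y, t))
        (-(c * β * t * ((β - α) * |y| ^ (β - α - 2) * y))) y :=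
      ((hasDerivAt_abs_rpow_of_ne hy (β - α)).const_mul (c * β * t)).const_sub α
    have h : HasDerivAt (fun y => barrierFlux p α β c (y, t)) _ y :=
      (((hasDerivAt_abs_rpow_of_ne hy (sourceExponent p α)).mul (hasDerivAt_id y)).mul
        (hF.rpow_const (p := p - 1) (Or.inr (by linarith)))).neg
    convert h using 1
    have hy0 := abs_pos.2 hy
    have s1 : y * y = |y| ^ (2 : ℝ) := by rw [Real.rpow_two, sq_abs, sq]
    have e1 : |y| ^ (sourceExponent p α - 2) * (y * y) = |y| ^ sourceExponent p α := by
      rw [s1, ← Real.rpow_add hy0]; ring_nf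
    have e2 : |y| ^ (sourceExponent p α + (β - α))
        = |y| ^ sourceExponent p α * (|y| ^ (β - α - 2) * (y * y)) := by
      rw [s1, ← Real.rpow_add hy0, ← Real.rpow_add hy0]; ring_nf
    have e3 : p - 1 - 1 = p - 2 := by ring
    simp only [barrierFluxDeriv, Pi.mul_apply, id, e2, e3]
    linear_combination (sourceExponent p α * barrierFactor α β c (y, t) ^ (p - 1)) * e1
  rcases eq_or_ne x 0 with rfl | hx
  · have c1 := continuous_barrierFlux (c := c) hp hm.le hβ
    have c2 := continuous_barrierFluxDeriv (c := c) hp hm.le hβ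
    exact hasDerivAt_of_hasDerivAt_of_ne (g := fun y => barrierFluxDeriv p α β c (y, t)) hne
      (Continuous.continuousAt (by fun_prop)) (Continuous.continuousAt (by fun_prop))
  · exact hne x hx

/-- Nonnegativity of the factor is needed to remove its absolute value. The powers of `|x|` add up
to `(α-2)(p-2) + (p-2) + (α-2) = sourceExponent p α`. -/
lemma flux_barrierSlope (hp : 2 < p) {z : ℝ × ℝ} (hz : 0 ≤ barrierFactor α β c z) :
    flux p (barrierSlope α β c z) = barrierFlux p α β c z := by
  rcases eq_or_ne z.1 0 with h0 | h0
  · simp [barrierSlope, barrierFlux, h0, flux]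
  have hx := abs_pos.2 h0
  have e0 : (0 : ℝ) ≤ |z.1| ^ (α - 2) := by positivity
  rcases hz.eq_or_lt with hq | hq
  · simp [barrierSlope, barrierFlux, ← hq, flux, Real.zero_rpow (show p - 1 ≠ 0 by linarith)]
  have e1 : barrierFactor α β c z ^ (p - 1)
      = barrierFactor α β c z ^ (p - 2) * barrierFactor α β c z := by
    rw [← Real.rpow_add_one hq.ne']; ring_nf
  have e2 : |z.1| ^ sourceExponent p α
      = (|z.1| ^ (α - 2)) ^ (p - 2) * |z.1| ^ (p - 2) * |z.1| ^ (α - 2) := by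
    rw [← Real.rpow_mul hx.le, ← Real.rpow_add hx, ← Real.rpow_add hx, sourceExponent]; ring_nf
  rw [barrierSlope, flux_neg, flux, abs_mul, abs_mul, abs_of_nonneg e0, abs_of_nonneg hz,
    Real.mul_rpow (by positivity) hz, Real.mul_rpow e0 hx.le, barrierFlux, e1, e2]
  ring

/-- The stationary source in closed form. -/
lemma stationarySource_eq (hp : 2 < p) (hα : 2 ≤ α) (x : ℝ) :
    DifferentiableAt ℝ (profile α) x ∧
    DifferentiableAt ℝ (fun y => flux p (deriv (profile α) y)) x ∧
    stationarySource p α x = (sourceExponent p α + 1) * |x| ^ sourceExponent p α * α ^ (p - 1) := by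
  have hm : 0 < sourceExponent p α := by unfold sourceExponent; nlinarith
  -- The profile is the barrier with `c = 0`; the value `α + 1` is an arbitrary exponent above `α`.
  have h1 : ∀ y, HasDerivAt (profile α) (barrierSlope α (α + 1) 0 (y, 0)) y := fun y => by
    simpa [barrier] using hasDerivAt_barrier (c := 0) hα (lt_add_one α) y 0
  have h2 : (fun y => flux p (deriv (profile α) y))
      = fun y => barrierFlux p α (α + 1) 0 (y, 0) := by
    funext y
    rw [(h1 y).deriv, flux_barrierSlope hp (by simp [barrierFactor]; linarith)]
  have h3 := hasDerivAt_barrierFlux (c := 0) hp hm (lt_add_one α) x 0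
  rw [stationarySource, h2]
  refine ⟨(h1 x).differentiableAt, h3.differentiableAt, ?_⟩
  rw [h3.deriv]
  simp [barrierFluxDeriv, barrierFactor]

end

/-! ### Classical sub- and supersolutions in integrated form. -/

/-- The closed box `[-1,1] × [0,T]`. -/
def closedBox (T : ℝ) : Set (ℝ × ℝ) := Icc (-1) 1 ×ˢ Icc 0 T

lemma isCompact_closedBox (T : ℝ) : IsCompact (closedBox T) := isCompact_Icc.prod isCompact_Icc

lemma measurableSet_closedBox (T : ℝ) : MeasurableSet (closedBox T) :=
  measurableSet_Icc.prod measurableSet_Icc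

lemma isSource_indicator {T : ℝ} {f : ℝ × ℝ → ℝ} (hf : Continuous f) :
    IsSource ((closedBox T).indicator f) := by
  refine ⟨hf.measurable.indicator (measurableSet_closedBox T), ?_, ?_⟩
  · obtain ⟨M, hM⟩ := (isCompact_closedBox T).exists_bound_of_continuousOn hf.continuousOn
    refine ⟨max M 0, fun z => ?_⟩
    by_cases hz : z ∈ closedBox T
    · rw [indicator_of_mem hz]; exact (hM z hz).trans (le_max_left _ _)
    · rw [indicator_of_notMem hz, abs_zero]; exact le_max_right _ _
  · exact HasCompactSupport.of_support_subset_isCompact (isCompact_closedBox T)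
      support_indicator_subset

section

variable {p a c T : ℝ} {b : ℝ → ℝ} {w G Φ D : ℝ × ℝ → ℝ}

/-- A function with continuous classical derivatives is an energy pair. -/
lemma energyPair_of_hasDerivAt (hw : Continuous w) (hG : Continuous G)
    (hwG : ∀ x t, HasDerivAt (fun y => w (y, t)) (G (x, t)) x) (ha : -1 ≤ a) (hc : c ≤ 1) :
    EnergyPair p a c T w ((closedBox T).indicator G) := by
  refine ⟨hw, (isSource_indicator hG).meas, (isSource_indicator hG).memLp _, ?_⟩
  filter_upwards [ae_restrict_mem measurableSet_Ioo] with t ht x hx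
  have h := intervalIntegral.integral_eq_sub_of_hasDerivAt (a := a) (b := x)
    (fun y _ => hwG y t) (Continuous.intervalIntegrable (by fun_prop) _ _)
  have e : ∫ y in a..x, (closedBox T).indicator G (y, t) = ∫ y in a..x, G (y, t) := by
    refine intervalIntegral.integral_congr fun y hy => ?_
    rw [uIcc_of_le hx.1] at hy
    have hz : (y, t) ∈ closedBox T :=
      ⟨⟨ha.trans hy.1, hy.2.trans (hx.2.trans hc)⟩, Ioo_subset_Icc_self ht⟩
    exact indicator_of_mem hz _
  rw [e, h]; ring

/-- Integration by parts for a classical flux. -/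
lemma integral_classical_flux (hp : 2 < p) (hΦ : Continuous Φ) (hD : Continuous D)
    (hΦD : ∀ x t, HasDerivAt (fun y => Φ (y, t)) (D (x, t)) x)
    (hGΦ : ∀ z ∈ closedBox T, flux p (G z) = Φ z) (ha : -1 ≤ a) (hac : a < c) (hc : c ≤ 1)
    {t' t : ℝ} (ht' : 0 ≤ t') (htt : t' < t) (ht : t < T) {φ q : ℝ → ℝ}
    (hφ : TestPair p a c φ q) :
    ∫ x in a..c, (∫ r in t'..t, flux p ((closedBox T).indicator G (x, r))) * q x
      = -∫ x in a..c, (∫ r in t'..t, D (x, r)) * φ x := by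
  have hp1 : 1 ≤ ENNReal.ofReal p := by
    rw [← ENNReal.ofReal_one]; exact ENNReal.ofReal_le_ofReal (by linarith)
  have hq : IntervalIntegrable q volume a c := by
    rw [intervalIntegrable_iff_integrableOn_Ioc_of_le hac.le]
    exact hφ.memLp.integrable hp1
  have hDc : Continuous fun x => ∫ r in t'..t, D (x, r) :=
    intervalIntegral.continuous_parametric_intervalIntegral_of_continuous' (by fun_prop) _ _
  refine integral_mul_of_primitive (κ := ∫ r in t'..t, Φ (a, r)) hac.le
    (hDc.intervalIntegrable _ _) hq ?_ hφ.eq_integral hφ.right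
  filter_upwards [ae_restrict_mem measurableSet_Ioo] with x hx
  have e1 : ∫ r in t'..t, flux p ((closedBox T).indicator G (x, r)) = ∫ r in t'..t, Φ (x, r) := by
    refine intervalIntegral.integral_congr fun r hr => ?_
    rw [uIcc_of_le htt.le] at hr
    have hz : (x, r) ∈ closedBox T :=
      ⟨⟨ha.trans hx.1.le, hx.2.le.trans hc⟩, ⟨ht'.trans hr.1, hr.2.trans ht.le⟩⟩
    simp only [indicator_of_mem hz, hGΦ _ hz]
  have e2 : ∫ y in a..x, ∫ r in t'..t, D (y, r) = ∫ r in t'..t, ∫ y in a..x, D (y, r) := by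
    refine intervalIntegral_intervalIntegral_swap (F := fun y r => D (y, r)) ?_
    exact (hD.continuousOn.integrableOn_compact (isCompact_uIcc.prod isCompact_uIcc)).mono_set
      (prod_mono uIoc_subset_uIcc uIoc_subset_uIcc)
  have e3 : ∀ r, ∫ y in a..x, D (y, r) = Φ (x, r) - Φ (a, r) := fun r =>
    intervalIntegral.integral_eq_sub_of_hasDerivAt (fun y _ => hΦD y r)
      (Continuous.intervalIntegrable (by fun_prop) _ _)
  rw [e1, e2]
  simp only [e3]
  rw [intervalIntegral.integral_sub (Continuous.intervalIntegrable (by fun_prop) _ _)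
    (Continuous.intervalIntegrable (by fun_prop) _ _)]
  ring

lemma integral_indicator_closedBox {f : ℝ × ℝ → ℝ} {x t' t : ℝ} (hx : x ∈ Icc (-1 : ℝ) 1)
    (ht' : 0 ≤ t') (htt : t' ≤ t) (ht : t ≤ T) :
    ∫ r in t'..t, (closedBox T).indicator f (x, r) = ∫ r in t'..t, f (x, r) := by
  refine intervalIntegral.integral_congr fun r hr => ?_
  rw [uIcc_of_le htt] at hr
  have hz : (x, r) ∈ closedBox T := ⟨hx, ⟨ht'.trans hr.1, hr.2.trans ht⟩⟩
  exact indicator_of_mem hz _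

lemma TestPair.continuousOn (hp : 2 < p) (hac : a ≤ c) {φ q : ℝ → ℝ} (hφ : TestPair p a c φ q) :
    ContinuousOn φ (Icc a c) := by
  have hp1 : 1 ≤ ENNReal.ofReal p := by
    rw [← ENNReal.ofReal_one]; exact ENNReal.ofReal_le_ofReal (by linarith)
  have hq : IntervalIntegrable q volume a c := by
    rw [intervalIntegrable_iff_integrableOn_Ioc_of_le hac]
    exact hφ.memLp.integrable hp1
  have := intervalIntegral.continuousOn_primitive_interval' hq left_mem_uIcc
  rw [uIcc_of_le hac] at this
  exact this.congr hφ.eq_integral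

/-- The residual of a classical function in the integrated equation. -/
lemma integral_classical_residual {f : ℝ × ℝ → ℝ} (hp : 2 < p) (hb : Continuous b)
    (hw : Continuous w) (hf : Continuous f) (hΦ : Continuous Φ) (hD : Continuous D)
    (hΦD : ∀ x t, HasDerivAt (fun y => Φ (y, t)) (D (x, t)) x)
    (hGΦ : ∀ z ∈ closedBox T, flux p (G z) = Φ z) (ha : -1 ≤ a) (hac : a < c) (hc : c ≤ 1)
    {t' t : ℝ} (ht' : 0 ≤ t') (htt : t' < t) (ht : t < T) {φ q : ℝ → ℝ}
    (hφ : TestPair p a c φ q) :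
    (∫ x in a..c, (b (w (x, t)) - b (w (x, t'))) * φ x)
      + (∫ x in a..c, (∫ r in t'..t, flux p ((closedBox T).indicator G (x, r))) * q x)
      - ∫ x in a..c, (∫ r in t'..t, (closedBox T).indicator f (x, r)) * φ x
      = ∫ x in a..c, (b (w (x, t)) - b (w (x, t')) - (∫ r in t'..t, D (x, r))
          - ∫ r in t'..t, f (x, r)) * φ x := by
  have hφc := hφ.continuousOn hp hac.le
  have hDc : Continuous fun x => ∫ r in t'..t, D (x, r) :=
    intervalIntegral.continuous_parametric_intervalIntegral_of_continuous' (by fun_prop) _ _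
  have hfc : Continuous fun x => ∫ r in t'..t, f (x, r) :=
    intervalIntegral.continuous_parametric_intervalIntegral_of_continuous' (by fun_prop) _ _
  have hi : ∀ F : ℝ → ℝ, Continuous F → IntervalIntegrable (fun x => F x * φ x) volume a c :=
    fun F hF => ContinuousOn.intervalIntegrable (by
      rw [uIcc_of_le hac.le]; exact hF.continuousOn.mul hφc)
  have e : ∫ x in a..c, (∫ r in t'..t, (closedBox T).indicator f (x, r)) * φ x
      = ∫ x in a..c, (∫ r in t'..t, f (x, r)) * φ x := by
    refine intervalIntegral.integral_congr fun x hx => ?_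
    rw [uIcc_of_le hac.le] at hx
    simp only [integral_indicator_closedBox (f := f) ⟨ha.trans hx.1, hx.2.trans hc⟩ ht' htt.le ht.le]
  have i1 := hi (fun x => b (w (x, t)) - b (w (x, t'))) (by fun_prop)
  rw [integral_classical_flux hp hΦ hD hΦD hGΦ ha hac hc ht' htt ht hφ, ← sub_eq_add_neg, e,
    ← intervalIntegral.integral_sub i1 (hi _ hDc),
    ← intervalIntegral.integral_sub (i1.sub (hi _ hDc)) (hi _ hfc)]
  simp only [sub_mul]

/-- A classical supersolution is a supersolution in integrated form. -/
lemma isSupersolution_of_hasDerivAt {f : ℝ × ℝ → ℝ} (hp : 2 < p) (hb : Continuous b)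
    (hw : Continuous w) (hf : Continuous f) (hΦ : Continuous Φ) (hD : Continuous D)
    (hΦD : ∀ x t, HasDerivAt (fun y => Φ (y, t)) (D (x, t)) x)
    (hGΦ : ∀ z ∈ closedBox T, flux p (G z) = Φ z) (ha : -1 ≤ a) (hac : a < c) (hc : c ≤ 1)
    (hle : ∀ x ∈ Icc a c, ∀ t' t, 0 ≤ t' → t' < t → t < T →
      ∫ r in t'..t, f (x, r) ≤ b (w (x, t)) - b (w (x, t')) - ∫ r in t'..t, D (x, r)) :
    IsSupersolution p b a c T w ((closedBox T).indicator G) ((closedBox T).indicator f) := by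
  intro t' t ht' htt ht φ q hφ
  rw [← sub_nonneg, integral_classical_residual hp hb hw hf hΦ hD hΦD hGΦ ha hac hc ht' htt ht hφ]
  exact intervalIntegral.integral_nonneg hac.le fun x hx =>
    mul_nonneg (sub_nonneg.2 (hle x hx t' t ht' htt ht)) (hφ.nonneg x hx)

/-- A classical subsolution is a subsolution in integrated form. -/
lemma isSubsolution_of_hasDerivAt {f : ℝ × ℝ → ℝ} (hp : 2 < p) (hb : Continuous b)
    (hw : Continuous w) (hf : Continuous f) (hΦ : Continuous Φ) (hD : Continuous D)
    (hΦD : ∀ x t, HasDerivAt (fun y => Φ (y, t)) (D (x, t)) x)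
    (hGΦ : ∀ z ∈ closedBox T, flux p (G z) = Φ z) (ha : -1 ≤ a) (hac : a < c) (hc : c ≤ 1)
    (hle : ∀ x ∈ Icc a c, ∀ t' t, 0 ≤ t' → t' < t → t < T →
      b (w (x, t)) - b (w (x, t')) - ∫ r in t'..t, D (x, r) ≤ ∫ r in t'..t, f (x, r)) :
    IsSubsolution p b a c T w ((closedBox T).indicator G) ((closedBox T).indicator f) := by
  intro t' t ht' htt ht φ q hφ
  rw [← sub_nonpos, integral_classical_residual hp hb hw hf hΦ hD hΦD hGΦ ha hac hc ht' htt ht hφ]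
  rw [intervalIntegral.integral_of_le hac.le]
  refine setIntegral_nonpos measurableSet_Ioc fun x hx => ?_
  have hx := Ioc_subset_Icc_self hx
  exact mul_nonpos_of_nonpos_of_nonneg (sub_nonpos.2 (hle x hx t' t ht' htt ht)) (hφ.nonneg x hx)

end

/-! ### The barrier as a supersolution, the profile as a stationary solution. -/

/-- The constant in the estimate of the flux of the barrier. -/
noncomputable def barrierConst (p α β : ℝ) : ℝ :=
  β * (p - 1) * α ^ (p - 2) * (sourceExponent p α + 1 + (β - α))

section

variable {p α β c T : ℝ}

lemma continuous_stationarySource (hp : 2 < p) (hα : 2 ≤ α) :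
    Continuous (stationarySource p α) := by
  have hm : 0 < sourceExponent p α := by unfold sourceExponent; nlinarith
  have h : Continuous fun x : ℝ => |x| ^ sourceExponent p α :=
    continuous_abs.rpow_const fun _ => Or.inr hm.le
  rw [funext fun x => (stationarySource_eq hp hα x).2.2]
  fun_prop

lemma barrierFluxDeriv_zero (hp : 2 < p) (hα : 2 ≤ α) (z : ℝ × ℝ) :
    barrierFluxDeriv p α β 0 z = -stationarySource p α z.1 := by
  rw [(stationarySource_eq hp hα z.1).2.2]
  simp [barrierFluxDeriv, barrierFactor]

lemma barrierFactor_nonneg (hα : 2 ≤ α) (hβ : α < β) (hc : 0 ≤ c) (hcT : c * β * T ≤ α)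
    {z : ℝ × ℝ} (hz : z ∈ closedBox T) : 0 ≤ barrierFactor α β c z := by
  have h1 : |z.1| ^ (β - α) ≤ 1 :=
    Real.rpow_le_one (abs_nonneg _) (abs_le.2 hz.1) (by linarith)
  have h2 : 0 ≤ c * β * z.2 := mul_nonneg (mul_nonneg hc (by linarith)) hz.2.1
  have h3 : c * β * z.2 ≤ c * β * T :=
    mul_le_mul_of_nonneg_left hz.2.2 (mul_nonneg hc (by linarith))
  unfold barrierFactor
  nlinarith

/-- The barrier almost solves the stationary equation. -/
lemma barrierFluxDeriv_le (hp : 2 < p) (hα : 2 ≤ α) (hαp : p / (p - 2) ≤ α) (hβ : α < β)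
    (hc : 0 ≤ c) (hcT : c * β * T ≤ α) {z : ℝ × ℝ} (hz : z ∈ closedBox T) :
    barrierFluxDeriv p α β c z
      ≤ -stationarySource p α z.1 + barrierConst p α β * c * z.2 * |z.1| ^ β := by
  have hm := le_sourceExponent hp hαp
  have hQ := barrierFactor_nonneg hα hβ hc hcT hz
  rw [(stationarySource_eq hp hα z.1).2.2]
  have hx0 := abs_nonneg z.1
  have hα0 : 0 < α := by linarith
  have hX0 : 0 ≤ |z.1| ^ (β - α) := Real.rpow_nonneg hx0 _
  have hl0 : 0 ≤ c * β * z.2 := mul_nonneg (mul_nonneg hc (by linarith)) hz.2.1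
  have hlX := mul_nonneg hl0 hX0
  have hQdef : barrierFactor α β c z = α * (1 + -(c * β * z.2 * |z.1| ^ (β - α) / α)) := by
    unfold barrierFactor; field_simp; ring
  have hs : -1 ≤ -(c * β * z.2 * |z.1| ^ (β - α) / α) := by
    rw [hQdef] at hQ
    have := nonneg_of_mul_nonneg_right hQ hα0
    linarith
  -- Bernoulli's inequality, available since `p - 1 ≥ 1`, bounds the loss in the leading term
  -- linearly in `c t |x|^(β-α)`.
  have hB := one_add_mul_self_le_rpow_one_add hs (show 1 ≤ p - 1 by linarith)
  have hA : α ^ (p - 1) = α ^ (p - 2) * α := by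
    rw [← Real.rpow_add_one hα0.ne']; ring_nf
  have hA0 : 0 < α ^ (p - 2) := Real.rpow_pos_of_pos hα0 _
  have h1 : α ^ (p - 1) - (p - 1) * α ^ (p - 2) * (c * β * z.2 * |z.1| ^ (β - α))
      ≤ barrierFactor α β c z ^ (p - 1) := by
    rw [hQdef, Real.mul_rpow hα0.le (by linarith), hA]
    refine le_trans (le_of_eq ?_) (mul_le_mul_of_nonneg_left hB (by positivity))
    field_simp
    ring
  have h2 : barrierFactor α β c z ^ (p - 2) ≤ α ^ (p - 2) :=
    Real.rpow_le_rpow hQ (by unfold barrierFactor; linarith) (by linarith)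
  have h3 : |z.1| ^ (sourceExponent p α + (β - α))
      = |z.1| ^ sourceExponent p α * |z.1| ^ (β - α) :=
    Real.rpow_add_of_nonneg hx0 (by linarith) (by linarith)
  -- Here `sourceExponent p α ≥ α` and `|x| ≤ 1` are used. Both error terms carry this power, and
  -- their coefficients add up to `barrierConst p α β * c * t`.
  have h4 : |z.1| ^ (sourceExponent p α + (β - α)) ≤ |z.1| ^ β :=
    Real.rpow_le_rpow_of_exponent_ge' hx0 (abs_le.2 hz.1) (by linarith) (by linarith)
  have hY0 : 0 ≤ |z.1| ^ sourceExponent p α := Real.rpow_nonneg hx0 _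
  have hK0 : 0 ≤ barrierConst p α β := by
    unfold barrierConst
    have : 0 ≤ p - 1 := by linarith
    have : 0 ≤ β := by linarith
    have : 0 ≤ sourceExponent p α + 1 + (β - α) := by linarith
    positivity
  have hm1 : 0 ≤ sourceExponent p α + 1 := by linarith
  have t1 := mul_le_mul_of_nonneg_left h1 (mul_nonneg hm1 hY0)
  have t2 : (p - 1) * (c * β * z.2) * (β - α) * |z.1| ^ (sourceExponent p α + (β - α))
      * barrierFactor α β c z ^ (p - 2)
      ≤ (p - 1) * (c * β * z.2) * (β - α) * |z.1| ^ (sourceExponent p α + (β - α))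
        * α ^ (p - 2) := by
    refine mul_le_mul_of_nonneg_left h2 ?_
    have : 0 ≤ p - 1 := by linarith
    have : 0 ≤ β - α := by linarith
    positivity
  have t3 := mul_le_mul_of_nonneg_left h4 (mul_nonneg (mul_nonneg hK0 hc) hz.2.1)
  unfold barrierFluxDeriv
  rw [h3] at t2 t3 ⊢
  unfold barrierConst at t3 ⊢
  nlinarith

lemma profile_nonneg (hα : 2 ≤ α) {x : ℝ} (hx : x ∈ Icc (-1 : ℝ) 1) : 0 ≤ profile α x := by
  have := Real.rpow_le_one (abs_nonneg x) (abs_le.2 hx) (show 0 ≤ α by linarith)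
  unfold profile; linarith

lemma profile_zero (hα : 2 ≤ α) : profile α 0 = 1 := by
  simp [profile, Real.zero_rpow (show α ≠ 0 by linarith)]

/-- The barrier is a supersolution for a short time. -/
lemma isSupersolution_barrier {k : ℝ} {b : ℝ → ℝ} (hp : 2 < p) (hα : 2 ≤ α)
    (hαp : p / (p - 2) ≤ α) (hβ : α < β) (hc : 0 ≤ c) (hcT : c * β * T ≤ α)
    (hKT : barrierConst p α β * c * T ≤ 1) (hb : Continuous b)
    (hbk : ∀ s r, 0 ≤ r → r ≤ s → k * (s - r) ≤ b s - b r) (hkc : 2 ≤ k * c) :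
    IsSupersolution p b (-1) 1 T (barrier α β c)
      ((closedBox T).indicator (barrierSlope α β c))
      ((closedBox T).indicator fun z => stationarySource p α z.1 + |z.1| ^ β) := by
  have hm := le_sourceExponent hp hαp
  have hm0 : 0 < sourceExponent p α := by linarith
  have hfs := continuous_stationarySource hp hα
  have hX : Continuous fun x : ℝ => |x| ^ β :=
    continuous_abs.rpow_const fun _ => Or.inr (by linarith)
  have hD := continuous_barrierFluxDeriv (c := c) hp hm0.le hβ
  refine isSupersolution_of_hasDerivAt hp hb (continuous_barrier hα hβ)
    ((hfs.comp continuous_fst).add (hX.comp continuous_fst)) (continuous_barrierFlux hp hm0.le hβ) hD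
    (hasDerivAt_barrierFlux hp hm0 hβ)
    (fun z hz => flux_barrierSlope hp (barrierFactor_nonneg hα hβ hc hcT hz)) le_rfl
    (by norm_num) le_rfl fun x hx t' t ht' htt ht => ?_
  have hX0 : 0 ≤ |x| ^ β := Real.rpow_nonneg (abs_nonneg x) _
  have hv : barrier α β c (x, t) - barrier α β c (x, t') = c * (t - t') * |x| ^ β := by
    simp only [barrier]; ring
  have h1 : k * (c * (t - t') * |x| ^ β) ≤ b (barrier α β c (x, t)) - b (barrier α β c (x, t')) := by
    rw [← hv]
    refine hbk _ _ (add_nonneg (profile_nonneg hα hx) (by positivity)) (sub_nonneg.1 ?_)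
    rw [hv]
    have : 0 ≤ t - t' := by linarith
    positivity
  have h2 : ∫ r in t'..t, barrierFluxDeriv p α β c (x, r)
      ≤ ∫ r in t'..t, (-stationarySource p α x + |x| ^ β) := by
    refine intervalIntegral.integral_mono_on htt.le
      (Continuous.intervalIntegrable (by fun_prop) _ _) (by simp) fun r hr => ?_
    have hz : (x, r) ∈ closedBox T := ⟨hx, ht'.trans hr.1, hr.2.trans ht.le⟩
    refine (barrierFluxDeriv_le hp hα hαp hβ hc hcT hz).trans ?_
    have hK0 : 0 ≤ barrierConst p α β := by
      unfold barrierConst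
      have : 0 ≤ p - 1 := by linarith
      have : 0 ≤ β := by linarith
      have : 0 ≤ sourceExponent p α + 1 + (β - α) := by linarith
      positivity
    have h3 : barrierConst p α β * c * r ≤ 1 :=
      (mul_le_mul_of_nonneg_left hz.2.2 (mul_nonneg hK0 hc)).trans hKT
    have := mul_le_mul_of_nonneg_right h3 hX0
    simp only
    linarith
  -- Of the two copies of `|x|^β` gained from the time increment, one pays for the flux error and
  -- the other for the perturbation in the source.
  have h4 := mul_le_mul_of_nonneg_right hkc (mul_nonneg (sub_nonneg.2 htt.le) hX0)
  simp only [intervalIntegral.integral_const, smul_eq_mul] at h2 ⊢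
  linarith

section Profile

variable {b : ℝ → ℝ} {a d : ℝ}

/-- For `c = 0` the barrier is constant in time, so the residual is exactly the stationary source.
Being an equality, it serves for both the sub- and the supersolution. -/
lemma integral_barrierFluxDeriv_zero (hp : 2 < p) (hα : 2 ≤ α) (x t' t : ℝ) :
    b (barrier α β 0 (x, t)) - b (barrier α β 0 (x, t'))
      - ∫ r in t'..t, barrierFluxDeriv p α β 0 (x, r) = ∫ _ in t'..t, stationarySource p α x := by
  simp only [barrierFluxDeriv_zero hp hα, intervalIntegral.integral_neg]
  simp [barrier]

/-- The profile is a stationary subsolution. -/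
lemma isSubsolution_profile (hp : 2 < p) (hα : 2 ≤ α) (hβ : α < β) (hb : Continuous b)
    (ha : -1 ≤ a) (had : a < d) (hd : d ≤ 1) :
    IsSubsolution p b a d T (barrier α β 0) ((closedBox T).indicator (barrierSlope α β 0))
      ((closedBox T).indicator fun z => stationarySource p α z.1) := by
  have hm : 0 < sourceExponent p α := by unfold sourceExponent; nlinarith
  have hfs := continuous_stationarySource hp hα
  exact isSubsolution_of_hasDerivAt hp hb (continuous_barrier hα hβ) (by fun_prop)
    (continuous_barrierFlux hp hm.le hβ) (continuous_barrierFluxDeriv hp hm.le hβ)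
    (hasDerivAt_barrierFlux hp hm hβ)
    (fun z hz => flux_barrierSlope hp
      (barrierFactor_nonneg hα hβ le_rfl (by simp; linarith) hz)) ha had hd
    fun x _ t' t _ _ _ => (integral_barrierFluxDeriv_zero hp hα x t' t).le

/-- The profile is a stationary supersolution. -/
lemma isSupersolution_profile (hp : 2 < p) (hα : 2 ≤ α) (hβ : α < β) (hb : Continuous b)
    (ha : -1 ≤ a) (had : a < d) (hd : d ≤ 1) :
    IsSupersolution p b a d T (barrier α β 0) ((closedBox T).indicator (barrierSlope α β 0))
      ((closedBox T).indicator fun z => stationarySource p α z.1) := by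
  have hm : 0 < sourceExponent p α := by unfold sourceExponent; nlinarith
  have hfs := continuous_stationarySource hp hα
  exact isSupersolution_of_hasDerivAt hp hb (continuous_barrier hα hβ) (by fun_prop)
    (continuous_barrierFlux hp hm.le hβ) (continuous_barrierFluxDeriv hp hm.le hβ)
    (hasDerivAt_barrierFlux hp hm hβ)
    (fun z hz => flux_barrierSlope hp
      (barrierFactor_nonneg hα hβ le_rfl (by simp; linarith) hz)) ha had hd
    fun x _ t' t _ _ _ => (integral_barrierFluxDeriv_zero hp hα x t' t).ge

end Profile

end

/-! ### Solutions trapped between the profile and the barrier. -/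

section

variable {p α β c T τ M k : ℝ} {b : ℝ → ℝ} {ψ H w g : ℝ × ℝ → ℝ}

/-- Sources with bounded measurable `ψ` have bounded measurable representatives. -/
lemma exists_isSource (hp : 2 < p) (hα : 2 ≤ α) (hβ : α < β)
    (hψ : AEStronglyMeasurable ψ (volume.restrict (cylinder T)))
    (hM : ∀ᵐ z ∂(volume.restrict (cylinder T)), |ψ z| ≤ M) :
    ∃ H, IsSource H ∧ ∀ᵐ z ∂(volume.restrict (cylinder T)), source p α β ψ z = H z := by
  have hfs := continuous_stationarySource hp hα
  have hX : Continuous fun x : ℝ => |x| ^ β :=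
    continuous_abs.rpow_const fun _ => Or.inr (by linarith)
  have hm := hψ.stronglyMeasurable_mk.measurable
  -- Clamping to `[-M,M]` turns the a.e. bound on `ψ` into one valid everywhere, without changing
  -- `ψ` almost everywhere.
  refine ⟨(closedBox T).indicator fun z => stationarySource p α z.1
    + |z.1| ^ β * max (-M) (min M (hψ.mk ψ z)), ⟨?_, ?_, ?_⟩, ?_⟩
  · have h1 := hfs.measurable
    have h2 := hX.measurable
    refine Measurable.indicator ?_ (measurableSet_closedBox T)
    exact (h1.comp measurable_fst).add ((h2.comp measurable_fst).mul
      (measurable_const.max (measurable_const.min hm)))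
  · obtain ⟨N, hN⟩ := (isCompact_closedBox T).exists_bound_of_continuousOn
      (hfs.comp continuous_fst).continuousOn
    refine ⟨max (N + |M|) 0, fun z => ?_⟩
    by_cases hz : z ∈ closedBox T
    · rw [indicator_of_mem hz]
      refine le_trans ?_ (le_max_left _ _)
      refine (abs_add_le _ _).trans (add_le_add (hN z hz) ?_)
      have h1 : |z.1| ^ β ≤ 1 := Real.rpow_le_one (abs_nonneg _) (abs_le.2 hz.1) (by linarith)
      have h2 : |max (-M) (min M (hψ.mk ψ z))| ≤ |M| :=
        abs_le.2 ⟨(neg_le_neg (le_abs_self M)).trans (le_max_left _ _),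
          max_le (neg_le_abs M) ((min_le_left _ _).trans (le_abs_self M))⟩
      rw [abs_mul, abs_of_nonneg (Real.rpow_nonneg (abs_nonneg _) _)]
      exact (mul_le_mul h1 h2 (abs_nonneg _) zero_le_one).trans_eq (one_mul _)
    · rw [indicator_of_notMem hz, abs_zero]; exact le_max_right _ _
  · exact HasCompactSupport.of_support_subset_isCompact (isCompact_closedBox T)
      support_indicator_subset
  · filter_upwards [hM, hψ.ae_eq_mk, ae_restrict_mem (measurableSet_cylinder T)] with z h1 h2 hz
    have hz' : z ∈ closedBox T := cylinder_subset T hz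
    rw [indicator_of_mem hz', ← h2, min_eq_right (abs_le.1 h1).2, max_eq_right (abs_le.1 h1).1,
      source]

lemma barrier_zero_time (x : ℝ) : barrier α β c (x, 0) = profile α x := by simp [barrier]

lemma barrier_zero_slope (z : ℝ × ℝ) : barrier α β 0 z = profile α z.1 := by simp [barrier]

lemma profile_neg_one : profile α (-1) = 0 := by simp [profile]

lemma profile_one : profile α 1 = 0 := by simp [profile]

/-- Solutions with small source stay above the profile, and touch it at the origin. -/
lemma IntegratedSolution.profile_le_and_eq (hs : IntegratedSolution p b T w g H) (hp : 2 < p)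
    (hα : 2 ≤ α) (hαp : p / (p - 2) ≤ α) (hβ : α < β) (hb : Continuous b) (hbm : StrictMono b)
    (hc : 0 ≤ c) (hτ : 0 < τ) (hτT : τ < T) (hcτ : c * β * τ ≤ α)
    (hKτ : barrierConst p α β * c * τ ≤ 1)
    (hbk : ∀ s r, 0 ≤ r → r ≤ s → k * (s - r) ≤ b s - b r) (hkc : 2 ≤ k * c)
    (hini : ∀ x ∈ Icc (-1 : ℝ) 1, w (x, 0) = profile α x)
    (hH : ∀ᵐ z ∂(volume.restrict (cylinder τ)), DoublyNonlinear.source p α β ψ z = H z)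
    (hψ : ∀ᵐ z ∂(volume.restrict (cylinder τ)), 0 ≤ ψ z ∧ ψ z ≤ 1) :
    (∀ x ∈ Icc (-1 : ℝ) 1, ∀ t ∈ Ioo 0 τ, profile α x ≤ w (x, t)) ∧
    ∀ t ∈ Icc 0 τ, w (0, t) = 1 := by
  have hfs := continuous_stationarySource hp hα
  have hX : Continuous fun x : ℝ => |x| ^ β :=
    continuous_abs.rpow_const fun _ => Or.inr (by linarith)
  have hE := hs.energy.mono hτT.le hp le_rfl (by norm_num) le_rfl
  have hlow : ∀ x ∈ Icc (-1 : ℝ) 1, ∀ t ∈ Ioo 0 τ, barrier α β 0 (x, t) ≤ w (x, t) := by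
    refine comparison hp (by norm_num) hb hbm
      (energyPair_of_hasDerivAt (T := τ) (continuous_barrier hα hβ) (continuous_barrierSlope hα hβ)
        (hasDerivAt_barrier hα hβ) le_rfl le_rfl) hE (fun t _ s hs' => ?_) (fun t _ s hs' => ?_)
      (fun x hx => ?_) (isSource_indicator (by fun_prop)) hs.source
      (isSubsolution_profile hp hα hβ hb le_rfl (by norm_num) le_rfl)
      (fun t' t h1 h2 h3 =>
        hs.isSupersolution hp hb le_rfl (by norm_num) le_rfl t' t h1 h2 (h3.trans hτT)) ?_
    · rw [hs.left s ⟨hs'.1, hs'.2.trans hτT.le⟩, barrier_zero_slope, profile_neg_one]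
    · rw [hs.right s ⟨hs'.1, hs'.2.trans hτT.le⟩, barrier_zero_slope, profile_one]
    · rw [barrier_zero_slope, hini x hx]
    · filter_upwards [hH, hψ, ae_restrict_mem (measurableSet_cylinder τ)] with z h1 h2 hz
      have hz' : z ∈ closedBox τ := cylinder_subset τ hz
      rw [indicator_of_mem hz', ← h1, DoublyNonlinear.source]
      exact le_add_of_nonneg_right (mul_nonneg (Real.rpow_nonneg (abs_nonneg _) _) h2.1)
  have hupp : ∀ x ∈ Icc (-1 : ℝ) 1, ∀ t ∈ Ioo 0 τ, w (x, t) ≤ barrier α β c (x, t) := by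
    refine comparison hp (by norm_num) hb hbm hE
      (energyPair_of_hasDerivAt (T := τ) (continuous_barrier hα hβ) (continuous_barrierSlope hα hβ)
        (hasDerivAt_barrier hα hβ) le_rfl le_rfl) (fun t ht s hs' => ?_) (fun t ht s hs' => ?_)
      (fun x hx => ?_) hs.source
      (isSource_indicator ((hfs.comp continuous_fst).add (hX.comp continuous_fst)))
      (fun t' t h1 h2 h3 =>
        hs.isSubsolution hp hb le_rfl (by norm_num) le_rfl t' t h1 h2 (h3.trans hτT))
      (isSupersolution_barrier hp hα hαp hβ hc hcτ hKτ hb hbk hkc) ?_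
    · rw [hs.left t ⟨ht.1, ht.2.trans hτT.le⟩, barrier, profile_neg_one]
      have := hs'.1
      positivity
    · rw [hs.right t ⟨ht.1, ht.2.trans hτT.le⟩, barrier, profile_one]
      have := hs'.1
      positivity
    · rw [barrier_zero_time, hini x hx]
    · filter_upwards [hH, hψ, ae_restrict_mem (measurableSet_cylinder τ)] with z h1 h2 hz
      have hz' : z ∈ closedBox τ := cylinder_subset τ hz
      rw [indicator_of_mem hz', ← h1, DoublyNonlinear.source]
      exact add_le_add le_rfl
        (mul_le_of_le_one_right (Real.rpow_nonneg (abs_nonneg _) _) h2.2)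
  refine ⟨fun x hx t ht => (barrier_zero_slope (β := β) (x, t)).symm.trans_le (hlow x hx t ht), ?_⟩
  have hw := hs.energy.cont
  -- Comparison gives the value at open times only; the closed interval is needed when `x = 0`
  -- becomes a lateral boundary.
  have hcl : IsClosed {t : ℝ | w (0, t) = 1} := isClosed_eq (by fun_prop) continuous_const
  have hsub : Ioo 0 τ ⊆ {t : ℝ | w (0, t) = 1} := fun t ht => by
    have h0 : (0 : ℝ) ∈ Icc (-1 : ℝ) 1 := by norm_num
    have h1 := hlow 0 h0 t ht
    have h2 := hupp 0 h0 t ht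
    rw [barrier_zero_slope] at h1
    rw [barrier, abs_zero, Real.zero_rpow (by linarith), mul_zero, add_zero] at h2
    rw [mem_ofPred_eq, ← profile_zero hα]
    exact le_antisymm h2 h1
  have := closure_minimal hsub hcl
  rwa [closure_Ioo hτ.ne] at this

/-- Where the perturbation vanishes on the left half, the solution agrees with the profile. -/
lemma IntegratedSolution.le_profile_left (hs : IntegratedSolution p b T w g H) (hp : 2 < p)
    (hα : 2 ≤ α) (hβ : α < β) (hb : Continuous b) (hbm : StrictMono b) (hτT : τ < T)
    (hini : ∀ x ∈ Icc (-1 : ℝ) 1, w (x, 0) = profile α x)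
    (hzero : ∀ t ∈ Icc 0 τ, w (0, t) = 1)
    (hH : ∀ᵐ z ∂(volume.restrict (cylinder τ)), DoublyNonlinear.source p α β ψ z = H z)
    (hψ : ∀ᵐ z ∂(volume.restrict (Ioo (-1 : ℝ) 0 ×ˢ Ioo 0 τ)), ψ z = 0) :
    ∀ x ∈ Icc (-1 : ℝ) 0, ∀ t ∈ Ioo 0 τ, w (x, t) ≤ profile α x := by
  have hfs := continuous_stationarySource hp hα
  have hE := hs.energy.mono hτT.le hp (a := -1) (c := 0) le_rfl (by norm_num) (by norm_num)
  have hupp : ∀ x ∈ Icc (-1 : ℝ) 0, ∀ t ∈ Ioo 0 τ, w (x, t) ≤ barrier α β 0 (x, t) := by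
    refine comparison hp (by norm_num) hb hbm hE
      (energyPair_of_hasDerivAt (T := τ) (continuous_barrier hα hβ) (continuous_barrierSlope hα hβ)
        (hasDerivAt_barrier hα hβ) le_rfl (by norm_num)) (fun t ht s _ => ?_) (fun t ht s _ => ?_)
      (fun x hx => ?_) hs.source (isSource_indicator (by fun_prop))
      (fun t' t h1 h2 h3 =>
        hs.isSubsolution hp hb le_rfl (by norm_num) (by norm_num) t' t h1 h2 (h3.trans hτT))
      (isSupersolution_profile hp hα hβ hb le_rfl (by norm_num) (by norm_num)) ?_
    · rw [hs.left t ⟨ht.1, ht.2.trans hτT.le⟩, barrier_zero_slope, profile_neg_one]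
    · rw [hzero t ht, barrier_zero_slope, profile_zero hα]
    · rw [barrier_zero_slope, hini x ⟨hx.1, hx.2.trans zero_le_one⟩]
    · have hsub : Ioo (-1 : ℝ) 0 ×ˢ Ioo 0 τ ⊆ cylinder τ :=
        prod_mono (Ioo_subset_Ioo_right zero_le_one) subset_rfl
      filter_upwards [ae_restrict_of_ae_restrict_of_subset hsub hH, hψ,
        ae_restrict_mem (measurableSet_Ioo.prod measurableSet_Ioo)] with z h1 h2 hz
      have hz' : z ∈ closedBox τ := cylinder_subset τ (hsub hz)
      rw [indicator_of_mem hz', ← h1, DoublyNonlinear.source, h2, mul_zero, add_zero]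
  exact fun x hx t ht => (hupp x hx t ht).trans_eq (barrier_zero_slope _)

end

/-! ### Equality of sources from equality of solutions, and the short time. -/

/-- Primitives determine integrable functions. -/
lemma ae_eq_of_primitive_eq {f₁ f₂ : ℝ → ℝ} {a c : ℝ} (hac : a ≤ c)
    (h₁ : IntervalIntegrable f₁ volume a c) (h₂ : IntervalIntegrable f₂ volume a c)
    (h : ∀ x ∈ Icc a c, ∫ y in a..x, f₁ y = ∫ y in a..x, f₂ y) :
    ∀ᵐ x ∂(volume.restrict (Ioo a c)), f₁ x = f₂ x := by
  rw [ae_restrict_iff' measurableSet_Ioo]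
  filter_upwards [h₁.ae_hasDerivAt_integral, h₂.ae_hasDerivAt_integral] with x d₁ d₂ hx
  have hxI : x ∈ uIcc a c := by rw [uIcc_of_le hac]; exact Ioo_subset_Icc_self hx
  refine (d₁ hxI a left_mem_uIcc).unique ((d₂ hxI a left_mem_uIcc).congr_of_eventuallyEq ?_)
  filter_upwards [isOpen_Ioo.mem_nhds hx] with y hy using h y (Ioo_subset_Icc_self hy)

/-- Equal solutions have equal sources, if the sources are ordered. -/
lemma IntegratedSolution.source_ae_eq {p T τ T' : ℝ} {b : ℝ → ℝ} {w₁ w₂ g₁ g₂ H₁ H₂ : ℝ × ℝ → ℝ}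
    (hp : 2 < p) (hb : Continuous b) (h₁ : IntegratedSolution p b T w₁ g₁ H₁)
    (h₂ : IntegratedSolution p b T w₂ g₂ H₂) (hτ : 0 < τ) (hτT' : τ < T') (hT' : T' ≤ T)
    (hH : ∀ᵐ z ∂(volume.restrict (cylinder τ)), H₁ z ≤ H₂ z)
    (hw : ∀ x ∈ Icc (-1 : ℝ) 1, ∀ t ∈ Icc 0 T', w₁ (x, t) = w₂ (x, t)) :
    ∀ᵐ z ∂(volume.restrict (cylinder τ)), H₁ z = H₂ z := by
  have hp1 : 1 ≤ ENNReal.ofReal p := by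
    rw [← ENNReal.ofReal_one]; exact ENNReal.ofReal_le_ofReal (by linarith)
  have hg : ∀ᵐ t ∂(volume.restrict (Ioo 0 τ)), ∀ᵐ x ∂(volume.restrict (Ioo (-1) 1)),
      g₁ (x, t) = g₂ (x, t) := by
    have hsub : Ioo 0 τ ⊆ Ioo 0 T := Ioo_subset_Ioo_right (hτT'.le.trans hT')
    filter_upwards [ae_restrict_of_ae_restrict_of_subset hsub h₁.energy.primitive,
      ae_restrict_of_ae_restrict_of_subset hsub h₂.energy.primitive,
      ae_restrict_of_ae (h₁.energy.ae_memLp_slice hp),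
      ae_restrict_of_ae (h₂.energy.ae_memLp_slice hp),
      ae_restrict_mem measurableSet_Ioo] with t e₁ e₂ m₁ m₂ ht
    have ht' : t ∈ Icc 0 T' := ⟨ht.1.le, ht.2.le.trans hτT'.le⟩
    refine ae_eq_of_primitive_eq (by norm_num) ?_ ?_ fun x hx => ?_
    · rw [intervalIntegrable_iff, uIoc]; exact (m₁.restrict _).integrable hp1
    · rw [intervalIntegrable_iff, uIoc]; exact (m₂.restrict _).integrable hp1
    · have a₁ := e₁ x hx
      have a₂ := e₂ x hx
      rw [hw x hx t ht', hw (-1) (by simp) t ht', a₂] at a₁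
      linarith
  have hms : MeasurableSet {z : ℝ × ℝ | g₁ (z.1, z.2) = g₂ (z.1, z.2)} :=
    measurableSet_eq_fun h₁.energy.meas h₂.energy.meas
  rw [← Measure.ae_ae_comm (p := fun x t => g₁ (x, t) = g₂ (x, t)) hms] at hg
  obtain ⟨κ₁, e₁⟩ := h₁.eq 0 τ le_rfl hτ (hτT'.trans_le hT')
  obtain ⟨κ₂, e₂⟩ := h₂.eq 0 τ le_rfl hτ (hτT'.trans_le hT')
  have hc₁ := h₁.energy.cont
  have hc₂ := h₂.energy.cont
  have i₁ := h₁.source.intervalIntegrable_timeIntegral 0 τ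
  have i₂ := h₂.source.intervalIntegrable_timeIntegral 0 τ
  set D₁ : ℝ → ℝ := fun y => b (w₁ (y, τ)) - b (w₁ (y, 0)) - ∫ r in 0..τ, H₁ (y, r) with hD₁
  set D₂ : ℝ → ℝ := fun y => b (w₂ (y, τ)) - b (w₂ (y, 0)) - ∫ r in 0..τ, H₂ (y, r) with hD₂
  have j₁ : ∀ u v, IntervalIntegrable D₁ volume u v := fun u v =>
    (Continuous.intervalIntegrable (by fun_prop) u v).sub (i₁ u v)
  have j₂ : ∀ u v, IntervalIntegrable D₂ volume u v := fun u v =>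
    (Continuous.intervalIntegrable (by fun_prop) u v).sub (i₂ u v)
  have hκ : ∀ x ∈ Icc (-1 : ℝ) 1, κ₁ + ∫ y in (-1)..x, D₁ y = κ₂ + ∫ y in (-1)..x, D₂ y := by
    have h1 : (fun x => κ₁ + ∫ y in (-1)..x, D₁ y) =ᵐ[volume.restrict (Icc (-1) 1)]
        fun x => κ₂ + ∫ y in (-1)..x, D₂ y := by
      rw [← Measure.restrict_congr_set (Ioo_ae_eq_Icc (μ := volume) (a := (-1 : ℝ)) (b := 1))]
      filter_upwards [e₁, e₂, hg] with x a₁ a₂ hx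
      rw [← a₁, ← a₂, intervalIntegral.integral_of_le hτ.le, intervalIntegral.integral_of_le hτ.le,
        integral_Ioc_eq_integral_Ioo, integral_Ioc_eq_integral_Ioo]
      exact integral_congr_ae (hx.mono fun r hr => by simp only [hr])
    exact Measure.eqOn_Icc_of_ae_eq volume (by norm_num) h1
      (continuous_const.add (intervalIntegral.continuous_primitive j₁ _)).continuousOn
      (continuous_const.add (intervalIntegral.continuous_primitive j₂ _)).continuousOn
  -- The endpoint `x = -1` equates the constants, and `x = 1` then equates the total integrals. The
  -- primitive form thus allows the constant function as a test, although it does not vanish on the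
  -- lateral boundary.
  have k0 := hκ (-1) (by simp)
  have k1 := hκ 1 (by simp)
  rw [intervalIntegral.integral_same, intervalIntegral.integral_same] at k0
  have k2 : ∫ y in (-1)..1, ((∫ r in 0..τ, H₂ (y, r)) - ∫ r in 0..τ, H₁ (y, r)) = 0 := by
    have : ∫ y in (-1)..1, ((∫ r in 0..τ, H₂ (y, r)) - ∫ r in 0..τ, H₁ (y, r))
        = ∫ y in (-1)..1, (D₁ y - D₂ y) := by
      refine intervalIntegral.integral_congr fun y hy => ?_
      rw [uIcc_of_le (by norm_num)] at hy
      simp only [hD₁, hD₂]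
      rw [hw y hy τ ⟨hτ.le, hτT'.le⟩, hw y hy 0 ⟨le_rfl, (hτ.trans hτT').le⟩]
      ring
    rw [this, intervalIntegral.integral_sub (j₁ _ _) (j₂ _ _)]
    linarith
  have m₁ : IntegrableOn H₁ (cylinder τ) := ((h₁.source.memLp 1).restrict _).integrable le_rfl
  have m₂ : IntegrableOn H₂ (cylinder τ) := ((h₂.source.memLp 1).restrict _).integrable le_rfl
  have k3 : ∫ z in cylinder τ, (H₂ z - H₁ z) = 0 := by
    have hI : IntegrableOn (fun z => H₂ z - H₁ z) (cylinder τ) := m₂.sub m₁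
    rw [IntegrableOn, restrict_cylinder] at hI
    rw [← k2, restrict_cylinder, integral_prod _ hI,
      intervalIntegral.integral_of_le (by norm_num), integral_Ioc_eq_integral_Ioo]
    refine integral_congr_ae (.of_forall fun x => ?_)
    beta_reduce
    rw [← intervalIntegral.integral_sub (h₂.source.intervalIntegrable_slice x 0 τ)
      (h₁.source.intervalIntegrable_slice x 0 τ), intervalIntegral.integral_of_le hτ.le,
      integral_Ioc_eq_integral_Ioo]
  have k4 := (integral_eq_zero_iff_of_nonneg_ae (hH.mono fun z hz => sub_nonneg.2 hz)
    (m₂.sub m₁)).1 k3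
  exact k4.mono fun z hz => (sub_eq_zero.1 hz).symm

/-- A lower bound for the derivative bounds the increments from below. -/
lemma mul_sub_le_sub_of_lt_deriv {b : ℝ → ℝ} {k : ℝ} (hb : ContinuousOn b (Ici 0))
    (hb' : ContDiffOn ℝ 1 b (Ioi 0)) (hk : ∀ s : ℝ, 0 < s → k < deriv b s) (s r : ℝ) (hr : 0 ≤ r)
    (hrs : r ≤ s) : k * (s - r) ≤ b s - b r := by
  refine (convex_Ici (0 : ℝ)).mul_sub_le_image_sub_of_le_deriv hb ?_ ?_ r hr s (hr.trans hrs) hrs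
  · rw [interior_Ici]; exact hb'.differentiableOn (by norm_num)
  · rw [interior_Ici]; exact fun x hx => (hk x hx).le

/-- A short time on which the barrier is a supersolution. -/
lemma exists_short_time {p α β c T : ℝ} (hp : 2 < p) (hα : 2 ≤ α) (hαp : p / (p - 2) ≤ α)
    (hβ : α < β) (hc : 0 < c) (hT : 0 < T) :
    ∃ τ, 0 < τ ∧ τ < T ∧ τ ≤ 1 ∧ c * β * τ ≤ α ∧ barrierConst p α β * c * τ ≤ 1 := by
  have hm := le_sourceExponent hp hαp
  have hK : 0 < barrierConst p α β * c := by
    unfold barrierConst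
    have : 0 < p - 1 := by linarith
    have : 0 < α := by linarith
    have : 0 < β := by linarith
    have : 0 < sourceExponent p α + 1 + (β - α) := by linarith
    positivity
  have hcβ : 0 < c * β := mul_pos hc (by linarith)
  -- Besides `τ < T` and `τ ≤ 1`, the bound by `α / (c * β)` keeps the barrier factor nonnegative,
  -- and the last one keeps the flux error below `|x|^β`.
  refine ⟨min (T / 2) (min 1 (min (α / (c * β)) (1 / (barrierConst p α β * c)))), ?_, ?_, ?_, ?_,
    ?_⟩
  · have : 0 < α := by linarith
    positivity
  · exact (min_le_left _ _).trans_lt (by linarith)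
  · exact (min_le_right _ _).trans (min_le_left _ _)
  · rw [mul_comm, ← le_div_iff₀ hcβ]
    exact ((min_le_right _ _).trans (min_le_right _ _)).trans (min_le_left _ _)
  · rw [mul_comm, ← le_div_iff₀ hK]
    exact ((min_le_right _ _).trans (min_le_right _ _)).trans (min_le_right _ _)

end DoublyNonlinear

/-! ### Failure of the strong comparison principle. -/

open DoublyNonlinear

theorem mainTheorem1 (p α β γ k : ℝ) (hp : 2 < p) (hα : max 2 (p / (p - 2)) ≤ α)
    (hαβ : α < β) (hγ : γ = β - α) (hk : 0 < k) :
    (∀ x ∈ Ioo (-1 : ℝ) 1,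
      DifferentiableAt ℝ (DoublyNonlinear.profile α) x ∧
      DifferentiableAt ℝ
        (fun y => DoublyNonlinear.flux p (deriv (DoublyNonlinear.profile α) y)) x ∧
      DoublyNonlinear.stationarySource p α x
        = (p - 1) * α ^ (p - 1) * (α - 1) * |x| ^ ((α - 1) * (p - 2) + α - 2)) ∧
    ∃ C₀ : ℝ, 0 < C₀ ∧ ∀ C : ℝ, 0 < C → C ≤ C₀ →
      ∀ b : ℝ → ℝ, ContinuousOn b (Ici 0) → b 0 = 0 → ContDiffOn ℝ 1 b (Ioi 0) →
        (∀ s : ℝ, 0 < s → k < deriv b s) →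
      ∀ T : ℝ, 0 < T →
      ∀ ψ₁ ψ₂ : ℝ × ℝ → ℝ,
        MemLp ψ₁ ⊤ (volume.restrict (DoublyNonlinear.cylinder T)) →
        MemLp ψ₂ ⊤ (volume.restrict (DoublyNonlinear.cylinder T)) →
        (∀ᵐ z ∂(volume.restrict (DoublyNonlinear.cylinder T)),
          0 ≤ ψ₁ z ∧ ψ₁ z ≤ ψ₂ z ∧
            ψ₂ z ≤ 1 / 2 * |z.1| ^ β * (1 - |z.1| ^ γ + C * z.2)) →
        (∀ τ ∈ Ioo 0 T,
          ¬ ∀ᵐ z ∂(volume.restrict (DoublyNonlinear.cylinder τ)), ψ₁ z = ψ₂ z) →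
      ∀ w₁ w₂ : ℝ × ℝ → ℝ,
        ContinuousOn w₁ (Icc (-1) 1 ×ˢ Icc 0 T) →
        ContinuousOn w₂ (Icc (-1) 1 ×ˢ Icc 0 T) →
        DoublyNonlinear.IsWeakSolution p b T (DoublyNonlinear.source p α β ψ₁)
          (DoublyNonlinear.profile α) w₁ →
        DoublyNonlinear.IsWeakSolution p b T (DoublyNonlinear.source p α β ψ₂)
          (DoublyNonlinear.profile α) w₂ →
      ∃ t₀ ∈ Ioo 0 T,
        (∀ x ∈ Ioo (-1 : ℝ) 1, ∀ t ∈ Ioo 0 t₀, w₁ (x, t) ≤ w₂ (x, t)) ∧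
        (∃ x ∈ Ioo (-1 : ℝ) 1, ∃ t ∈ Ioo 0 t₀, w₁ (x, t) ≠ w₂ (x, t)) ∧
        (∀ t ∈ Ioo 0 t₀, w₁ (0, t) = w₂ (0, t)) ∧
        ((∀ᵐ z ∂(volume.restrict (Ioo (-1 : ℝ) 0 ×ˢ Ioo 0 t₀)), ψ₁ z = 0 ∧ ψ₂ z = 0) →
          (∀ x ∈ Ioc (-1 : ℝ) 0, ∀ t ∈ Ioo 0 t₀,
            w₁ (x, t) = DoublyNonlinear.profile α x ∧
            w₂ (x, t) = DoublyNonlinear.profile α x) ∧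
          ∃ x ∈ Ioo (0 : ℝ) 1, ∃ t ∈ Ioo 0 t₀, w₁ (x, t) ≠ w₂ (x, t)) := by
  obtain ⟨hα2, hαp⟩ := max_le_iff.1 hα
  -- The value `C₀ = 1` suffices: with `C ≤ 1` and `τ ≤ 1`, the bound `(1 + C t) / 2` on the
  -- perturbations is at most `1` up to time `τ`.
  refine ⟨fun x _ => ?_, 1, one_pos, ?_⟩
  · obtain ⟨h1, h2, h3⟩ := stationarySource_eq hp hα2 x
    refine ⟨h1, h2, h3.trans ?_⟩
    have e : sourceExponent p α + 1 = (α - 1) * (p - 1) := by unfold sourceExponent; ring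
    rw [e, sourceExponent]
    ring
  intro C hC hC1 b hbc _ hb1 hbk T hT ψ₁ ψ₂ hψ₁ hψ₂ hψ hne w₁ w₂ hw₁ hw₂ hs₁ hs₂
  have hbk' := mul_sub_le_sub_of_lt_deriv hbc hb1 hbk
  have hbm : StrictMonoOn b (Ici 0) := fun r hr s _ hrs => by
    have h1 := hbk' s r hr hrs.le
    have h2 := mul_pos hk (sub_pos.2 hrs)
    linarith
  have hB := continuous_extendLaw hbc
  have hBm := strictMono_extendLaw hbm
  have hBk : ∀ s r, 0 ≤ r → r ≤ s → k * (s - r) ≤ extendLaw b s - extendLaw b r :=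
    fun s r hr hrs => by
      rw [extendLaw_of_nonneg b hr, extendLaw_of_nonneg b (hr.trans hrs)]
      exact hbk' s r hr hrs
  have hbound : ∀ z ∈ cylinder T, ψ₂ z ≤ 1 / 2 * |z.1| ^ β * (1 - |z.1| ^ γ + C * z.2) →
      ψ₂ z ≤ 1 / 2 * (1 + C * z.2) := fun z hz h => by
    have hx : |z.1| ≤ 1 := abs_le.2 ⟨hz.1.1.le, hz.1.2.le⟩
    have h1 : |z.1| ^ β ≤ 1 := Real.rpow_le_one (abs_nonneg _) hx (by linarith)
    have h2 : 0 ≤ |z.1| ^ β := Real.rpow_nonneg (abs_nonneg _) _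
    have h3 : 0 ≤ |z.1| ^ γ := Real.rpow_nonneg (abs_nonneg _) _
    have h4 : 0 ≤ C * z.2 := mul_nonneg hC.le hz.2.1.le
    nlinarith
  have hM : ∀ᵐ z ∂(volume.restrict (cylinder T)),
      |ψ₁ z| ≤ 1 / 2 * (1 + C * T) ∧ |ψ₂ z| ≤ 1 / 2 * (1 + C * T) := by
    filter_upwards [hψ, ae_restrict_mem (measurableSet_cylinder T)] with z h hz
    have h1 := hbound z hz h.2.2
    have h2 := mul_le_mul_of_nonneg_left hz.2.2.le hC.le
    constructor <;> rw [abs_le] <;> constructor <;> linarith [h.1, h.2.1]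
  obtain ⟨H₁, hH₁, hH₁e⟩ := exists_isSource (p := p) hp hα2 hαβ hψ₁.aestronglyMeasurable
    (hM.mono fun z h => h.1)
  obtain ⟨H₂, hH₂, hH₂e⟩ := exists_isSource (p := p) hp hα2 hαβ hψ₂.aestronglyMeasurable
    (hM.mono fun z h => h.2)
  have hu := (continuous_profile hα2).continuousOn (s := Icc (-1) 1)
  have hu0 : ∀ x ∈ Icc (-1 : ℝ) 1, 0 ≤ profile α x := fun x hx => profile_nonneg hα2 hx
  obtain ⟨-, hi₁, g₁, S₁⟩ := hs₁.exists_integratedSolution hp hT hbc hbm hw₁ hH₁ hH₁e hu hu0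
  obtain ⟨-, hi₂, g₂, S₂⟩ := hs₂.exists_integratedSolution hp hT hbc hbm hw₂ hH₂ hH₂e hu hu0
  have hW : ∀ w : ℝ × ℝ → ℝ, ∀ x ∈ Icc (-1 : ℝ) 1, ∀ t ∈ Icc 0 T,
      clampExtend T w (x, t) = w (x, t) := fun w x hx t ht => clampExtend_eq hx ht
  have h0T : (0 : ℝ) ∈ Icc 0 T := ⟨le_rfl, hT.le⟩
  have hi₁' : ∀ x ∈ Icc (-1 : ℝ) 1, clampExtend T w₁ (x, 0) = profile α x := fun x hx => by
    rw [hW w₁ x hx 0 h0T, hi₁ x hx]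
  have hi₂' : ∀ x ∈ Icc (-1 : ℝ) 1, clampExtend T w₂ (x, 0) = profile α x := fun x hx => by
    rw [hW w₂ x hx 0 h0T, hi₂ x hx]
  -- The barrier speed `c = 2/k` makes `k * c = 2`, as the supersolution estimate requires.
  have hc : 0 < 2 / k := by positivity
  obtain ⟨τ, hτ, hτT, hτ1, hcτ, hKτ⟩ := exists_short_time hp hα2 hαp hαβ hc hT
  have hkc : 2 ≤ k * (2 / k) := by field_simp; rfl
  have hsub : ∀ τ', τ' ≤ T → cylinder τ' ⊆ cylinder T := fun τ' h =>
    prod_mono subset_rfl (Ioo_subset_Ioo_right h)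
  have hψτ : ∀ᵐ z ∂(volume.restrict (cylinder τ)),
      (0 ≤ ψ₁ z ∧ ψ₁ z ≤ 1) ∧ (0 ≤ ψ₂ z ∧ ψ₂ z ≤ 1) := by
    filter_upwards [ae_restrict_of_ae_restrict_of_subset (hsub τ hτT.le) hψ,
      ae_restrict_mem (measurableSet_cylinder τ)] with z h hz
    have h1 := hbound z (hsub τ hτT.le hz) h.2.2
    have h2 : C * z.2 ≤ 1 := mul_le_one₀ hC1 hz.2.1.le (hz.2.2.le.trans hτ1)
    refine ⟨⟨?_, ?_⟩, ?_, ?_⟩ <;> linarith [h.1, h.2.1]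
  have hHe₁ := ae_restrict_of_ae_restrict_of_subset (hsub τ hτT.le) hH₁e
  have hHe₂ := ae_restrict_of_ae_restrict_of_subset (hsub τ hτT.le) hH₂e
  obtain ⟨low₁, zero₁⟩ := S₁.profile_le_and_eq hp hα2 hαp hαβ hB hBm hc.le hτ hτT hcτ hKτ hBk hkc
    hi₁' hHe₁ (hψτ.mono fun z h => h.1)
  obtain ⟨low₂, zero₂⟩ := S₂.profile_le_and_eq hp hα2 hαp hαβ hB hBm hc.le hτ hτT hcτ hKτ hBk hkc
    hi₂' hHe₂ (hψτ.mono fun z h => h.2)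
  have hHle : ∀ᵐ z ∂(volume.restrict (cylinder T)), H₁ z ≤ H₂ z := by
    filter_upwards [hH₁e, hH₂e, hψ] with z h1 h2 h
    rw [← h1, ← h2]
    exact add_le_add le_rfl
      (mul_le_mul_of_nonneg_left h.2.1 (Real.rpow_nonneg (abs_nonneg _) _))
  have hIcc : ∀ t ∈ Ioo 0 τ, t ∈ Icc 0 T := fun t ht => ⟨ht.1.le, (ht.2.trans hτT).le⟩
  have hle : ∀ x ∈ Icc (-1 : ℝ) 1, ∀ t ∈ Ioo 0 T,
      clampExtend T w₁ (x, t) ≤ clampExtend T w₂ (x, t) :=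
    comparison hp (by norm_num) hB hBm S₁.energy S₂.energy
      (fun t ht s hs => by rw [S₁.left t ht, S₂.left s hs])
      (fun t ht s hs => by rw [S₁.right t ht, S₂.right s hs])
      (fun x hx => by rw [hi₁' x hx, hi₂' x hx]) hH₁ hH₂
      (S₁.isSubsolution hp hB le_rfl (by norm_num) le_rfl)
      (S₂.isSupersolution hp hB le_rfl (by norm_num) le_rfl) hHle
  have hdiff : ∃ x ∈ Ioo (-1 : ℝ) 1, ∃ t ∈ Ioo 0 τ, w₁ (x, t) ≠ w₂ (x, t) := by
    by_contra! hcon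
    -- Half of `τ` leaves room for the strict inequality between the time of the sources and the
    -- time up to which the solutions agree.
    have hτ2 : τ / 2 ∈ Ioo 0 T := ⟨by linarith, by linarith⟩
    refine hne (τ / 2) hτ2 ?_
    have heq : ∀ z ∈ Icc (-1 : ℝ) 1 ×ˢ Icc 0 τ, clampExtend T w₁ z = clampExtend T w₂ z := by
      have hcl : IsClosed {z | clampExtend T w₁ z = clampExtend T w₂ z} :=
        isClosed_eq S₁.energy.cont S₂.energy.cont
      have hs : cylinder τ ⊆ {z | clampExtend T w₁ z = clampExtend T w₂ z} := fun z hz => by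
        have hx := Ioo_subset_Icc_self hz.1
        have ht := hIcc z.2 hz.2
        rw [mem_ofPred_eq, ← Prod.mk.eta (p := z), hW w₁ _ hx _ ht, hW w₂ _ hx _ ht]
        exact hcon _ hz.1 _ hz.2
      have h := closure_minimal hs hcl
      rw [DoublyNonlinear.cylinder, closure_prod_eq, closure_Ioo (by norm_num), closure_Ioo hτ.ne] at h
      exact h
    have hH := S₁.source_ae_eq hp hB S₂ hτ2.1 (half_lt_self hτ) hτT.le
      (ae_restrict_of_ae_restrict_of_subset (hsub _ hτ2.2.le) hHle)
      fun x hx t ht => heq (x, t) ⟨hx, ht⟩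
    -- Off the null set `x = 0` the factor `|x|^β` can be cancelled, so equal sources mean `ψ₁ = ψ₂`
    -- a.e., contrary to (ii).
    have hx0 : ∀ᵐ z ∂(volume.restrict (cylinder (τ / 2))), z.1 ≠ 0 := by
      rw [restrict_cylinder]
      exact Measure.quasiMeasurePreserving_fst.ae (ae_restrict_of_ae (Measure.ae_ne volume 0))
    filter_upwards [hH, hx0, ae_restrict_of_ae_restrict_of_subset (hsub _ hτ2.2.le) hH₁e,
      ae_restrict_of_ae_restrict_of_subset (hsub _ hτ2.2.le) hH₂e] with z h1 h2 h3 h4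
    rw [← h3, ← h4, source, source] at h1
    exact mul_left_cancel₀ (Real.rpow_pos_of_pos (abs_pos.2 h2) β).ne' (add_left_cancel h1)
  have h0 : (0 : ℝ) ∈ Icc (-1 : ℝ) 1 := by norm_num
  refine ⟨τ, ⟨hτ, hτT⟩, fun x hx t ht => ?_, hdiff, fun t ht => ?_, fun hzero => ?_⟩
  · have := hle x (Ioo_subset_Icc_self hx) t ⟨ht.1, ht.2.trans hτT⟩
    rwa [hW w₁ x (Ioo_subset_Icc_self hx) t (hIcc t ht),
      hW w₂ x (Ioo_subset_Icc_self hx) t (hIcc t ht)] at this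
  · rw [← hW w₁ 0 h0 t (hIcc t ht), ← hW w₂ 0 h0 t (hIcc t ht),
      zero₁ t (Ioo_subset_Icc_self ht), zero₂ t (Ioo_subset_Icc_self ht)]
  have hleft : ∀ x ∈ Ioc (-1 : ℝ) 0, ∀ t ∈ Ioo 0 τ,
      w₁ (x, t) = profile α x ∧ w₂ (x, t) = profile α x := by
    intro x hx t ht
    have hx' : x ∈ Icc (-1 : ℝ) 0 := Ioc_subset_Icc_self hx
    have hx1 : x ∈ Icc (-1 : ℝ) 1 := ⟨hx'.1, hx'.2.trans zero_le_one⟩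
    rw [← hW w₁ x hx1 t (hIcc t ht), ← hW w₂ x hx1 t (hIcc t ht)]
    exact ⟨(S₁.le_profile_left hp hα2 hαβ hB hBm hτT hi₁' zero₁ hHe₁
        (hzero.mono fun z h => h.1) x hx' t ht).antisymm (low₁ x hx1 t ht),
      (S₂.le_profile_left hp hα2 hαβ hB hBm hτT hi₂' zero₂ hHe₂
        (hzero.mono fun z h => h.2) x hx' t ht).antisymm (low₂ x hx1 t ht)⟩
  refine ⟨hleft, ?_⟩
  obtain ⟨x, hx, t, ht, hxt⟩ := hdiff
  rcases le_or_gt x 0 with hx0 | hx0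
  · obtain ⟨e₁, e₂⟩ := hleft x ⟨hx.1, hx0⟩ t ht
    exact absurd (e₁.trans e₂.symm) hxt
  · exact ⟨x, ⟨hx0, hx.2⟩, t, ht, hxt⟩
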